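/- For $x\in\mathbb R^3$ let $[x]_\times$ be the skew-symmetric matrix with $[x]_\times y=x\times y$, let $[\cdot]_\otimes$ be the inverse of $x\mapsto[x]_\times$ on skew-symmetric matrices, and for $X\in SO(3)$ let $|X|_I=\sqrt{\mathrm{tr}(I-X)/4}$. Equip $SO(3)$ with the Riemannian metric $\langle X\Omega_1,X\Omega_2\rangle_X=\mathrm{tr}(\Omega_1^\top\Omega_2)$; $\nabla$ denotes the gradient in the rotation variable, $\|\cdot\|_F$ the Frobenius norm. Let $\mathcal Q\subset\mathbb N$ be finite and $\mathcal D\subseteq SO(3)\times\mathcal Q$ with $\{I\}\times\mathcal Q\subseteq\mathcal D$. Let $\Phi:SO(3)\times\mathcal Q\to[0,\infty)$ be a potential function on $\mathcal D$: $\Phi(\cdot,q)$ is continuous for each $q$, $\Phi(I,q)=0$, $\Phi(X,q)>0$ for $X\neq I$, and $\Phi$ is differentiable in $X$ at the points of $\mathcal D$, with $\nabla\Phi(\cdot,q)$ continuous on $\{X:(X,q)\in\mathcal D\}$. Let $\gamma_P,\gamma_I,\delta>0$ and put $$\mathcal F=\{(X,q):\Phi(X,q)-\min_{p}\Phi(X,p)\le\delta\},\qquad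 \mathcal J=\{(X,q):\Phi(X,q)-\min_{p}\Phi(X,p)\ge\delta\}.$$ Assume that $\mathcal F\subseteq\mathcal D$ and that for some $\alpha_1,\dots,\alpha_4>0$ $$\alpha_1|X|_I^2\le\Phi(X,q)\le\alpha_2|X|_I^2\ \text{ on } SO(3)\times\mathcal Q,\qquad \alpha_3|X|_I^2\le\|\nabla\Phi(X,q)\|_F^2\le\alpha_4|X|_I^2\ \text{ on }\mathcal F .$$ Let $\dot R=R[\omega]_\times$ on $[t_0,\infty)$ with $\|\omega(t)\|\le c_\omega$, let $b_\omega\in\mathbb R^3$ be a constant gyro bias with $\|b_\omega\|\le\bar b_\omega$ for a known $\bar b_\omega$, and consider the hybrid observer with state $(\hat R,\hat b_\omega,q)\in SO(3)\times\mathbb R^3\times\mathcal Q$ and $\tilde R=R\hat R^\top$, $$\dot{\hat R}=\hat R\big[(\omega+b_\omega)-\hat b_\omega+\gamma_P\beta\big]_\times,\quad \dot{\hat b}_\omega=\mathrm{Proj}(-\gamma_I\beta,\hat b_\omega),\quad \dot q=0\quad\text{when }(\tilde R,q)\in\mathcal F,$$ $$q^+\in\arg\min_{p\in\mathcal Q}\Phi(\tilde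 R,p),\quad \hat R^+=\hat R,\quad \hat b_\omega^+=\hat b_\omega\quad\text{when }(\tilde R,q)\in\mathcal J,$$ where $\beta=\hat R^\top[\tilde R^\top\nabla\Phi(\tilde R,q)]_\otimes$, and $\mathrm{Proj}(\mu,\hat b)=\mu$ if $\|\hat b\|\le\bar b_\omega$ or $\hat b^\top\mu\le0$, and $\mathrm{Proj}(\mu,\hat b)=(I-\hat b\hat b^\top/\|\hat b\|^2)\mu$ otherwise. Solutions are hybrid arcs on hybrid time domains starting at $(t_0,0)$, locally absolutely continuous between jumps, that satisfy the differential equations almost everywhere; since $\mathrm{Proj}(\mu,\cdot)$ is discontinuous on the sphere $\|\hat b\|=\bar b_\omega$, the bias law is understood in the sense of Krasovskii, i.e. $\dot{\hat b}_\omega\in\bigcap_{\varepsilon>0}\overline{\mathrm{co}}\,\mathrm{Proj}\big(-\gamma_I\beta,B(\hat b_\omega,\varepsilon)\big)$. Let $e=(|\tilde R|_I,\|\hat b_\omega-b_\omega\|)^\top$. Then the equilibrium $e=0$ is uniformly globally exponentially stable and the number of jumps is bounded: for every $r\ge\bar b_\omega$ (in particular for $r=\bar b_\omega$) there are $k,\lambda>0$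 and $N\in\mathbb N$, depending only on $\Phi,\mathcal Q,\gamma_P,\gamma_I,\delta,\alpha_1,\dots,\alpha_4,\bar b_\omega,c_\omega$ and $r$, such that for all $t_0\in\mathbb R$, all $\omega$, $b_\omega$ and $R$ as above, and all solutions with $\|\hat b_\omega(t_0,0)\|\le r$ (with no restriction on $R(t_0)$, $\hat R(t_0,0)$, $q(t_0,0)$), $$\|\hat b_\omega(t,j)\|\le r,\qquad j\le N,\qquad \|e(t,j)\|\le k\,e^{-\lambda(t-t_0+j)}\|e(t_0,0)\|$$ for all $(t,j)$ in the domain of the solution; moreover, if the solution is maximal, it is complete (its hybrid time domain is unbounded). -/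

import Mathlib

open Set Filter Topology MeasureTheory

namespace HybridObserver

/-- Vectors of `ℝ³` with the Euclidean norm. -/
abbrev Vec3 : Type := EuclideanSpace ℝ (Fin 3)

/-- Real `3 × 3` matrices. -/
abbrev Mat3 : Type := Matrix (Fin 3) (Fin 3) ℝ

/-- The rotation group `SO(3)`, a set of matrices with the subspace topology. -/
abbrev SO3 : Type := ↥(Matrix.specialOrthogonalGroup (Fin 3) ℝ)

/-- The skew-symmetric matrix `[x]_×` of `y ↦ x × y`. -/
def skew (x : Vec3) : Mat3 :=
  !![0, -x 2, x 1; x 2, 0, -x 0; -x 1, x 0, 0]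

/-- The vector of the skew-symmetric part of a matrix; on skew-symmetric matrices it is the inverse
of `skew`. -/
noncomputable def vee (A : Mat3) : Vec3 :=
  !₂[(A 2 1 - A 1 2) / 2, (A 0 2 - A 2 0) / 2, (A 1 0 - A 0 1) / 2]

/-- The inner product `tr (Aᵀ B)` of matrices. -/
def matInner (A B : Mat3) : ℝ := (A.transpose * B).trace

/-- The Frobenius norm. -/
noncomputable def frobNorm (A : Mat3) : ℝ := Real.sqrt (matInner A A)

/-- The normalized distance `|X|_I = (tr (I - X) / 4)^(1/2)` of a rotation to the identity. -/
noncomputable def attNorm (X : SO3) : ℝ := Real.sqrt ((1 - (X : Mat3)).trace / 4)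

/-! ### Gradients and potential functions -/

/-- `f : SO(3) → ℝ` is differentiable at `R`, with Riemannian gradient `G` for the metric
`⟨R Ω₁, R Ω₂⟩ = tr (Ω₁ᵀ Ω₂)`: the matrix `G` is tangent to `SO(3)` at `R`, and
`f R' = f R + ⟨G, R' - R⟩ + o(‖R' - R‖)` as `R' → R` in `SO(3)`. -/
def HasGradientSO3 (f : SO3 → ℝ) (R : SO3) (G : Mat3) : Prop :=
  (∃ u : Vec3, G = (R : Mat3) * skew u) ∧
    (fun R' : SO3 => f R' - f R - matInner G ((R' : Mat3) - (R : Mat3)))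
      =o[𝓝 R] (fun R' : SO3 => frobNorm ((R' : Mat3) - (R : Mat3)))

open Classical in
/-- The Riemannian gradient of `f` at `R` (zero where `f` is not differentiable). -/
noncomputable def gradSO3 (f : SO3 → ℝ) (R : SO3) : Mat3 :=
  if h : ∃ G, HasGradientSO3 f R G then h.choose else 0

/-- `Φ` is a potential function on `𝒟 ⊆ SO(3) × 𝒬` with respect to `{I} × 𝒬`. -/
structure IsPotential {𝒬 : Finset ℕ} (Φ : SO3 → 𝒬 → ℝ) (𝒟 : Set (SO3 × 𝒬)) : Prop where
  continuous : ∀ q, Continuous fun R => Φ R q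
  one_mem : ∀ q, ((1 : SO3), q) ∈ 𝒟
  map_one : ∀ q, Φ 1 q = 0
  pos : ∀ R q, R ≠ 1 → 0 < Φ R q
  differentiable : ∀ x ∈ 𝒟, ∃ G, HasGradientSO3 (fun R => Φ R x.2) x.1 G
  continuousOn_grad : ∀ q, ContinuousOn (gradSO3 fun R => Φ R q) {R | (R, q) ∈ 𝒟}

/-- The flow set: `Φ(R̃, q) - min_p Φ(R̃, p) ≤ δ`. -/
def flowSet {𝒬 : Finset ℕ} (Φ : SO3 → 𝒬 → ℝ) (δ : ℝ) : Set (SO3 × 𝒬) :=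
  {x | Φ x.1 x.2 - ⨅ p, Φ x.1 p ≤ δ}

/-- The jump set: `Φ(R̃, q) - min_p Φ(R̃, p) ≥ δ`. -/
def jumpSet {𝒬 : Finset ℕ} (Φ : SO3 → 𝒬 → ℝ) (δ : ℝ) : Set (SO3 × 𝒬) :=
  {x | δ ≤ Φ x.1 x.2 - ⨅ p, Φ x.1 p}

/-! ### The projection operator -/

open Classical in
/-- The projection `Proj(μ, b̂) = p(b̂) μ` with the bound `bbar`: `p = I` if `‖b̂‖ ≤ bbar` or
`b̂ᵀ μ ≤ 0`, and `p = I - b̂ b̂ᵀ / ‖b̂‖²` otherwise. -/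
noncomputable def proj (bbar : ℝ) (μ bh : Vec3) : Vec3 :=
  if ‖bh‖ ≤ bbar ∨ inner ℝ bh μ ≤ 0 then μ else μ - (inner ℝ bh μ / ‖bh‖ ^ 2) • bh

/-- The Krasovskii regularization of a (possibly discontinuous) vector field. -/
def krasovskii (f : Vec3 → Vec3) (x : Vec3) : Set Vec3 :=
  ⋂ ε ∈ Ioi (0 : ℝ), closure (convexHull ℝ (f '' Metric.ball x ε))

/-! ### Absolutely continuous curves and the attitude kinematics -/

/-- The curve of rotations `R` has derivative `A` at time `t` (entry by entry). -/
def HasMatDerivAt (R : ℝ → SO3) (A : Mat3) (t : ℝ) : Prop :=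
  ∀ i k, HasDerivAt (fun s => (R s : Mat3) i k) (A i k) t

/-- The curve of rotations `R` is locally absolutely continuous on the interval `I`. -/
def LocallyACMat (R : ℝ → SO3) (I : Set ℝ) : Prop :=
  ∀ i k a b, a ≤ b → Icc a b ⊆ I → AbsolutelyContinuousOnInterval (fun s => (R s : Mat3) i k) a b

/-- The curve of vectors `b` is locally absolutely continuous on the interval `I`. -/
def LocallyACVec (x : ℝ → Vec3) (I : Set ℝ) : Prop :=
  ∀ a b, a ≤ b → Icc a b ⊆ I → AbsolutelyContinuousOnInterval x a b

/-- `R` is an attitude trajectory on `[t₀, ∞)` with angular velocity `ω`: `Ṙ = R [ω]_×`. -/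
def IsAttitude (ω : ℝ → Vec3) (t₀ : ℝ) (R : ℝ → SO3) : Prop :=
  LocallyACMat R (Ici t₀) ∧
    ∀ᵐ t : ℝ, t₀ ≤ t → HasMatDerivAt R ((R t : Mat3) * skew (ω t)) t

/-! ### Hybrid arcs and solutions of the closed loop -/

/-- Hybrid time domains starting at `(t₀, 0)`: unions of intervals `[t_j, t_{j+1}] × {j}`,
infinitely many of them, or finitely many followed by a last interval of one of the forms
`[t_J, ∞)`, `[t_J, T]` and `[t_J, T)`. -/
def IsHybridTimeDomain (t₀ : ℝ) (E : Set (ℝ × ℕ)) : Prop :=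
  ∃ τ : ℕ → ℝ, Monotone τ ∧ τ 0 = t₀ ∧
    (E = {x | x.1 ∈ Icc (τ x.2) (τ (x.2 + 1))} ∨
      ∃ (J : ℕ) (I : Set ℝ),
        (I = Ici (τ J) ∨ (∃ T, τ J ≤ T ∧ I = Icc (τ J) T) ∨ ∃ T, τ J < T ∧ I = Ico (τ J) T) ∧
        E = {x | (x.2 < J ∧ x.1 ∈ Icc (τ x.2) (τ (x.2 + 1))) ∨ (x.2 = J ∧ x.1 ∈ I)})

/-- The observer state `(R̂, b̂, q)` as a function of hybrid time `(t, j)`; only the values at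
points of `dom` are meaningful. -/
structure Arc (𝒬 : Finset ℕ) where
  dom : Set (ℝ × ℕ)
  Rhat : ℝ → ℕ → SO3
  bhat : ℝ → ℕ → Vec3
  q : ℝ → ℕ → 𝒬

/-- The flow interval `I_j = {t | (t, j) ∈ dom}`. -/
def Arc.interval {𝒬 : Finset ℕ} (x : Arc 𝒬) (j : ℕ) : Set ℝ := {t | (t, j) ∈ x.dom}

/-- The attitude estimation error `R̃ = R R̂ᵀ`. -/
noncomputable def Arc.Rtilde {𝒬 : Finset ℕ} (x : Arc 𝒬) (R : ℝ → SO3) (t : ℝ) (j : ℕ) : SO3 :=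
  R t * (x.Rhat t j)⁻¹

/-- The parameters of the observer: potential function, gains, hysteresis gap, bias bound. -/
structure Design (𝒬 : Finset ℕ) where
  Φ : SO3 → 𝒬 → ℝ
  γP : ℝ
  γI : ℝ
  δ : ℝ
  bbar : ℝ

/-- The innovation term `β = R̂ᵀ [R̃ᵀ ∇Φ(R̃, q)]_⊗`. -/
noncomputable def Design.beta {𝒬 : Finset ℕ} (d : Design 𝒬) (Rt Rh : SO3) (q : 𝒬) : Vec3 :=
  WithLp.toLp 2 ((Rh : Mat3).transpose.mulVec
    (vee ((Rt : Mat3).transpose * gradSO3 (fun X => d.Φ X q) Rt)))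

/-- `x` is a solution, from initial time `t₀`, of the hybrid observer with projection, driven by the
attitude trajectory `R` and the biased angular velocity measurement `ω + b`. As `proj` is
discontinuous where `‖b̂‖ = bbar`, the bias law `(d/dt) b̂ = Proj(-γI β, b̂)` is taken in the sense of
Krasovskii; every solution that satisfies it literally almost everywhere is included. -/
structure IsSolution {𝒬 : Finset ℕ} (d : Design 𝒬) (ω : ℝ → Vec3) (b : Vec3) (t₀ : ℝ)
    (R : ℝ → SO3) (x : Arc 𝒬) : Prop where
  dom : IsHybridTimeDomain t₀ x.dom
  ac_Rhat : ∀ j, LocallyACMat (fun t => x.Rhat t j) (x.interval j)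
  ac_bhat : ∀ j, LocallyACVec (fun t => x.bhat t j) (x.interval j)
  /-- `q` is constant along flows. -/
  flow_q : ∀ j, ∀ s ∈ x.interval j, ∀ t ∈ x.interval j, x.q s j = x.q t j
  /-- Flows take place in the flow set. -/
  flow_mem : ∀ j, ∀ t ∈ interior (x.interval j), (x.Rtilde R t j, x.q t j) ∈ flowSet d.Φ d.δ
  flow_Rhat : ∀ j, ∀ᵐ t : ℝ, t ∈ x.interval j →
    HasMatDerivAt (fun s => x.Rhat s j)
      ((x.Rhat t j : Mat3) * skew ((ω t + b) - x.bhat t j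
        + d.γP • d.beta (x.Rtilde R t j) (x.Rhat t j) (x.q t j))) t
  flow_bhat : ∀ j, ∀ᵐ t : ℝ, t ∈ x.interval j →
    ∃ v ∈ krasovskii (proj d.bbar (-(d.γI • d.beta (x.Rtilde R t j) (x.Rhat t j) (x.q t j))))
        (x.bhat t j),
      HasDerivAt (fun s => x.bhat s j) v t
  /-- Jumps take place in the jump set. -/
  jump_mem : ∀ t j, (t, j) ∈ x.dom → (t, j + 1) ∈ x.dom →
    (x.Rtilde R t j, x.q t j) ∈ jumpSet d.Φ d.δ
  /-- The new index minimizes `Φ(R̃, ·)`. -/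
  jump_q : ∀ t j, (t, j) ∈ x.dom → (t, j + 1) ∈ x.dom →
    ∀ p, d.Φ (x.Rtilde R t j) (x.q t (j + 1)) ≤ d.Φ (x.Rtilde R t j) p
  jump_Rhat : ∀ t j, (t, j) ∈ x.dom → (t, j + 1) ∈ x.dom → x.Rhat t (j + 1) = x.Rhat t j
  jump_bhat : ∀ t j, (t, j) ∈ x.dom → (t, j + 1) ∈ x.dom → x.bhat t (j + 1) = x.bhat t j

/-- `y` extends `x`. -/
def Arc.ExtendedBy {𝒬 : Finset ℕ} (x y : Arc 𝒬) : Prop :=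
  x.dom ⊆ y.dom ∧ ∀ t j, (t, j) ∈ x.dom →
    y.Rhat t j = x.Rhat t j ∧ y.bhat t j = x.bhat t j ∧ y.q t j = x.q t j

/-- A maximal solution: one that no solution properly extends. -/
def IsMaximalSolution {𝒬 : Finset ℕ} (d : Design 𝒬) (ω : ℝ → Vec3) (b : Vec3) (t₀ : ℝ)
    (R : ℝ → SO3) (x : Arc 𝒬) : Prop :=
  IsSolution d ω b t₀ R x ∧
    ∀ y, IsSolution d ω b t₀ R y → x.ExtendedBy y → y.dom = x.dom

/-- Completeness: the hybrid time domain is unbounded. -/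
def Arc.Complete {𝒬 : Finset ℕ} (x : Arc 𝒬) : Prop :=
  ∀ M : ℝ, ∃ t j, (t, j) ∈ x.dom ∧ M ≤ t + j

/-- The Euclidean norm of the error vector `e = (|R̃|_I, ‖b̂ - b‖)`. -/
noncomputable def Arc.errNorm {𝒬 : Finset ℕ} (x : Arc 𝒬) (b : Vec3) (R : ℝ → SO3) (t : ℝ) (j : ℕ) :
    ℝ :=
  Real.sqrt (attNorm (x.Rtilde R t j) ^ 2 + ‖x.bhat t j - b‖ ^ 2)

end HybridObserver

open HybridObserver

/-!
Write `R̃ = R R̂ᵀ` for the attitude error, `b̃ = b̂ - b` for the bias error and `w = R b̃`.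
In these variables `d/dt R̃ = [w]_× R̃ - γP ∇Φ(R̃, q)`: the angular velocity cancels
(`FlowAt.hasEntryDerivAt_error`).

Stability. The energy `Φ(R̃, q) + ‖b̃‖² / γI` has derivative at most `-γP ‖∇Φ‖²` along flows, because
the projection never increases `⟨b̃, d/dt b̃⟩`, also after Krasovskii regularization; so it dissipates
the attitude error only. Subtracting `ε ⟨R̃, [w]_×⟩` for a small `ε` gives a Lyapunov function
(`lyapunov`) that is strict: since `⟨[w]_× R̃, [w]_×⟩` is `2 ‖b̃‖²` up to a term that vanishes with the
attitude error, the cross term contributes `-2 ε ‖b̃‖²`, and Young's inequality absorbs all other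
terms, `b̃` and `ω` being bounded. The Lyapunov function is equivalent to `‖e‖²`, decays exponentially
along flows (`FlowOn.lyapunov_le`), and drops by at least the hysteresis gap `δ` at each jump, where
neither `R̃` nor `b̃` changes. As it is bounded at the initial time, uniformly because `SO(3)` is
compact, the number of jumps is bounded (`IsSolution.lyap_estimates`), and decay in `t` is decay in
`t + j`. The estimates hold almost everywhere in time, so they rest on the fundamental theorem of
calculus for absolutely continuous functions; the potential is Lipschitz along flows since its
gradient is bounded on the flow set.

Completeness. A maximal solution with bounded domain is excluded in three cases
(`IsMaximalSolution.complete`). If the last interval is half-open, the bounded velocities give a limit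
at its end. If it is closed and ends in the jump set, a jump extends the solution. Otherwise the
flow set contains a neighbourhood of the final error, and a flow exists for a short time
(`Admissible.exists_flowOn`). In the error variables the only discontinuity is that of the projection,
so it suffices that an arbitrary bounded field has Krasovskii solutions
(`exists_krasovskii_solution`): pointwise limits, along an ultrafilter, of Euler step functions.
-/

namespace HybridObserver

/-! ### Absolutely continuous functions -/

theorem le_of_ae_hasDerivAt_nonpos {f : ℝ → ℝ} {a b : ℝ} (hab : a ≤ b)
    (hf : AbsolutelyContinuousOnInterval f a b)
    (h : ∀ᵐ x, x ∈ Ioo a b → ∃ f', HasDerivAt f f' x ∧ f' ≤ 0) : f b ≤ f a := by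
  have h1 := hf.integral_deriv_eq_sub
  have h2 : ∫ x in a..b, deriv f x ≤ 0 := by
    rw [intervalIntegral.integral_of_le hab, integral_Ioc_eq_integral_Ioo]
    refine setIntegral_nonpos_ae measurableSet_Ioo ?_
    filter_upwards [h] with x hx hxm
    obtain ⟨f', hf', hle⟩ := hx hxm
    rwa [hf'.deriv]
  linarith

/-- Gronwall's inequality for absolutely continuous functions. -/
theorem le_exp_mul_of_ae_hasDerivAt_le {f : ℝ → ℝ} {a b c : ℝ} (hab : a ≤ b)
    (hf : AbsolutelyContinuousOnInterval f a b)
    (h : ∀ᵐ x, x ∈ Ioo a b → ∃ f', HasDerivAt f f' x ∧ f' ≤ -c * f x) :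
    f b ≤ Real.exp (-c * (b - a)) * f a := by
  have he : ∀ x, HasDerivAt (fun x : ℝ => Real.exp (c * x)) (Real.exp (c * x) * c) x := fun x => by
    simpa using ((hasDerivAt_id x).const_mul c).exp
  have hac : AbsolutelyContinuousOnInterval (fun x : ℝ => Real.exp (c * x)) a b := by
    apply ContDiffOn.absolutelyContinuousOnInterval
    exact (Real.contDiff_exp.comp (contDiff_const.mul contDiff_id)).contDiffOn
  have key := le_of_ae_hasDerivAt_nonpos hab (hac.mul hf) (by
    filter_upwards [h] with x hx hxm
    obtain ⟨f', hf', hle⟩ := hx hxm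
    refine ⟨_, (he x).mul hf', ?_⟩
    have := mul_le_mul_of_nonneg_left hle (Real.exp_pos (c * x)).le
    linarith)
  simp only [Pi.mul_apply] at key
  have e : Real.exp (-c * (b - a)) = Real.exp (c * a) / Real.exp (c * b) := by
    rw [← Real.exp_sub]; ring_nf
  rw [e, div_mul_eq_mul_div, le_div_iff₀ (Real.exp_pos _)]
  linarith

theorem abs_sub_le_of_ae_hasDerivAt_abs_le {f : ℝ → ℝ} {a b C : ℝ} (hab : a ≤ b)
    (hf : AbsolutelyContinuousOnInterval f a b)
    (h : ∀ᵐ x, x ∈ Ioo a b → ∃ f', HasDerivAt f f' x ∧ |f'| ≤ C) :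
    |f b - f a| ≤ C * (b - a) := by
  have hid : AbsolutelyContinuousOnInterval (fun x : ℝ => C * x) a b :=
    (contDiff_const.mul contDiff_id).contDiffOn.absolutelyContinuousOnInterval
  have hd : ∀ x, HasDerivAt (fun x : ℝ => C * x) C x := fun x => by
    simpa using (hasDerivAt_id x).const_mul C
  have h1 := le_of_ae_hasDerivAt_nonpos hab (hf.sub hid) (by
    filter_upwards [h] with x hx hxm
    obtain ⟨f', hf', hle⟩ := hx hxm
    exact ⟨_, hf'.sub (hd x), by linarith [le_abs_self f']⟩)
  have h2 := le_of_ae_hasDerivAt_nonpos hab (hf.neg.sub hid) (by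
    filter_upwards [h] with x hx hxm
    obtain ⟨f', hf', hle⟩ := hx hxm
    exact ⟨_, hf'.neg.sub (hd x), by linarith [neg_abs_le f']⟩)
  simp only [Pi.sub_apply, Pi.neg_apply] at h1 h2
  exact abs_le.2 ⟨by linarith, by linarith⟩

theorem _root_.LipschitzWith.comp_absolutelyContinuousOnInterval {X Y : Type*}
    [PseudoMetricSpace X] [PseudoMetricSpace Y] {K : NNReal} {g : X → Y} (hg : LipschitzWith K g)
    {f : ℝ → X} {a b : ℝ} (hf : AbsolutelyContinuousOnInterval f a b) :
    AbsolutelyContinuousOnInterval (fun x => g (f x)) a b := by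
  rw [absolutelyContinuousOnInterval_iff] at hf ⊢
  intro ε hε
  obtain ⟨δ, hδ, h⟩ := hf (ε / (K + 1)) (by positivity)
  refine ⟨δ, hδ, fun E hE hEδ => ?_⟩
  have h1 := h E hE hEδ
  rw [lt_div_iff₀ (by positivity)] at h1
  refine lt_of_le_of_lt ?_ h1
  rw [Finset.sum_mul]
  refine Finset.sum_le_sum fun i _ => (hg.dist_le_mul _ _).trans ?_
  nlinarith [dist_nonneg (x := f (E.2 i).1) (y := f (E.2 i).2)]

/-- Reparametrization by a map `φ` that collapses parts of the interval, such as `min · c`. -/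
theorem absolutelyContinuousOnInterval_comp {X : Type*} [PseudoMetricSpace X] {f : ℝ → X}
    {φ : ℝ → ℝ} {a b c d : ℝ} (hf : AbsolutelyContinuousOnInterval f c d)
    (hmaps : MapsTo φ (uIcc a b) (uIcc c d)) (hdist : ∀ x y, dist (φ x) (φ y) ≤ dist x y)
    (hsub : ∀ x y, uIoc (φ x) (φ y) ⊆ uIoc x y) :
    AbsolutelyContinuousOnInterval (fun x => f (φ x)) a b := by
  rw [absolutelyContinuousOnInterval_iff] at hf ⊢
  intro ε hε
  obtain ⟨δ, hδ, h⟩ := hf ε hε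
  refine ⟨δ, hδ, fun E hE hEδ => ?_⟩
  refine h (E.1, fun i => (φ (E.2 i).1, φ (E.2 i).2)) ?_
    (lt_of_le_of_lt (Finset.sum_le_sum fun i _ => hdist _ _) hEδ)
  simp only [AbsolutelyContinuousOnInterval.disjWithin, mem_ofPred_eq] at hE ⊢
  refine ⟨fun i hi => ⟨hmaps (hE.1 i hi).1, hmaps (hE.1 i hi).2⟩, fun i hi j hj hij => ?_⟩
  exact Disjoint.mono (hsub _ _) (hsub _ _) (hE.2 hi hj hij)

theorem absolutelyContinuousOnInterval_join {E : Type*} [SeminormedAddCommGroup E] {f : ℝ → E}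
    {a b c : ℝ} (hac : a ≤ c) (hcb : c ≤ b) (h₁ : AbsolutelyContinuousOnInterval f a c)
    (h₂ : AbsolutelyContinuousOnInterval f c b) : AbsolutelyContinuousOnInterval f a b := by
  have hmin : AbsolutelyContinuousOnInterval (fun x => f (min x c)) a b := by
    refine absolutelyContinuousOnInterval_comp (φ := fun x => min x c) h₁ ?_ ?_ ?_
    · intro x hx
      rw [uIcc_of_le (hac.trans hcb)] at hx
      rw [uIcc_of_le hac]
      exact ⟨le_min hx.1 hac, min_le_right _ _⟩
    · intro x y
      simpa [Real.dist_eq] using abs_min_sub_min_le_max x c y c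
    · intro x y z
      simp only [mem_uIoc, min_lt_iff, le_min_iff]
      grind
  have hmax : AbsolutelyContinuousOnInterval (fun x => f (max x c)) a b := by
    refine absolutelyContinuousOnInterval_comp (φ := fun x => max x c) h₂ ?_ ?_ ?_
    · intro x hx
      rw [uIcc_of_le (hac.trans hcb)] at hx
      rw [uIcc_of_le hcb]
      exact ⟨le_max_right _ _, max_le hx.2 hcb⟩
    · intro x y
      simpa [Real.dist_eq] using abs_max_sub_max_le_max x c y c
    · intro x y z
      simp only [mem_uIoc, max_lt_iff, le_max_iff]
      grind
  have hconst : AbsolutelyContinuousOnInterval (fun _ : ℝ => f c) a b :=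
    (LipschitzWith.const (f c)).lipschitzOnWith.absolutelyContinuousOnInterval
  convert (hmin.add hmax).sub hconst using 1
  funext x
  rcases le_total x c with h | h <;> simp [h]

theorem _root_.AbsolutelyContinuousOnInterval.congr {X : Type*} [PseudoMetricSpace X]
    {f g : ℝ → X} {a b : ℝ} (hf : AbsolutelyContinuousOnInterval f a b)
    (h : EqOn f g (uIcc a b)) : AbsolutelyContinuousOnInterval g a b := by
  rw [absolutelyContinuousOnInterval_iff] at hf ⊢
  intro ε hε
  obtain ⟨δ, hδ, H⟩ := hf ε hε
  refine ⟨δ, hδ, fun E hE hEδ => ?_⟩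
  convert H E hE hEδ using 2 with i hi
  have := hE.1 i hi
  rw [h this.1, h this.2]

theorem absolutelyContinuousOnInterval_sum {ι : Type*} (s : Finset ι) {f : ι → ℝ → ℝ} {a b : ℝ}
    (h : ∀ i ∈ s, AbsolutelyContinuousOnInterval (f i) a b) :
    AbsolutelyContinuousOnInterval (fun x => ∑ i ∈ s, f i x) a b := by
  classical
  induction s using Finset.induction_on with
  | empty =>
    simpa using (LipschitzWith.const (0 : ℝ)).lipschitzOnWith.absolutelyContinuousOnInterval
  | insert i s hi ih =>
    simp only [Finset.sum_insert hi]
    exact (h i (by simp)).fun_add (ih fun j hj => h j (by simp [hj]))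

theorem norm_sub_le_of_ae_hasDerivAt_norm_le {E : Type*} [NormedAddCommGroup E]
    [InnerProductSpace ℝ E] {f : ℝ → E} {a b C : ℝ} (hab : a ≤ b)
    (hf : AbsolutelyContinuousOnInterval f a b)
    (h : ∀ᵐ x, x ∈ Ioo a b → ∃ f', HasDerivAt f f' x ∧ ‖f'‖ ≤ C) :
    ‖f b - f a‖ ≤ C * (b - a) := by
  set c := f b - f a with hc
  have hac : AbsolutelyContinuousOnInterval (fun x => inner ℝ c (f x)) a b :=
    (innerSL ℝ c).lipschitz.comp_absolutelyContinuousOnInterval hf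
  have key := abs_sub_le_of_ae_hasDerivAt_abs_le hab hac (C := ‖c‖ * C) (by
    filter_upwards [h] with x hx hxm
    obtain ⟨f', hf', hle⟩ := hx hxm
    refine ⟨_, (hasDerivAt_const x c).inner ℝ hf', ?_⟩
    simp only [inner_zero_left, add_zero]
    exact (abs_real_inner_le_norm _ _).trans (by gcongr))
  rw [← inner_sub_right, ← hc, real_inner_self_eq_norm_sq, abs_of_nonneg (by positivity)] at key
  rcases (norm_nonneg c).eq_or_lt with h0 | h0
  · rw [← h0]
    rcases hab.eq_or_lt with h1 | h1
    · simp [h1]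
    · have : ∃ x, ∃ f', HasDerivAt f f' x ∧ ‖f'‖ ≤ C := by
        by_contra hcon
        push Not at hcon
        have h2 : ∀ᵐ x : ℝ, x ∉ Ioo a b := by
          filter_upwards [h] with x hx hxm
          obtain ⟨f', hf', hle⟩ := hx hxm
          exact absurd hle (hcon x f' hf').not_ge
        have h3 : volume (Ioo a b) = 0 := by
          have := ae_iff.1 h2
          simp only [not_not] at this
          exact this
        rw [Real.volume_Ioo] at h3
        simp at h3
        linarith
      obtain ⟨x, f', -, h2⟩ := this
      have := (norm_nonneg f').trans h2
      have := sub_nonneg.2 hab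
      positivity
  · nlinarith

/-- A continuous function with pointwise Lipschitz constant `C` on an open interval has Lipschitz
constant `C`. -/
theorem abs_sub_le_of_forall_eventually {f : ℝ → ℝ} {a b C : ℝ} (hab : a ≤ b)
    (hf : ContinuousOn f (Icc a b))
    (h : ∀ x ∈ Ioo a b, ∀ᶠ y in 𝓝[>] x, |f y - f x| ≤ C * (y - x)) :
    |f b - f a| ≤ C * (b - a) := by
  rcases hab.eq_or_lt with rfl | hlt
  · simp
  have main : ∀ s ∈ Ioo a b, |f b - f s| ≤ C * (b - s) := by
    intro s hs
    have hC : ∀ r, C < r → ∀ x ∈ Ico s b, ∃ᶠ z in 𝓝[>] x,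
        slope (fun y => ‖f y - f s‖) x z < r := by
      intro r hr x hx
      refine Eventually.frequently ?_
      filter_upwards [h x ⟨hs.1.trans_le hx.1, hx.2⟩, self_mem_nhdsWithin] with z hz hxz
      have hxz : 0 < z - x := sub_pos.2 hxz
      rw [slope_def_field, div_lt_iff₀ hxz]
      have h1 : ‖f z - f s‖ - ‖f x - f s‖ ≤ |f z - f x| := by
        have := norm_sub_norm_le (f z - f s) (f x - f s)
        simpa using this
      nlinarith
    have hcont : ContinuousOn (fun y => ‖f y - f s‖) (Icc s b) :=
      ((hf.mono (Icc_subset_Icc_left hs.1.le)).sub continuousOn_const).norm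
    have := image_le_of_liminf_slope_right_le_deriv_boundary hcont
      (B := fun y => C * (y - s)) (B' := fun _ => C) (by simp)
      (by fun_prop) (fun x _ => by
        simpa using (((hasDerivAt_id x).sub_const s).const_mul C).hasDerivWithinAt)
      (fun x hx r hr => hC r hr x hx) (x := b) ⟨hs.2.le, le_rfl⟩
    simpa using this
  have hlim : Tendsto (fun s => |f b - f s|) (𝓝[Ioo a b] a) (𝓝 |f b - f a|) :=
    ((tendsto_const_nhds.sub ((hf a ⟨le_rfl, hab⟩).mono_left
      (nhdsWithin_mono _ Ioo_subset_Icc_self))).abs)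
  have hlim2 : Tendsto (fun s => C * (b - s)) (𝓝[Ioo a b] a) (𝓝 (C * (b - a))) := by
    refine Tendsto.mono_left (Continuous.tendsto ?_ a) nhdsWithin_le_nhds
    fun_prop
  have : (𝓝[Ioo a b] a).NeBot := by
    rw [nhdsWithin_Ioo_eq_nhdsGT hlt]; infer_instance
  exact le_of_tendsto_of_tendsto hlim hlim2 (eventually_nhdsWithin_of_forall main)

/-! ### Matrices, rotations and their derivatives -/

/-- A matrix as a vector of `ℝ⁹`; this identifies `matInner` with the Euclidean inner product. -/
noncomputable def matVec (A : Mat3) : EuclideanSpace ℝ (Fin 3 × Fin 3) :=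
  WithLp.toLp 2 fun p => A p.1 p.2

@[simp] theorem matVec_apply (A : Mat3) (p : Fin 3 × Fin 3) : matVec A p = A p.1 p.2 := rfl

theorem matVec_sub (A B : Mat3) : matVec (A - B) = matVec A - matVec B := rfl
theorem matVec_smul (c : ℝ) (A : Mat3) : matVec (c • A) = c • matVec A := rfl

theorem matInner_eq_sum (A B : Mat3) : matInner A B = ∑ i, ∑ k, A i k * B i k := by
  rw [matInner, Matrix.trace, Finset.sum_comm]
  simp [Matrix.mul_apply]

theorem matInner_eq_inner (A B : Mat3) : matInner A B = inner ℝ (matVec A) (matVec B) := by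
  rw [matInner_eq_sum, PiLp.inner_apply, Fintype.sum_prod_type]
  simp [mul_comm]

theorem frobNorm_eq_norm (A : Mat3) : frobNorm A = ‖matVec A‖ := by
  rw [frobNorm, matInner_eq_inner, real_inner_self_eq_norm_sq, Real.sqrt_sq (norm_nonneg _)]

theorem frobNorm_nonneg (A : Mat3) : 0 ≤ frobNorm A := Real.sqrt_nonneg _

theorem matInner_self (A : Mat3) : matInner A A = frobNorm A ^ 2 := by
  rw [frobNorm_eq_norm, matInner_eq_inner, real_inner_self_eq_norm_sq]

theorem abs_matInner_le (A B : Mat3) : |matInner A B| ≤ frobNorm A * frobNorm B := by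
  rw [matInner_eq_inner, frobNorm_eq_norm, frobNorm_eq_norm]
  exact abs_real_inner_le_norm _ _

theorem matInner_comm (A B : Mat3) : matInner A B = matInner B A := by
  simp [matInner_eq_sum, mul_comm]

theorem matInner_sub_left (A B C : Mat3) : matInner (A - B) C = matInner A C - matInner B C := by
  simp [matInner_eq_inner, matVec_sub, inner_sub_left]
theorem matInner_sub_right (A B C : Mat3) : matInner A (B - C) = matInner A B - matInner A C := by
  simp [matInner_eq_inner, matVec_sub, inner_sub_right]
theorem matInner_smul_left (c : ℝ) (A B : Mat3) : matInner (c • A) B = c * matInner A B := by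
  simp [matInner_eq_inner, matVec_smul, inner_smul_left]
theorem matInner_smul_right (c : ℝ) (A B : Mat3) : matInner A (c • B) = c * matInner A B := by
  simp [matInner_eq_inner, matVec_smul, inner_smul_right]

theorem abs_apply_le_frobNorm (A : Mat3) (i k : Fin 3) : |A i k| ≤ frobNorm A := by
  rw [frobNorm_eq_norm]
  exact PiLp.norm_apply_le (matVec A) (i, k)

theorem frobNorm_le_of_abs_le {A : Mat3} {C : ℝ} (hC : 0 ≤ C) (h : ∀ i k, |A i k| ≤ C) :
    frobNorm A ≤ 3 * C := by
  rw [frobNorm, matInner_eq_sum]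
  apply Real.sqrt_le_iff.2 ⟨by positivity, ?_⟩
  have : ∀ i k, A i k * A i k ≤ C ^ 2 := fun i k => by
    rw [← sq, ← sq_abs]; exact pow_le_pow_left₀ (abs_nonneg _) (h i k) 2
  calc _ ≤ ∑ _i : Fin 3, ∑ _k : Fin 3, C ^ 2 :=
        Finset.sum_le_sum fun i _ => Finset.sum_le_sum fun k _ => this i k
    _ = (3 * C) ^ 2 := by simp; ring

theorem SO3.transpose_mul_self (R : SO3) : (R : Mat3).transpose * (R : Mat3) = 1 := by
  exact (Matrix.mem_orthogonalGroup_iff' _ _).1 (Matrix.mem_specialOrthogonalGroup_iff.1 R.2).1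

theorem SO3.self_mul_transpose (R : SO3) : (R : Mat3) * (R : Mat3).transpose = 1 := by
  exact (Matrix.mem_orthogonalGroup_iff _ _).1 (Matrix.mem_specialOrthogonalGroup_iff.1 R.2).1

theorem SO3.det_eq_one (R : SO3) : (R : Mat3).det = 1 :=
  (Matrix.mem_specialOrthogonalGroup_iff.1 R.2).2

theorem mem_SO3_iff {A : Mat3} :
    A ∈ Matrix.specialOrthogonalGroup (Fin 3) ℝ ↔ A.transpose * A = 1 ∧ A.det = 1 := by
  rw [Matrix.mem_specialOrthogonalGroup_iff, Matrix.mem_orthogonalGroup_iff']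

theorem SO3.coe_inv (R : SO3) : ((R⁻¹ : SO3) : Mat3) = (R : Mat3).transpose := rfl

theorem SO3.coe_mul (R S : SO3) : ((R * S : SO3) : Mat3) = (R : Mat3) * (S : Mat3) := rfl

theorem SO3.adjugate (R : SO3) : (R : Mat3).adjugate = (R : Mat3).transpose := by
  calc (R : Mat3).adjugate
      = ((R : Mat3).transpose * (R : Mat3)) * (R : Mat3).adjugate := by
        rw [SO3.transpose_mul_self, one_mul]
    _ = (R : Mat3).transpose := by
        rw [mul_assoc, Matrix.mul_adjugate, SO3.det_eq_one, one_smul, mul_one]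

theorem inner_vec3 (v w : Vec3) : inner ℝ v w = v 0 * w 0 + v 1 * w 1 + v 2 * w 2 := by
  simp [PiLp.inner_apply, Fin.sum_univ_three, mul_comm]

/-- The action of a rotation on a vector. -/
noncomputable def rot (A : Mat3) (v : Vec3) : Vec3 := WithLp.toLp 2 (A.mulVec v)

theorem rot_apply (A : Mat3) (v : Vec3) (i : Fin 3) : rot A v i = ∑ k, A i k * v k := rfl

theorem rot_mul (A B : Mat3) (v : Vec3) : rot (A * B) v = rot A (rot B v) := by
  simp [rot, Matrix.mulVec_mulVec]

theorem rot_one (v : Vec3) : rot 1 v = v := by simp [rot]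

theorem rot_add (A : Mat3) (v w : Vec3) : rot A (v + w) = rot A v + rot A w := by
  ext i; simp [rot, Matrix.mulVec_add]
theorem rot_sub (A : Mat3) (v w : Vec3) : rot A (v - w) = rot A v - rot A w := by
  ext i; simp [rot, Matrix.mulVec_sub]
theorem rot_smul (A : Mat3) (c : ℝ) (v : Vec3) : rot A (c • v) = c • rot A v := by
  ext i; simp [rot, Matrix.mulVec_smul]

theorem inner_rot_transpose (A : Mat3) (v w : Vec3) :
    inner ℝ (rot A.transpose v) w = inner ℝ v (rot A w) := by
  simp only [inner_vec3, rot_apply, Fin.sum_univ_three, Matrix.transpose_apply]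
  ring

theorem inner_rot_rot (R : SO3) (v w : Vec3) :
    inner ℝ (rot (R : Mat3) v) (rot (R : Mat3) w) = inner ℝ v w := by
  rw [← inner_rot_transpose, ← rot_mul, SO3.transpose_mul_self, rot_one]

theorem norm_rot (R : SO3) (v : Vec3) : ‖rot (R : Mat3) v‖ = ‖v‖ := by
  rw [← sq_eq_sq₀ (norm_nonneg _) (norm_nonneg _), ← real_inner_self_eq_norm_sq,
    ← real_inner_self_eq_norm_sq, inner_rot_rot]

theorem norm_rot_transpose (R : SO3) (v : Vec3) : ‖rot (R : Mat3).transpose v‖ = ‖v‖ :=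
  norm_rot R⁻¹ v

theorem skew_add (u v : Vec3) : skew (u + v) = skew u + skew v := by
  ext i j; fin_cases i <;> fin_cases j <;> simp [skew] <;> ring
theorem skew_sub (u v : Vec3) : skew (u - v) = skew u - skew v := by
  ext i j; fin_cases i <;> fin_cases j <;> simp [skew] <;> ring
theorem skew_smul (c : ℝ) (v : Vec3) : skew (c • v) = c • skew v := by
  ext i j; fin_cases i <;> fin_cases j <;> simp [skew]
theorem skew_transpose (v : Vec3) : (skew v).transpose = -skew v := by
  ext i j; fin_cases i <;> fin_cases j <;> simp [skew]
theorem vee_skew (v : Vec3) : vee (skew v) = v := by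
  ext i; fin_cases i <;> simp [skew, vee]

theorem matInner_skew_skew (u v : Vec3) : matInner (skew u) (skew v) = 2 * inner ℝ u v := by
  simp [matInner_eq_sum, Fin.sum_univ_three, skew, inner_vec3]
  ring

theorem frobNorm_skew_sq (v : Vec3) : frobNorm (skew v) ^ 2 = 2 * ‖v‖ ^ 2 := by
  rw [← matInner_self, matInner_skew_skew, real_inner_self_eq_norm_sq]

theorem frobNorm_skew (v : Vec3) : frobNorm (skew v) = √2 * ‖v‖ := by
  rw [← sq_eq_sq₀ (frobNorm_nonneg _) (by positivity), frobNorm_skew_sq, mul_pow,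
    Real.sq_sqrt (by norm_num)]

theorem matInner_mul_left (R : SO3) (A B : Mat3) :
    matInner ((R : Mat3) * A) ((R : Mat3) * B) = matInner A B := by
  rw [matInner, matInner, Matrix.transpose_mul, mul_assoc, ← mul_assoc _ (R : Mat3) B,
    SO3.transpose_mul_self, one_mul]

/-- Left multiplication by `[w]_×` is the cross product with `w` in each column. -/
theorem frobNorm_skew_mul_le (w : Vec3) (A : Mat3) :
    frobNorm (skew w * A) ≤ ‖w‖ * frobNorm A := by
  rw [← sq_le_sq₀ (frobNorm_nonneg _) (mul_nonneg (norm_nonneg _) (frobNorm_nonneg _)), mul_pow,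
    ← matInner_self, ← matInner_self, ← real_inner_self_eq_norm_sq]
  have : inner ℝ w w * matInner A A - matInner (skew w * A) (skew w * A)
      = ∑ k, (w 0 * A 0 k + w 1 * A 1 k + w 2 * A 2 k) ^ 2 := by
    simp only [inner_vec3, matInner_eq_sum, Matrix.mul_apply, Fin.sum_univ_three]
    simp [skew]
    ring
  have h : 0 ≤ ∑ k, (w 0 * A 0 k + w 1 * A 1 k + w 2 * A 2 k) ^ 2 :=
    Finset.sum_nonneg fun _ _ => sq_nonneg _
  linarith

/-- Rotations preserve the cross product: `R [v]_× Rᵀ = [R v]_×`. -/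
theorem skew_rot (R : SO3) (v : Vec3) :
    (R : Mat3) * skew v * (R : Mat3).transpose = skew (rot (R : Mat3) v) := by
  have hadj := (SO3.adjugate R).symm
  rw [Matrix.adjugate_fin_three] at hadj
  -- each entry of `R` equals its cofactor
  have h : ∀ i k, (R : Mat3) i k = (R : Mat3).transpose k i := fun _ _ => rfl
  have h00 := h 0 0
  have h01 := h 0 1
  have h02 := h 0 2
  have h10 := h 1 0
  have h11 := h 1 1
  have h12 := h 1 2
  have h20 := h 2 0
  have h21 := h 2 1
  have h22 := h 2 2
  rw [hadj] at h00 h01 h02 h10 h11 h12 h20 h21 h22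
  simp at h00 h01 h02 h10 h11 h12 h20 h21 h22
  ext i j
  fin_cases i <;> fin_cases j <;>
    simp [skew, rot_apply, Matrix.mul_apply, Fin.sum_univ_three] <;>
    first
      | ring1
      | linear_combination v 0 * h00 + v 1 * h01 + v 2 * h02
      | linear_combination v 0 * h10 + v 1 * h11 + v 2 * h12
      | linear_combination v 0 * h20 + v 1 * h21 + v 2 * h22
      | linear_combination -(v 0 * h00 + v 1 * h01 + v 2 * h02)
      | linear_combination -(v 0 * h10 + v 1 * h11 + v 2 * h12)
      | linear_combination -(v 0 * h20 + v 1 * h21 + v 2 * h22)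

theorem skew_rot_mul (R : SO3) (v : Vec3) :
    skew (rot (R : Mat3) v) * (R : Mat3) = (R : Mat3) * skew v := by
  rw [← skew_rot, mul_assoc, SO3.transpose_mul_self, mul_one]

theorem SO3.abs_apply_le (R : SO3) (i k : Fin 3) : |(R : Mat3) i k| ≤ 1 := by
  have h := congrFun (congrFun (SO3.self_mul_transpose R) i) i
  rw [Matrix.mul_apply, Matrix.one_apply_eq] at h
  have h2 : (R : Mat3) i k * (R : Mat3) i k ≤ 1 := by
    rw [← h]
    exact Finset.single_le_sum (f := fun j => (R : Mat3) i j * (R : Mat3).transpose j i)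
      (fun j _ => mul_self_nonneg _) (Finset.mem_univ k)
  rw [← abs_mul_abs_self] at h2
  nlinarith [abs_nonneg ((R : Mat3) i k)]

theorem attNorm_nonneg (R : SO3) : 0 ≤ attNorm R := Real.sqrt_nonneg _

theorem frobNorm_sub_one_sq (R : SO3) : frobNorm ((R : Mat3) - 1) ^ 2 = 8 * attNorm R ^ 2 := by
  have h : frobNorm ((R : Mat3) - 1) ^ 2 = 2 * (1 - (R : Mat3)).trace := by
    rw [← matInner_self, matInner, Matrix.transpose_sub, sub_mul, mul_sub, mul_sub,
      SO3.transpose_mul_self]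
    simp [Matrix.trace_sub]
    ring
  have h0 : 0 ≤ (1 - (R : Mat3)).trace := by nlinarith [sq_nonneg (frobNorm ((R : Mat3) - 1))]
  rw [h, attNorm, Real.sq_sqrt (by positivity)]
  ring

theorem frobNorm_sub_one (R : SO3) : frobNorm ((R : Mat3) - 1) = 2 * √2 * attNorm R := by
  rw [← sq_eq_sq₀ (frobNorm_nonneg _) (mul_nonneg (by positivity) (attNorm_nonneg _)),
    frobNorm_sub_one_sq, mul_pow, mul_pow, Real.sq_sqrt (by norm_num)]
  ring

/-- Skew-symmetric matrices are orthogonal to the identity, so this pairing vanishes at `R = 1`. -/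
theorem matInner_skew_eq_sub_one (A : Mat3) (w : Vec3) :
    matInner A (skew w) = matInner (A - 1) (skew w) := by
  rw [matInner_sub_left]
  simp [matInner, skew, Matrix.trace, Fin.sum_univ_three]

theorem abs_matInner_skew_le (R : SO3) (w : Vec3) :
    |matInner (R : Mat3) (skew w)| ≤ 4 * attNorm R * ‖w‖ := by
  have h2 : √2 * √2 = 2 := Real.mul_self_sqrt (by norm_num)
  rw [matInner_skew_eq_sub_one]
  refine (abs_matInner_le _ _).trans (le_of_eq ?_)
  rw [frobNorm_skew, frobNorm_sub_one]
  linear_combination (2 * attNorm R * ‖w‖) * h2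

theorem attNorm_sq_le (R : SO3) : attNorm R ^ 2 ≤ 3 / 2 := by
  rw [attNorm]
  have h := fun i => abs_le.1 (SO3.abs_apply_le R i i)
  have ht : (1 - (R : Mat3)).trace ≤ 6 := by
    simp [Matrix.trace, Fin.sum_univ_three]
    linarith [(h 0).1, (h 1).1, (h 2).1]
  have h0 : 0 ≤ (1 - (R : Mat3)).trace := by
    simp [Matrix.trace, Fin.sum_univ_three]
    linarith [(h 0).2, (h 1).2, (h 2).2]
  rw [Real.sq_sqrt (by positivity)]
  linarith

/-- Entrywise derivative of a curve of matrices. -/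
def HasEntryDerivAt (A : ℝ → Mat3) (A' : Mat3) (t : ℝ) : Prop :=
  ∀ i k, HasDerivAt (fun s => A s i k) (A' i k) t

theorem HasEntryDerivAt.mul {A B : ℝ → Mat3} {A' B' : Mat3} {t : ℝ} (hA : HasEntryDerivAt A A' t)
    (hB : HasEntryDerivAt B B' t) :
    HasEntryDerivAt (fun s => A s * B s) (A' * B t + A t * B') t := by
  intro i k
  simp only [Matrix.mul_apply, Matrix.add_apply, ← Finset.sum_add_distrib]
  exact HasDerivAt.fun_sum fun j _ => (hA i j).mul (hB j k)

theorem HasEntryDerivAt.transpose {A : ℝ → Mat3} {A' : Mat3} {t : ℝ} (hA : HasEntryDerivAt A A' t) :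
    HasEntryDerivAt (fun s => (A s).transpose) A'.transpose t := fun i k => hA k i

theorem HasEntryDerivAt.matInner {A B : ℝ → Mat3} {A' B' : Mat3} {t : ℝ}
    (hA : HasEntryDerivAt A A' t) (hB : HasEntryDerivAt B B' t) :
    HasDerivAt (fun s => matInner (A s) (B s)) (matInner A' (B t) + matInner (A t) B') t := by
  simp only [matInner_eq_sum, ← Finset.sum_add_distrib]
  exact HasDerivAt.fun_sum fun i _ => HasDerivAt.fun_sum fun k _ => (hA i k).mul (hB i k)

theorem hasDerivAt_euclidean_iff {ι : Type*} [Fintype ι] {v : ℝ → EuclideanSpace ℝ ι}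
    {v' : EuclideanSpace ℝ ι} {t : ℝ} :
    HasDerivAt v v' t ↔ ∀ i, HasDerivAt (fun s => v s i) (v' i) t := by
  let L := EuclideanSpace.equiv ι ℝ
  have h : HasDerivAt v v' t ↔ HasDerivAt (fun s => L (v s)) (L v') t := by
    refine ⟨fun h => L.hasFDerivAt.comp_hasDerivAt t h, fun h => ?_⟩
    simpa [Function.comp_def] using L.symm.hasFDerivAt.comp_hasDerivAt t h
  rw [h, hasDerivAt_pi]
  rfl

theorem HasDerivAt.skew {v : ℝ → Vec3} {v' : Vec3} {t : ℝ} (h : HasDerivAt v v' t) :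
    HasEntryDerivAt (fun s => skew (v s)) (skew v') t := by
  rw [hasDerivAt_euclidean_iff] at h
  intro i k
  fin_cases i <;> fin_cases k <;> simp [HybridObserver.skew] <;>
    first
      | exact hasDerivAt_const t 0
      | exact h 0
      | exact h 1
      | exact h 2
      | exact (h 0).neg
      | exact (h 1).neg
      | exact (h 2).neg

theorem HasEntryDerivAt.rot {A : ℝ → Mat3} {A' : Mat3} {v : ℝ → Vec3} {v' : Vec3} {t : ℝ}
    (hA : HasEntryDerivAt A A' t) (hv : HasDerivAt v v' t) :
    HasDerivAt (fun s => rot (A s) (v s)) (rot A' (v t) + rot (A t) v') t := by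
  rw [hasDerivAt_euclidean_iff] at hv ⊢
  intro i
  simp only [PiLp.add_apply, rot_apply, ← Finset.sum_add_distrib]
  exact HasDerivAt.fun_sum fun j _ => (hA i j).mul (hv j)

theorem continuous_matVec : Continuous matVec := by
  refine (PiLp.continuous_toLp 2 _).comp (continuous_pi fun p => ?_)
  exact (continuous_apply p.2).comp (continuous_apply p.1)

theorem norm_rot_skew_le (R : SO3) (w v : Vec3) :
    ‖rot ((R : Mat3) * skew w) v‖ ≤ ‖w‖ * ‖v‖ := by
  rw [rot_mul, norm_rot, ← sq_le_sq₀ (norm_nonneg _) (by positivity), mul_pow,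
    ← real_inner_self_eq_norm_sq, ← real_inner_self_eq_norm_sq, ← real_inner_self_eq_norm_sq]
  have h : inner ℝ w w * inner ℝ v v - inner ℝ (rot (skew w) v) (rot (skew w) v)
      = (inner ℝ w v) ^ 2 := by
    simp only [inner_vec3, rot_apply, Fin.sum_univ_three]
    simp [skew]
    ring
  nlinarith [sq_nonneg (inner ℝ w v)]

/-! ### The projection and its Krasovskii regularization -/

theorem proj_eq_max (bbar : ℝ) (μ : Vec3) {y : Vec3} (hy : bbar < ‖y‖) :
    proj bbar μ y = μ - (max 0 (inner ℝ y μ) / ‖y‖ ^ 2) • y := by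
  rw [proj]
  split_ifs with h
  · have : inner ℝ y μ ≤ 0 := h.resolve_left (not_le.2 hy)
    simp [max_eq_left this]
  · push Not at h
    rw [max_eq_right h.2.le]

theorem proj_of_le {bbar : ℝ} (μ : Vec3) {y : Vec3} (hy : ‖y‖ ≤ bbar) : proj bbar μ y = μ := by
  rw [proj, if_pos (Or.inl hy)]

theorem norm_div_sq_smul_le (a : ℝ) (y : Vec3) : ‖(a / ‖y‖ ^ 2) • y‖ ≤ |a| / ‖y‖ := by
  rw [norm_smul, Real.norm_eq_abs, abs_div, abs_of_nonneg (sq_nonneg ‖y‖)]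
  rcases eq_or_ne ‖y‖ 0 with h | h
  · simp [h]
  · apply le_of_eq
    field_simp

theorem abs_inner_div_norm_le (y μ : Vec3) : |inner ℝ y μ| / ‖y‖ ≤ ‖μ‖ := by
  apply div_le_of_le_mul₀ (norm_nonneg _) (norm_nonneg _)
  rw [mul_comm]
  exact abs_real_inner_le_norm y μ

theorem norm_proj_sub_proj_le (bbar : ℝ) (μ ν y : Vec3) :
    ‖proj bbar μ y - proj bbar ν y‖ ≤ 2 * ‖μ - ν‖ := by
  rcases le_or_gt ‖y‖ bbar with hy | hy
  · rw [proj_of_le _ hy, proj_of_le _ hy]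
    linarith [norm_nonneg (μ - ν)]
  · rw [proj_eq_max _ _ hy, proj_eq_max _ _ hy]
    have h1 : |max 0 (inner ℝ y μ) - max 0 (inner ℝ y ν)| ≤ |inner ℝ y (μ - ν)| := by
      rw [inner_sub_right]
      simpa using abs_max_sub_max_le_max (0 : ℝ) (inner ℝ y μ) 0 (inner ℝ y ν)
    have h2 : ‖((max 0 (inner ℝ y μ) - max 0 (inner ℝ y ν)) / ‖y‖ ^ 2) • y‖ ≤ ‖μ - ν‖ :=
      (norm_div_sq_smul_le _ _).trans
        ((div_le_div_of_nonneg_right h1 (norm_nonneg _)).trans (abs_inner_div_norm_le _ _))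
    calc _ = ‖(μ - ν) - ((max 0 (inner ℝ y μ) - max 0 (inner ℝ y ν)) / ‖y‖ ^ 2) • y‖ := by
          congr 1
          rw [sub_div, sub_smul]
          abel
      _ ≤ _ := (norm_sub_le _ _).trans (by linarith)

theorem norm_proj_sub_self_le (bbar : ℝ) (μ y : Vec3) : ‖proj bbar μ y - μ‖ ≤ ‖μ‖ := by
  rcases le_or_gt ‖y‖ bbar with hy | hy
  · simp [proj_of_le _ hy]
  · rw [proj_eq_max _ _ hy, sub_sub_cancel_left, norm_neg]
    refine (norm_div_sq_smul_le _ _).trans (le_trans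
      (div_le_div_of_nonneg_right ?_ (norm_nonneg _)) (abs_inner_div_norm_le y μ))
    rw [abs_of_nonneg (le_max_left (0 : ℝ) _)]
    exact max_le (abs_nonneg _) (le_abs_self _)

theorem norm_proj_le (bbar : ℝ) (μ y : Vec3) : ‖proj bbar μ y‖ ≤ ‖μ‖ := by
  rw [proj]
  split_ifs with h
  · exact le_rfl
  · push Not at h
    rw [← sq_le_sq₀ (norm_nonneg _) (norm_nonneg _), norm_sub_sq_real, norm_smul, inner_smul_right,
      real_inner_comm y μ]
    rcases eq_or_ne ‖y‖ 0 with h0 | h0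
    · simp [h0]
    · have : 0 ≤ (inner ℝ y μ / ‖y‖) ^ 2 := sq_nonneg _
      rw [Real.norm_eq_abs, mul_pow, sq_abs]
      field_simp at this ⊢
      nlinarith

theorem inner_proj_nonpos {bbar : ℝ} (μ : Vec3) {y : Vec3} (hb : 0 ≤ bbar) (hy : bbar < ‖y‖) :
    inner ℝ y (proj bbar μ y) ≤ 0 := by
  have h0 : ‖y‖ ≠ 0 := (hb.trans_lt hy).ne'
  rw [proj_eq_max _ _ hy, inner_sub_right, inner_smul_right, real_inner_self_eq_norm_sq,
    div_mul_cancel₀ _ (pow_ne_zero 2 h0)]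
  linarith [le_max_right 0 (inner ℝ y μ)]

/-- Projecting only improves the correlation with the estimation error, because the true parameter
lies in the ball. -/
theorem inner_sub_proj_le {bbar : ℝ} {b : Vec3} (μ y : Vec3) (hb : ‖b‖ ≤ bbar) :
    inner ℝ (y - b) (proj bbar μ y - μ) ≤ 0 := by
  rcases le_or_gt ‖y‖ bbar with hy | hy
  · simp [proj_of_le _ hy]
  · rw [proj_eq_max _ _ hy, sub_sub_cancel_left, inner_neg_right, inner_smul_right, inner_sub_left,
      real_inner_self_eq_norm_sq]
    have h1 : inner ℝ b y ≤ ‖y‖ ^ 2 := by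
      have := real_inner_le_norm b y
      nlinarith [norm_nonneg y]
    have h2 : 0 ≤ max 0 (inner ℝ y μ) / ‖y‖ ^ 2 := by positivity
    nlinarith

theorem mem_of_mem_krasovskii {f : Vec3 → Vec3} {x v : Vec3} {S : Set Vec3} {ε : ℝ}
    (hv : v ∈ krasovskii f x) (hε : 0 < ε) (hS : IsClosed S) (hS' : Convex ℝ S)
    (h : ∀ y ∈ Metric.ball x ε, f y ∈ S) : v ∈ S := by
  rw [krasovskii, mem_iInter₂] at hv
  exact closure_minimal (convexHull_min (image_subset_iff.2 h) hS') hS (hv ε hε)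

theorem norm_le_of_mem_krasovskii_proj {bbar : ℝ} {μ x v : Vec3}
    (hv : v ∈ krasovskii (proj bbar μ) x) : ‖v‖ ≤ ‖μ‖ := by
  have := mem_of_mem_krasovskii hv one_pos (Metric.isClosed_closedBall (x := 0) (ε := ‖μ‖))
    (convex_closedBall _ _) fun y _ => by simpa using norm_proj_le bbar μ y
  simpa using this

theorem isClosed_setOf_inner_le (c : Vec3) (κ : ℝ) : IsClosed {v : Vec3 | inner ℝ c v ≤ κ} :=
  isClosed_le (by fun_prop) continuous_const

theorem convex_setOf_inner_le (c : Vec3) (κ : ℝ) : Convex ℝ {v : Vec3 | inner ℝ c v ≤ κ} :=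
  convex_halfSpace_le (innerₛₗ ℝ c).isLinear κ

theorem inner_sub_le_of_mem_krasovskii_proj {bbar : ℝ} {b μ x v : Vec3} (hb : ‖b‖ ≤ bbar)
    (hv : v ∈ krasovskii (proj bbar μ) x) : inner ℝ (x - b) v ≤ inner ℝ (x - b) μ := by
  suffices h : ∀ ε > 0, inner ℝ (x - b) v ≤ inner ℝ (x - b) μ + ε * ‖μ‖ by
    refine le_of_forall_pos_le_add fun η hη => ?_
    refine (h (η / (‖μ‖ + 1)) (by positivity)).trans ?_
    have : η / (‖μ‖ + 1) * ‖μ‖ ≤ η := by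
      rw [div_mul_eq_mul_div, div_le_iff₀ (by positivity)]
      nlinarith [norm_nonneg μ]
    linarith
  intro ε hε
  refine mem_of_mem_krasovskii hv hε (isClosed_setOf_inner_le _ _) (convex_setOf_inner_le _ _)
    fun y hy => ?_
  have h1 := inner_sub_proj_le (bbar := bbar) μ y hb
  have h2 : inner ℝ (x - y) (proj bbar μ y - μ) ≤ ε * ‖μ‖ := by
    refine (real_inner_le_norm _ _).trans ?_
    have h3 : ‖x - y‖ ≤ ε := by
      rw [← dist_eq_norm, dist_comm]; exact (Metric.mem_ball.1 hy).le
    exact mul_le_mul h3 (norm_proj_sub_self_le _ _ _) (norm_nonneg _) hε.le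
  have h4 : inner ℝ (x - b) (proj bbar μ y - μ)
      = inner ℝ (y - b) (proj bbar μ y - μ) + inner ℝ (x - y) (proj bbar μ y - μ) := by
    rw [← inner_add_left]; congr 1; abel
  rw [inner_sub_right] at h4
  show inner ℝ (x - b) (proj bbar μ y) ≤ _
  linarith

theorem inner_nonpos_of_mem_krasovskii_proj {bbar : ℝ} {μ x v : Vec3} (hb : 0 ≤ bbar)
    (hx : bbar < ‖x‖) (hv : v ∈ krasovskii (proj bbar μ) x) : inner ℝ x v ≤ 0 := by
  suffices h : ∀ ε > 0, ε < ‖x‖ - bbar → inner ℝ x v ≤ ε * ‖μ‖ by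
    have hlim : Tendsto (fun ε : ℝ => ε * ‖μ‖) (𝓝[>] 0) (𝓝 0) := by
      have : Tendsto (fun ε : ℝ => ε * ‖μ‖) (𝓝 0) (𝓝 (0 * ‖μ‖)) :=
        Continuous.tendsto (by fun_prop) 0
      rw [zero_mul] at this
      exact this.mono_left nhdsWithin_le_nhds
    refine ge_of_tendsto hlim ?_
    filter_upwards [Ioo_mem_nhdsGT (sub_pos.2 hx)] with ε hε
    exact h ε hε.1 hε.2
  intro ε hε hεx
  refine mem_of_mem_krasovskii hv hε (isClosed_setOf_inner_le _ _) (convex_setOf_inner_le _ _)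
    fun y hy => ?_
  have h3 : ‖x - y‖ < ε := by
    rw [← dist_eq_norm, dist_comm]; exact Metric.mem_ball.1 hy
  have hy' : bbar < ‖y‖ := by linarith [norm_sub_norm_le x y]
  have h1 := inner_proj_nonpos μ hb hy'
  have h2 : inner ℝ (x - y) (proj bbar μ y) ≤ ε * ‖μ‖ :=
    (real_inner_le_norm _ _).trans
      (mul_le_mul h3.le (norm_proj_le _ _ _) (norm_nonneg _) hε.le)
  rw [inner_sub_left] at h2
  show inner ℝ x (proj bbar μ y) ≤ _
  linarith

/-- The Krasovskii regularization is insensitive to small perturbations of the argument `μ` of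
`proj`. -/
theorem mem_krasovskii_proj_of_forall {bbar : ℝ} {μ x v : Vec3}
    (h : ∀ ε > 0, v ∈ closure (convexHull ℝ
      {w | ∃ ν ∈ Metric.ball μ ε, ∃ y ∈ Metric.ball x ε, w = proj bbar ν y})) :
    v ∈ krasovskii (proj bbar μ) x := by
  rw [krasovskii, mem_iInter₂]
  intro ε hε
  set S := convexHull ℝ (proj bbar μ '' Metric.ball x ε) with hS
  have hSc : Convex ℝ S := convex_convexHull ℝ _
  rw [Metric.mem_closure_iff_infDist_zero]
  swap
  · exact ⟨_, subset_convexHull ℝ _ (mem_image_of_mem _ (Metric.mem_ball_self hε))⟩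
  refine le_antisymm ?_ Metric.infDist_nonneg
  refine le_of_forall_pos_le_add fun η hη => ?_
  rw [zero_add]
  have hsub : closure (convexHull ℝ {w | ∃ ν ∈ Metric.ball μ (min ε (η / 2)),
      ∃ y ∈ Metric.ball x (min ε (η / 2)), w = proj bbar ν y}) ⊆ Metric.cthickening η S := by
    refine closure_minimal (convexHull_min ?_ (hSc.cthickening η)) Metric.isClosed_cthickening
    rintro _ ⟨ν, hν, y, hy, rfl⟩
    refine Metric.mem_cthickening_of_dist_le _ (proj bbar μ y) η S ?_ ?_
    · exact subset_convexHull ℝ _ (mem_image_of_mem _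
        (Metric.ball_subset_ball (min_le_left _ _) hy))
    · rw [dist_eq_norm]
      refine (norm_proj_sub_proj_le bbar ν μ y).trans ?_
      have : ‖ν - μ‖ < η / 2 := by
        rw [← dist_eq_norm]; exact (Metric.mem_ball.1 hν).trans_le (min_le_right _ _)
      linarith
  have hv := hsub (h _ (lt_min hε (half_pos hη)))
  rw [Metric.mem_cthickening_iff] at hv
  rw [Metric.infDist]
  exact ENNReal.toReal_le_of_le_ofReal hη.le hv

/-! ### Existence of Krasovskii solutions -/

section Existence

variable {E : Type*} [NormedAddCommGroup E] [NormedSpace ℝ E]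

/-- The nodes of the explicit Euler scheme with step `h` for `z' = f (t, z)`, `z t₀ = z₀`. -/
def eulerNode (f : ℝ × E → E) (h t₀ : ℝ) (z₀ : E) : ℕ → E
  | 0 => z₀
  | k + 1 => eulerNode f h t₀ z₀ k + h • f (t₀ + k * h, eulerNode f h t₀ z₀ k)

theorem norm_eulerNode_sub_le {f : ℝ × E → E} {C h t₀ : ℝ} {z₀ : E} (hf : ∀ p, ‖f p‖ ≤ C)
    (hh : 0 ≤ h) {k l : ℕ} (hkl : k ≤ l) :
    ‖eulerNode f h t₀ z₀ l - eulerNode f h t₀ z₀ k‖ ≤ C * ((l - k) * h) := by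
  induction l, hkl using Nat.le_induction with
  | base => simp
  | succ l hkl ih =>
    have h1 : ‖h • f (t₀ + l * h, eulerNode f h t₀ z₀ l)‖ ≤ h * C := by
      rw [norm_smul, Real.norm_eq_abs, abs_of_nonneg hh]
      exact mul_le_mul_of_nonneg_left (hf _) hh
    calc _ = ‖(eulerNode f h t₀ z₀ l - eulerNode f h t₀ z₀ k)
            + h • f (t₀ + l * h, eulerNode f h t₀ z₀ l)‖ := by
          rw [eulerNode]; congr 1; abel
      _ ≤ _ := norm_add_le _ _
      _ ≤ C * ((l - k) * h) + h * C := add_le_add ih h1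
      _ = _ := by push_cast; ring

/-- Increments of the Euler scheme are multiples of averages of the values of the vector field. -/
theorem exists_eulerNode_sub_eq {f : ℝ × E → E} {h t₀ : ℝ} {z₀ : E} {S : Set E}
    (hS : Convex ℝ S) {k l : ℕ} (hkl : k < l)
    (hmem : ∀ i, k ≤ i → i < l → f (t₀ + i * h, eulerNode f h t₀ z₀ i) ∈ S) :
    ∃ s ∈ S, eulerNode f h t₀ z₀ l - eulerNode f h t₀ z₀ k = ((l - k) * h) • s := by
  induction l, Nat.succ_le_of_lt hkl using Nat.le_induction with
  | base =>
    refine ⟨_, hmem k le_rfl hkl, ?_⟩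
    rw [Nat.succ_eq_add_one, eulerNode]
    simp
  | succ l hkl' ih =>
    obtain ⟨s, hs, hsl⟩ := ih hkl' fun i hi hil => hmem i hi (hil.trans (Nat.lt_succ_self l))
    have hlk : (0 : ℝ) < l - k := sub_pos.2 (by exact_mod_cast hkl')
    refine ⟨((l - k : ℝ) / (l - k + 1)) • s + ((1 : ℝ) / (l - k + 1)) •
      f (t₀ + l * h, eulerNode f h t₀ z₀ l), ?_, ?_⟩
    · refine hS hs (hmem l (Nat.le_of_succ_le hkl') (Nat.lt_succ_self l)) (by positivity)
        (by positivity) (by field_simp)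
    · have h1 : eulerNode f h t₀ z₀ (l + 1) - eulerNode f h t₀ z₀ k
          = (eulerNode f h t₀ z₀ l - eulerNode f h t₀ z₀ k)
            + h • f (t₀ + l * h, eulerNode f h t₀ z₀ l) := by
        rw [eulerNode]; abel
      rw [h1, hsl, smul_add, smul_smul, smul_smul]
      congr 2
      · push_cast; field_simp; ring
      · push_cast; field_simp; ring

/-- The step function through the nodes of the Euler scheme. -/
noncomputable def eulerStep (f : ℝ × E → E) (h t₀ : ℝ) (z₀ : E) (t : ℝ) : E :=
  eulerNode f h t₀ z₀ ⌊(t - t₀) / h⌋₊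

theorem floor_sub_floor_mul_le {h t₀ s t : ℝ} (hh : 0 < h) (hst : s ≤ t) :
    ((⌊(t - t₀) / h⌋₊ : ℝ) - ⌊(s - t₀) / h⌋₊) * h ≤ (t - s) + h := by
  rcases le_or_gt t t₀ with ht | ht
  · rw [Nat.floor_of_nonpos (div_nonpos_of_nonpos_of_nonneg (by linarith) hh.le),
      Nat.floor_of_nonpos (div_nonpos_of_nonpos_of_nonneg (by linarith) hh.le)]
    simp only [sub_self, zero_mul]
    linarith
  · have h1 := Nat.floor_le (div_nonneg (sub_nonneg.2 ht.le) hh.le)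
    have h2 := Nat.lt_floor_add_one ((s - t₀) / h)
    rw [le_div_iff₀ hh] at h1
    rw [div_lt_iff₀ hh] at h2
    nlinarith

theorem dist_eulerStep_le {f : ℝ × E → E} {C h t₀ : ℝ} {z₀ : E} (hf : ∀ p, ‖f p‖ ≤ C)
    (hC : 0 ≤ C) (hh : 0 < h) (s t : ℝ) :
    dist (eulerStep f h t₀ z₀ s) (eulerStep f h t₀ z₀ t) ≤ C * (dist s t + h) := by
  wlog hst : s ≤ t generalizing s t
  · rw [dist_comm, dist_comm s t]
    exact this t s (le_of_not_ge hst)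
  rw [dist_comm, dist_comm s t, dist_eq_norm, Real.dist_eq, abs_of_nonneg (sub_nonneg.2 hst)]
  refine (norm_eulerNode_sub_le hf hh.le (Nat.floor_mono ?_)).trans ?_
  · gcongr
  · exact mul_le_mul_of_nonneg_left (floor_sub_floor_mul_le hh hst) hC

theorem eulerStep_self (f : ℝ × E → E) (h t₀ : ℝ) (z₀ : E) : eulerStep f h t₀ z₀ t₀ = z₀ := by
  simp [eulerStep, eulerNode]

/-- A bounded vector field, however discontinuous, has a Krasovskii solution. The solution is the
limit of Euler schemes along an ultrafilter; pointwise convergence suffices because a difference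
quotient of the solution is a limit of averages of nearby values of the field. -/
theorem exists_krasovskii_solution [FiniteDimensional ℝ E] {f : ℝ × E → E} {C : ℝ}
    (hf : ∀ p, ‖f p‖ ≤ C) (t₀ : ℝ) (z₀ : E) :
    ∃ y : ℝ → E, LipschitzWith C.toNNReal y ∧ y t₀ = z₀ ∧ ∀ t, t₀ ≤ t → ∀ v, HasDerivAt y v t →
      ∀ ε > 0, v ∈ closure (convexHull ℝ (f '' Metric.ball (t, y t) ε)) := by
  have hC : 0 ≤ C := (norm_nonneg _).trans (hf (0, 0))
  have : ProperSpace E := FiniteDimensional.proper ℝ E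
  set U : Ultrafilter ℕ := hyperfilter ℕ
  have hU : (U : Filter ℕ) ≤ atTop := Nat.hyperfilter_le_atTop
  set h : ℕ → ℝ := fun n => 1 / ((n : ℝ) + 1) with hh
  have hpos : ∀ n, 0 < h n := fun n => by positivity
  have hlim : Tendsto h U (𝓝 0) := tendsto_one_div_add_atTop_nhds_zero_nat.mono_left hU
  set Y : ℕ → ℝ → E := fun n => eulerStep f (h n) t₀ z₀ with hY
  have hYlip : ∀ n s t, dist (Y n s) (Y n t) ≤ C * (dist s t + h n) := fun n =>
    dist_eulerStep_le hf hC (hpos n)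
  have hex : ∀ t, ∃ z, Tendsto (fun n => Y n t) U (𝓝 z) := by
    intro t
    have hcpt : IsCompact (Metric.closedBall z₀ (C * (dist t t₀ + 1))) := isCompact_closedBall _ _
    have hmem : ∀ n, Y n t ∈ Metric.closedBall z₀ (C * (dist t t₀ + 1)) := by
      intro n
      rw [Metric.mem_closedBall]
      have h1 := hYlip n t t₀
      have h2 : Y n t₀ = z₀ := eulerStep_self _ _ _ _
      rw [h2] at h1
      refine h1.trans (mul_le_mul_of_nonneg_left ?_ hC)
      have : h n ≤ 1 := by
        simp only [hh]
        rw [div_le_one (by positivity)]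
        linarith [Nat.cast_nonneg (α := ℝ) n]
      linarith
    obtain ⟨z, -, hz⟩ := hcpt.ultrafilter_le_nhds (U.map fun n => Y n t)
      (le_principal_iff.2 (Filter.mem_map.2 (Filter.univ_mem' hmem)))
    exact ⟨z, hz⟩
  choose y hy using hex
  have hylip : ∀ s t, dist (y s) (y t) ≤ C * dist s t := by
    intro s t
    have h1 : Tendsto (fun n => C * (dist s t + h n)) U (𝓝 (C * (dist s t + 0))) :=
      (tendsto_const_nhds.add hlim).const_mul C
    rw [add_zero] at h1
    exact le_of_tendsto_of_tendsto ((hy s).dist (hy t)) h1 (Eventually.of_forall fun n => hYlip n s t)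
  refine ⟨y, LipschitzWith.of_dist_le_mul fun s t => ?_, ?_, ?_⟩
  · rw [Real.coe_toNNReal _ hC]; exact hylip s t
  · refine tendsto_nhds_unique (hy t₀) ?_
    simp [hY, eulerStep_self]
  intro t ht v hv ε hε
  have hslope := (hasDerivWithinAt_iff_tendsto_slope' (self_notMem_Ioi)).1
    (hv.hasDerivWithinAt (s := Ioi t))
  refine isClosed_closure.mem_of_tendsto hslope ?_
  -- for differences `r - t < τ₀` and small steps, all nodes used between the times `t` and `r` lie
  -- in the ball of radius `ε`
  set τ₀ := min (ε / 2) (ε / (4 * (C + 1)))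
  have hτ₀ : 0 < τ₀ := lt_min (by positivity) (by positivity)
  filter_upwards [Ioo_mem_nhdsGT (show t < t + τ₀ by linarith)] with r hr
  have hτ : 0 < r - t := sub_pos.2 hr.1
  have hrτ : r - t < τ₀ := by linarith [hr.2]
  have hτ1 : r - t < ε / 2 := hrτ.trans_le (min_le_left _ _)
  have hτ2 : C * (r - t) ≤ ε / 4 := by
    have h1 : r - t < ε / (4 * (C + 1)) := hrτ.trans_le (min_le_right _ _)
    rw [lt_div_iff₀ (by positivity)] at h1
    nlinarith
  -- the numbers of Euler steps up to the times `t` and `r`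
  set k : ℕ → ℕ := fun n => ⌊(t - t₀) / h n⌋₊
  set l : ℕ → ℕ := fun n => ⌊(r - t₀) / h n⌋₊
  have hk : ∀ n, (k n : ℝ) * h n ≤ t - t₀ ∧ t - t₀ < (k n + 1) * h n := fun n =>
    ⟨(le_div_iff₀ (hpos n)).1 (Nat.floor_le (div_nonneg (sub_nonneg.2 ht) (hpos n).le)),
      (div_lt_iff₀ (hpos n)).1 (Nat.lt_floor_add_one _)⟩
  have hl : ∀ n, (l n : ℝ) * h n ≤ r - t₀ ∧ r - t₀ < (l n + 1) * h n := fun n =>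
    ⟨(le_div_iff₀ (hpos n)).1 (Nat.floor_le (div_nonneg (by linarith) (hpos n).le)),
      (div_lt_iff₀ (hpos n)).1 (Nat.lt_floor_add_one _)⟩
  have hlen : Tendsto (fun n => ((l n : ℝ) - k n) * h n) U (𝓝 (r - t)) := by
    have h1 : Tendsto (fun n => (r - t) - h n) U (𝓝 (r - t)) := by
      simpa using tendsto_const_nhds.sub hlim
    have h2 : Tendsto (fun n => (r - t) + h n) U (𝓝 (r - t)) := by
      simpa using tendsto_const_nhds.add hlim
    refine tendsto_of_tendsto_of_tendsto_of_le_of_le h1 h2 (fun n => ?_) (fun n => ?_)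
    · have := (hk n).1; have := (hl n).2; simp only; nlinarith
    · have := (hk n).2; have := (hl n).1; simp only; nlinarith
  have hquot : Tendsto (fun n => (((l n : ℝ) - k n) * h n)⁻¹ • (Y n r - Y n t)) U
      (𝓝 (slope y t r)) := by
    rw [slope_def_module]
    exact (hlen.inv₀ hτ.ne').smul ((hy r).sub (hy t))
  refine isClosed_closure.mem_of_tendsto hquot ?_
  have he1 : ∀ᶠ n in U, h n < min (r - t) (min (ε / 2) (ε / (4 * (C + 1)))) :=
    hlim.eventually_lt_const (lt_min hτ hτ₀)
  have he2 : ∀ᶠ n in U, dist (Y n t) (y t) < ε / 4 := (Metric.tendsto_nhds.1 (hy t)) _ (by positivity)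
  filter_upwards [he1, he2] with n hn1 hn2
  rw [lt_min_iff, lt_min_iff] at hn1
  obtain ⟨hn1, hn3, hn4⟩ := hn1
  have hCh : C * h n ≤ ε / 4 := by
    rw [lt_div_iff₀ (by positivity)] at hn4
    nlinarith [hpos n]
  have hkl : k n < l n := by
    have h1 := (hk n).1
    have h2 := (hl n).2
    have h3 : (k n : ℝ) * h n < l n * h n := by nlinarith
    exact_mod_cast lt_of_mul_lt_mul_right h3 (hpos n).le
  obtain ⟨s, hs, hseq⟩ := exists_eulerNode_sub_eq (f := f) (h := h n) (t₀ := t₀) (z₀ := z₀)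
    (convex_convexHull ℝ (f '' Metric.ball (t, y t) ε)) hkl (by
      intro i hi1 hi2
      refine subset_convexHull ℝ _ (mem_image_of_mem _ ?_)
      have hi1' : (k n : ℝ) ≤ i := by exact_mod_cast hi1
      have hi2' : (i : ℝ) ≤ l n := by exact_mod_cast hi2.le
      have e1 : (k n : ℝ) * h n ≤ i * h n := mul_le_mul_of_nonneg_right hi1' (hpos n).le
      have e2 : (i : ℝ) * h n ≤ l n * h n := mul_le_mul_of_nonneg_right hi2' (hpos n).le
      rw [Metric.mem_ball, Prod.dist_eq, max_lt_iff]
      constructor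
      · rw [Real.dist_eq, abs_lt]
        constructor
        · nlinarith [(hk n).2]
        · nlinarith [(hl n).1]
      · have h1 := norm_eulerNode_sub_le (t₀ := t₀) (z₀ := z₀) hf (hpos n).le hi1
        have h2 : C * (((i : ℝ) - k n) * h n) ≤ C * ((r - t) + h n) := by
          refine mul_le_mul_of_nonneg_left ?_ hC
          nlinarith [(hk n).2, (hl n).1]
        have h3 := dist_triangle (eulerNode f (h n) t₀ z₀ i) (Y n t) (y t)
        have h4 : dist (eulerNode f (h n) t₀ z₀ i) (Y n t) ≤ C * (((i : ℝ) - k n) * h n) := by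
          rw [dist_eq_norm]; exact h1
        linarith)
  have hne : ((l n : ℝ) - k n) * h n ≠ 0 := by
    have : (0 : ℝ) < l n - k n := sub_pos.2 (by exact_mod_cast hkl)
    exact (mul_pos this (hpos n)).ne'
  have hYs : Y n r - Y n t = (((l n : ℝ) - k n) * h n) • s := hseq
  rw [hYs, inv_smul_smul₀ hne]
  exact subset_closure hs

/-- Local existence: the vector field need only be bounded near the initial point. -/
theorem exists_local_krasovskii_solution [FiniteDimensional ℝ E] {f : ℝ × E → E} {C ρ : ℝ}
    {t₀ : ℝ} {z₀ : E} (hρ : 0 < ρ) (hf : ∀ p ∈ Metric.ball (t₀, z₀) ρ, ‖f p‖ ≤ C) :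
    ∃ (y : ℝ → E) (K : NNReal) (h : ℝ), 0 < h ∧ LipschitzWith K y ∧ y t₀ = z₀ ∧
      ∀ t ∈ Icc t₀ (t₀ + h), (t, y t) ∈ Metric.ball (t₀, z₀) ρ ∧ ∀ v, HasDerivAt y v t →
        ∀ ε > 0, v ∈ closure (convexHull ℝ (f '' Metric.ball (t, y t) ε)) := by
  classical
  set g : ℝ × E → E := fun p => if p ∈ Metric.ball (t₀, z₀) ρ then f p else 0
  have hC : 0 ≤ C := (norm_nonneg _).trans (hf (t₀, z₀) (Metric.mem_ball_self hρ))
  have hg : ∀ p, ‖g p‖ ≤ C := by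
    intro p
    simp only [g]
    split_ifs with hp
    · exact hf p hp
    · simpa using hC
  obtain ⟨y, hy, hy0, hyd⟩ := exists_krasovskii_solution hg t₀ z₀
  have hcont : Continuous fun t => (t, y t) := continuous_id.prodMk hy.continuous
  have hnear : ∀ᶠ t in 𝓝 t₀, (t, y t) ∈ Metric.ball (t₀, z₀) ρ := by
    refine hcont.continuousAt.eventually_mem (x := t₀) ?_
    simp only [hy0]
    exact Metric.ball_mem_nhds _ hρ
  obtain ⟨h, hh, hball⟩ := Metric.nhds_basis_closedBall.eventually_iff.1 hnear
  refine ⟨y, _, h, hh, hy, hy0, fun t ht => ?_⟩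
  have htb : (t, y t) ∈ Metric.ball (t₀, z₀) ρ := by
    refine hball ?_
    rw [Metric.mem_closedBall, Real.dist_eq, abs_of_nonneg (by linarith [ht.1])]
    linarith [ht.2]
  refine ⟨htb, fun v hv ε hε => ?_⟩
  obtain ⟨η, hη, hsub⟩ := Metric.isOpen_iff.1 Metric.isOpen_ball _ htb
  refine closure_mono (convexHull_mono ?_) (hyd t ht.1 v hv (min ε η) (lt_min hε hη))
  rintro _ ⟨p, hp, rfl⟩
  have hpb := hsub (Metric.ball_subset_ball (min_le_right _ _) hp)
  refine ⟨p, Metric.ball_subset_ball (min_le_left _ _) hp, ?_⟩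
  simp only [g, if_pos hpb]

end Existence

section

/-! ### Curves of rotations and gradients -/

theorem hasEntryDerivAt_iff {A : ℝ → Mat3} {A' : Mat3} {t : ℝ} :
    HasEntryDerivAt A A' t ↔ HasDerivAt (fun s => matVec (A s)) (matVec A') t := by
  rw [hasDerivAt_euclidean_iff, Prod.forall]
  rfl

theorem tendsto_SO3_iff {ι : Type*} {l : Filter ι} {X : ι → SO3} {Y : SO3} :
    Tendsto X l (𝓝 Y) ↔ ∀ i k, Tendsto (fun s => (X s : Mat3) i k) l (𝓝 ((Y : Mat3) i k)) := by
  rw [tendsto_subtype_rng]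
  exact tendsto_pi_nhds.trans (forall_congr' fun i => tendsto_pi_nhds)

theorem continuousOn_SO3_iff {X : ℝ → SO3} {s : Set ℝ} :
    ContinuousOn X s ↔ ∀ i k, ContinuousOn (fun t => (X t : Mat3) i k) s := by
  simp only [ContinuousOn, ContinuousWithinAt, tendsto_SO3_iff]
  grind

theorem HasGradientSO3.hasDerivAt_comp {f : SO3 → ℝ} {X : ℝ → SO3} {G A : Mat3} {t : ℝ}
    (hf : HasGradientSO3 f (X t) G) (hX : HasEntryDerivAt (fun s => (X s : Mat3)) A t) :
    HasDerivAt (fun s => f (X s)) (matInner G A) t := by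
  have hXt : Tendsto X (𝓝 t) (𝓝 (X t)) :=
    tendsto_SO3_iff.2 fun i k => (hX i k).continuousAt
  have hX' := hasEntryDerivAt_iff.1 hX
  have hO : (fun s => frobNorm ((X s : Mat3) - (X t : Mat3))) =O[𝓝 t] fun s => s - t := by
    simp only [frobNorm_eq_norm, matVec_sub]
    exact hX'.isBigO_sub.norm_left
  have h1 := (hf.2.comp_tendsto hXt).trans_isBigO hO
  have h2 := ((innerSL ℝ (matVec G)).hasFDerivAt.comp_hasDerivAt t hX')
  rw [hasDerivAt_iff_isLittleO] at h2 ⊢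
  refine (h1.add h2).congr_left fun s => ?_
  simp only [Function.comp_apply, matInner_eq_inner, matVec_sub, inner_sub_right,
    innerSL_apply_apply]
  ring

theorem HasGradientSO3.eventually_abs_sub_le {f : SO3 → ℝ} {Y : SO3} {G : Mat3}
    (hf : HasGradientSO3 f Y G) :
    ∀ᶠ Z in 𝓝 Y, |f Z - f Y| ≤ (frobNorm G + 1) * frobNorm ((Z : Mat3) - (Y : Mat3)) := by
  filter_upwards [hf.2.bound one_pos] with Z hZ
  rw [Real.norm_eq_abs, Real.norm_of_nonneg (frobNorm_nonneg _)] at hZ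
  have h1 := abs_matInner_le G ((Z : Mat3) - (Y : Mat3))
  have h2 := abs_add_le (f Z - f Y - matInner G ((Z : Mat3) - (Y : Mat3)))
    (matInner G ((Z : Mat3) - (Y : Mat3)))
  rw [sub_add_cancel] at h2
  linarith

/-- Along a curve with Lipschitz entries through points of differentiability with bounded gradient,
the function is Lipschitz. -/
theorem abs_comp_sub_le {f : SO3 → ℝ} (hf : Continuous f) {X : ℝ → SO3} {a b g M : ℝ} (hab : a ≤ b)
    (hM : 0 ≤ M) (hX : ∀ s ∈ Icc a b, ∀ t ∈ Icc a b, s ≤ t → ∀ i k,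
      |(X t : Mat3) i k - (X s : Mat3) i k| ≤ M * (t - s))
    (hgrad : ∀ t ∈ Ioo a b, ∃ G, HasGradientSO3 f (X t) G ∧ frobNorm G ≤ g) :
    |f (X b) - f (X a)| ≤ (g + 1) * (3 * M) * (b - a) := by
  have hcont : ContinuousOn X (Icc a b) := by
    rw [continuousOn_SO3_iff]
    intro i k
    refine (LipschitzOnWith.of_dist_le_mul (K := M.toNNReal) fun s hs t ht => ?_).continuousOn
    rw [Real.coe_toNNReal _ hM, Real.dist_eq, Real.dist_eq]
    rcases le_total s t with h | h
    · rw [abs_sub_comm, abs_sub_comm s t, abs_of_nonneg (sub_nonneg.2 h)]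
      exact hX s hs t ht h i k
    · rw [abs_of_nonneg (sub_nonneg.2 h)]
      exact hX t ht s hs h i k
  refine abs_sub_le_of_forall_eventually (f := fun t => f (X t)) hab
    (hf.comp_continuousOn hcont) fun t ht => ?_
  obtain ⟨G, hG, hGg⟩ := hgrad t ht
  have hnhds : Icc a b ∈ 𝓝 t := Icc_mem_nhds ht.1 ht.2
  have h1 := (hcont.continuousAt hnhds).eventually hG.eventually_abs_sub_le
  filter_upwards [nhdsWithin_le_nhds h1, nhdsWithin_le_nhds hnhds, self_mem_nhdsWithin]
    with z hz hzab htz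
  refine hz.trans ?_
  have h2 : frobNorm ((X z : Mat3) - (X t : Mat3)) ≤ 3 * (M * (z - t)) :=
    frobNorm_le_of_abs_le (mul_nonneg hM (sub_nonneg.2 (le_of_lt htz)))
      fun i k => hX t (Ioo_subset_Icc_self ht) z hzab (le_of_lt htz) i k
  have h3 := frobNorm_nonneg G
  have h4 := frobNorm_nonneg ((X z : Mat3) - (X t : Mat3))
  have h5 : 0 ≤ g := h3.trans hGg
  calc _ ≤ (g + 1) * (3 * (M * (z - t))) := by gcongr
    _ = _ := by ring

theorem hasGradientSO3_gradSO3 {f : SO3 → ℝ} {R : SO3} (h : ∃ G, HasGradientSO3 f R G) :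
    HasGradientSO3 f R (gradSO3 f R) := by
  rw [gradSO3, dif_pos h]
  exact h.choose_spec

/-! ### The closed loop along flows -/

variable {𝒬 : Finset ℕ}

/-- The standing assumptions on the design: positive gains, a potential function that is
differentiable on the flow set, and quadratic bounds. -/
structure Admissible (d : Design 𝒬) (𝒟 : Set (SO3 × 𝒬)) (α₁ α₂ α₃ α₄ : ℝ) : Prop where
  γP_pos : 0 < d.γP
  γI_pos : 0 < d.γI
  bbar_nonneg : 0 ≤ d.bbar
  potential : IsPotential d.Φ 𝒟
  flowSet_subset : flowSet d.Φ d.δ ⊆ 𝒟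
  α₁_pos : 0 < α₁
  α₂_pos : 0 < α₂
  α₄_pos : 0 < α₄
  bounds : ∀ X q, α₁ * attNorm X ^ 2 ≤ d.Φ X q ∧ d.Φ X q ≤ α₂ * attNorm X ^ 2
  grad_bounds : ∀ X q, (X, q) ∈ flowSet d.Φ d.δ →
    α₃ * attNorm X ^ 2 ≤ frobNorm (gradSO3 (fun Y => d.Φ Y q) X) ^ 2 ∧
      frobNorm (gradSO3 (fun Y => d.Φ Y q) X) ^ 2 ≤ α₄ * attNorm X ^ 2

/-- At time `t` the curves `R`, `Rh`, `bh` satisfy the kinematics and the observer equations with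
index `q`, with angular velocity `ω` and bias `b`, in the flow set. -/
structure FlowAt (d : Design 𝒬) (ω b : Vec3) (q : 𝒬) (R Rh : ℝ → SO3) (bh : ℝ → Vec3) (t : ℝ) :
    Prop where
  mem : (R t * (Rh t)⁻¹, q) ∈ flowSet d.Φ d.δ
  deriv_R : HasMatDerivAt R ((R t : Mat3) * skew ω) t
  deriv_Rh : HasMatDerivAt Rh ((Rh t : Mat3) * skew ((ω + b) - bh t
    + d.γP • d.beta (R t * (Rh t)⁻¹) (Rh t) q)) t
  deriv_bh : ∃ v ∈ krasovskii (proj d.bbar (-(d.γI • d.beta (R t * (Rh t)⁻¹) (Rh t) q))) (bh t),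
    HasDerivAt bh v t

theorem beta_eq {d : Design 𝒬} {Rt Rh : SO3} {q : 𝒬} {u : Vec3}
    (hu : gradSO3 (fun X => d.Φ X q) Rt = (Rt : Mat3) * skew u) :
    d.beta Rt Rh q = rot (Rh : Mat3).transpose u := by
  rw [Design.beta, hu, ← mul_assoc, SO3.transpose_mul_self, one_mul, vee_skew]
  rfl

theorem frobNorm_SO3_mul (R : SO3) (A : Mat3) : frobNorm ((R : Mat3) * A) = frobNorm A := by
  rw [frobNorm, frobNorm, matInner_mul_left]

namespace Admissible

variable {d : Design 𝒬} {𝒟 : Set (SO3 × 𝒬)} {α₁ α₂ α₃ α₄ : ℝ}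

theorem hasGradient (hd : Admissible d 𝒟 α₁ α₂ α₃ α₄) {X : SO3} {q : 𝒬}
    (h : (X, q) ∈ flowSet d.Φ d.δ) :
    HasGradientSO3 (fun Y => d.Φ Y q) X (gradSO3 (fun Y => d.Φ Y q) X) :=
  hasGradientSO3_gradSO3 (hd.potential.differentiable (X, q) (hd.flowSet_subset h))

theorem frobNorm_grad_le (hd : Admissible d 𝒟 α₁ α₂ α₃ α₄) {X : SO3} {q : 𝒬}
    (h : (X, q) ∈ flowSet d.Φ d.δ) :
    frobNorm (gradSO3 (fun Y => d.Φ Y q) X) ≤ √α₄ * attNorm X := by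
  rw [← sq_le_sq₀ (frobNorm_nonneg _) (mul_nonneg (Real.sqrt_nonneg _) (attNorm_nonneg _)),
    mul_pow, Real.sq_sqrt hd.α₄_pos.le]
  exact (hd.grad_bounds X q h).2

theorem norm_beta_le (hd : Admissible d 𝒟 α₁ α₂ α₃ α₄) {X : SO3} {q : 𝒬} (Rh : SO3)
    (h : (X, q) ∈ flowSet d.Φ d.δ) : ‖d.beta X Rh q‖ ≤ √α₄ * attNorm X := by
  obtain ⟨u, hu⟩ := (hd.hasGradient h).1
  rw [beta_eq hu, norm_rot_transpose]
  refine le_trans ?_ (hd.frobNorm_grad_le h)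
  rw [hu, frobNorm_SO3_mul, frobNorm_skew]
  have h1 : (1 : ℝ) ≤ √2 := Real.one_le_sqrt.2 (by norm_num)
  nlinarith [norm_nonneg u]

end Admissible

theorem attNorm_le_two (X : SO3) : attNorm X ≤ 2 := by
  nlinarith [attNorm_sq_le X, attNorm_nonneg X]

namespace FlowAt

variable {d : Design 𝒬} {𝒟 : Set (SO3 × 𝒬)} {α₁ α₂ α₃ α₄ : ℝ} {ω b : Vec3} {q : 𝒬}
  {R Rh : ℝ → SO3} {bh : ℝ → Vec3} {t : ℝ}

/-- The attitude error dynamics do not involve the angular velocity. -/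
theorem hasEntryDerivAt_error (h : FlowAt d ω b q R Rh bh t) (hd : Admissible d 𝒟 α₁ α₂ α₃ α₄) :
    HasEntryDerivAt (fun s => ((R s * (Rh s)⁻¹ : SO3) : Mat3))
      (skew (rot (R t : Mat3) (bh t - b)) * ((R t * (Rh t)⁻¹ : SO3) : Mat3)
        - d.γP • gradSO3 (fun Y => d.Φ Y q) (R t * (Rh t)⁻¹)) t := by
  obtain ⟨u, hu⟩ := (hd.hasGradient h.mem).1
  have h1 := HasEntryDerivAt.mul (A := fun s => (R s : Mat3))
    (B := fun s => (Rh s : Mat3).transpose) h.deriv_R (HasEntryDerivAt.transpose h.deriv_Rh)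
  have h2 : skew (rot (R t : Mat3) (bh t - b)) * ((R t * (Rh t)⁻¹ : SO3) : Mat3)
        - d.γP • gradSO3 (fun Y => d.Φ Y q) (R t * (Rh t)⁻¹)
      = (R t : Mat3) * skew ω * (Rh t : Mat3).transpose + (R t : Mat3) *
        ((Rh t : Mat3) * skew ((ω + b) - bh t
          + d.γP • d.beta (R t * (Rh t)⁻¹) (Rh t) q)).transpose := by
    have h3 : skew (rot (Rh t : Mat3).transpose u) * (Rh t : Mat3).transpose
        = (Rh t : Mat3).transpose * skew u := skew_rot_mul (Rh t)⁻¹ u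
    rw [hu, beta_eq hu, SO3.coe_mul, SO3.coe_inv, ← mul_assoc (skew _), skew_rot_mul,
      Matrix.transpose_mul, skew_transpose, mul_assoc (R t : Mat3), mul_assoc (R t : Mat3),
      mul_assoc (R t : Mat3), ← mul_add, ← Matrix.mul_smul, ← mul_sub]
    congr 1
    rw [skew_add, skew_sub, skew_sub, skew_add, skew_smul, neg_mul, add_mul, sub_mul, sub_mul,
      add_mul, Matrix.smul_mul, h3]
    abel
  rw [h2]
  exact h1

/-- The cross term of the Lyapunov function has derivative at least `2 ‖b̂ - b‖²` up to terms that
vanish with the attitude error. -/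
theorem cross_deriv (h : FlowAt d ω b q R Rh bh t) (hd : Admissible d 𝒟 α₁ α₂ α₃ α₄)
    {v : Vec3} (hv : v ∈ krasovskii (proj d.bbar
      (-(d.γI • d.beta (R t * (Rh t)⁻¹) (Rh t) q))) (bh t)) (hbv : HasDerivAt bh v t)
    {B c : ℝ} (hB : ‖bh t - b‖ ≤ B) (hω : ‖ω‖ ≤ c) :
    ∃ X', HasDerivAt (fun s => matInner ((R s * (Rh s)⁻¹ : SO3) : Mat3)
        (skew (rot (R s : Mat3) (bh s - b)))) X' t ∧
      2 * ‖bh t - b‖ ^ 2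
        - (4 * B + 2 * d.γP * √α₄ + 4 * c) * (‖bh t - b‖ * attNorm (R t * (Rh t)⁻¹))
        - 4 * d.γI * √α₄ * attNorm (R t * (Rh t)⁻¹) ^ 2 ≤ X' := by
  set Rt := R t * (Rh t)⁻¹ with hRt
  set G := gradSO3 (fun Y => d.Φ Y q) Rt with hG
  set w := rot (R t : Mat3) (bh t - b) with hw
  have hwn : ‖w‖ = ‖bh t - b‖ := norm_rot _ _
  set w' := rot ((R t : Mat3) * skew ω) (bh t - b) + rot (R t : Mat3) v with hw'
  have hdw : HasDerivAt (fun s => rot (R s : Mat3) (bh s - b)) w' t :=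
    HasEntryDerivAt.rot (A := fun s => (R s : Mat3)) h.deriv_R (hbv.sub_const b)
  have hX := (h.hasEntryDerivAt_error hd).matInner hdw.skew
  refine ⟨_, hX, ?_⟩
  simp only [← hRt, ← hG, ← hw]
  have hβ := hd.norm_beta_le (Rh t) h.mem
  rw [← hRt] at hβ
  have hvn : ‖v‖ ≤ d.γI * (√α₄ * attNorm Rt) := by
    refine (norm_le_of_mem_krasovskii_proj hv).trans ?_
    rw [norm_neg, norm_smul, Real.norm_of_nonneg hd.γI_pos.le]
    exact mul_le_mul_of_nonneg_left hβ hd.γI_pos.le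
  have hw'n : ‖w'‖ ≤ c * ‖bh t - b‖ + d.γI * (√α₄ * attNorm Rt) := by
    refine (norm_add_le _ _).trans (add_le_add ((norm_rot_skew_le _ _ _).trans ?_) ?_)
    · gcongr
    · rwa [norm_rot]
  have hρ := attNorm_nonneg Rt
  have hD := frobNorm_sub_one Rt
  have h2 : √2 * √2 = 2 := Real.mul_self_sqrt (by norm_num)
  have hT1 : matInner (skew w * (Rt : Mat3)) (skew w)
      = matInner (skew w * ((Rt : Mat3) - 1)) (skew w) + 2 * ‖bh t - b‖ ^ 2 := by
    rw [mul_sub, mul_one, matInner_sub_left, matInner_self, frobNorm_skew_sq, hwn]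
    ring
  have hT2 : |matInner (skew w * ((Rt : Mat3) - 1)) (skew w)|
      ≤ 4 * B * (‖bh t - b‖ * attNorm Rt) := by
    refine (abs_matInner_le _ _).trans ?_
    refine (mul_le_mul_of_nonneg_right (frobNorm_skew_mul_le _ _) (frobNorm_nonneg _)).trans ?_
    rw [frobNorm_skew, hwn, hD]
    calc _ = 2 * (√2 * √2) * ‖bh t - b‖ * (‖bh t - b‖ * attNorm Rt) := by ring
      _ ≤ 4 * B * (‖bh t - b‖ * attNorm Rt) := by
        rw [h2]
        gcongr
        linarith
  have hT3 : |matInner G (skew w)| ≤ 2 * √α₄ * (‖bh t - b‖ * attNorm Rt) := by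
    refine (abs_matInner_le _ _).trans ?_
    rw [frobNorm_skew, hwn]
    have h3 : √2 ≤ 2 := by nlinarith [Real.sqrt_nonneg 2]
    calc _ ≤ (√α₄ * attNorm Rt) * (2 * ‖bh t - b‖) := by
          have := hd.frobNorm_grad_le h.mem
          gcongr
      _ = _ := by ring
  have hT4 := abs_matInner_skew_le Rt w'
  rw [matInner_sub_left, matInner_smul_left, hT1]
  have e3 := mul_le_mul_of_nonneg_left ((le_abs_self _).trans hT3) hd.γP_pos.le
  have e4 : 4 * attNorm Rt * ‖w'‖
      ≤ 4 * attNorm Rt * (c * ‖bh t - b‖ + d.γI * (√α₄ * attNorm Rt)) := by gcongr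
  linarith [(abs_le.1 hT2).1, (abs_le.1 hT4).1]

/-- Without the cross term, the energy dissipates only the attitude error. -/
theorem energy_deriv (h : FlowAt d ω b q R Rh bh t) (hd : Admissible d 𝒟 α₁ α₂ α₃ α₄)
    (hb : ‖b‖ ≤ d.bbar) {v : Vec3} (hv : v ∈ krasovskii (proj d.bbar
      (-(d.γI • d.beta (R t * (Rh t)⁻¹) (Rh t) q))) (bh t)) (hbv : HasDerivAt bh v t) :
    ∃ V', HasDerivAt (fun s => d.Φ (R s * (Rh s)⁻¹) q + ‖bh s - b‖ ^ 2 / d.γI) V' t ∧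
      V' ≤ -(d.γP * α₃) * attNorm (R t * (Rh t)⁻¹) ^ 2 := by
  obtain ⟨u, hu⟩ := (hd.hasGradient h.mem).1
  have hΦ' := (hd.hasGradient h.mem).hasDerivAt_comp (X := fun s => R s * (Rh s)⁻¹)
    (h.hasEntryDerivAt_error hd)
  have hb' := ((hbv.sub_const b).norm_sq).div_const d.γI
  refine ⟨_, hΦ'.add hb', ?_⟩
  have hin := inner_sub_le_of_mem_krasovskii_proj hb hv
  have hg := (hd.grad_bounds _ _ h.mem).1
  rw [matInner_sub_right, matInner_smul_right, matInner_self]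
  have hβ := beta_eq (Rh := Rh t) hu
  have hcross : matInner (gradSO3 (fun Y => d.Φ Y q) (R t * (Rh t)⁻¹))
      (skew (rot (R t : Mat3) (bh t - b)) * ((R t * (Rh t)⁻¹ : SO3) : Mat3))
      = 2 * inner ℝ (bh t - b) (d.beta (R t * (Rh t)⁻¹) (Rh t) q) := by
    have h1 : rot (R t : Mat3) (bh t - b)
        = rot ((R t * (Rh t)⁻¹ : SO3) : Mat3) (rot (Rh t : Mat3) (bh t - b)) := by
      rw [← rot_mul, ← SO3.coe_mul, inv_mul_cancel_right]
    rw [h1, skew_rot_mul, hu, matInner_mul_left, matInner_skew_skew, hβ, real_inner_comm,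
      real_inner_comm (rot _ u), inner_rot_transpose, real_inner_comm]
  rw [hcross]
  rw [inner_neg_right, inner_smul_right] at hin
  have hin' : 2 * inner ℝ (bh t - b) v / d.γI
      ≤ -(2 * inner ℝ (bh t - b) (d.beta (R t * (Rh t)⁻¹) (Rh t) q)) := by
    rw [div_le_iff₀ hd.γI_pos]
    linarith
  have := mul_le_mul_of_nonneg_left hg hd.γP_pos.le
  linarith

theorem frobNorm_error_deriv_le (h : FlowAt d ω b q R Rh bh t)
    (hd : Admissible d 𝒟 α₁ α₂ α₃ α₄) {B : ℝ} (hB : ‖bh t - b‖ ≤ B) :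
    frobNorm (skew (rot (R t : Mat3) (bh t - b)) * ((R t * (Rh t)⁻¹ : SO3) : Mat3)
        - d.γP • gradSO3 (fun Y => d.Φ Y q) (R t * (Rh t)⁻¹)) ≤ 2 * B + d.γP * (2 * √α₄) := by
  rw [frobNorm_eq_norm, matVec_sub]
  refine (norm_sub_le _ _).trans (add_le_add ?_ ?_)
  · have h1 : rot (R t : Mat3) (bh t - b)
        = rot ((R t * (Rh t)⁻¹ : SO3) : Mat3) (rot (Rh t : Mat3) (bh t - b)) := by
      rw [← rot_mul, ← SO3.coe_mul, inv_mul_cancel_right]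
    rw [← frobNorm_eq_norm, h1, skew_rot_mul, frobNorm_SO3_mul, frobNorm_skew, norm_rot]
    have h3 : √2 ≤ 2 := Real.sqrt_le_iff.2 (by norm_num)
    gcongr
  · rw [matVec_smul, norm_smul, Real.norm_of_nonneg hd.γP_pos.le, ← frobNorm_eq_norm]
    refine mul_le_mul_of_nonneg_left ((hd.frobNorm_grad_le h.mem).trans ?_) hd.γP_pos.le
    rw [mul_comm]
    exact mul_le_mul_of_nonneg_right (attNorm_le_two _) (Real.sqrt_nonneg _)

end FlowAt

end

section

/-! ### Decay of the Lyapunov function along flows -/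

variable {𝒬 : Finset ℕ}

/-- The curves `R`, `Rh`, `bh` are absolutely continuous on `[s, t]` and flow, with index `q`,
on `(s, t)`. -/
structure FlowOn (d : Design 𝒬) (ω : ℝ → Vec3) (b : Vec3) (q : 𝒬) (R Rh : ℝ → SO3)
    (bh : ℝ → Vec3) (s t : ℝ) : Prop where
  le : s ≤ t
  ac_R : ∀ i k, AbsolutelyContinuousOnInterval (fun u => (R u : Mat3) i k) s t
  ac_Rh : ∀ i k, AbsolutelyContinuousOnInterval (fun u => (Rh u : Mat3) i k) s t
  ac_bh : AbsolutelyContinuousOnInterval bh s t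
  mem : ∀ u ∈ Ioo s t, (R u * (Rh u)⁻¹, q) ∈ flowSet d.Φ d.δ
  ae_flowAt : ∀ᵐ u, u ∈ Ioo s t → FlowAt d (ω u) b q R Rh bh u

/-- The Lyapunov function: the potential plus the energy of the bias error, minus a small cross
term that correlates the attitude error with the bias error. -/
noncomputable def lyapunov (d : Design 𝒬) (ε : ℝ) (b : Vec3) (q : 𝒬) (R Rh : SO3) (bh : Vec3) : ℝ :=
  d.Φ (R * Rh⁻¹) q + ‖bh - b‖ ^ 2 / d.γI
    - ε * matInner ((R * Rh⁻¹ : SO3) : Mat3) (skew (rot (R : Mat3) (bh - b)))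

variable {d : Design 𝒬} {𝒟 : Set (SO3 × 𝒬)} {α₁ α₂ α₃ α₄ : ℝ}

theorem Admissible.le_lyapunov (hd : Admissible d 𝒟 α₁ α₂ α₃ α₄) {ε : ℝ} (hε0 : 0 ≤ ε)
    (hε1 : ε ≤ 1) (hε : 16 * ε ≤ α₁ / d.γI) (b : Vec3) (q : 𝒬) (R Rh : SO3) (bh : Vec3) :
    min (α₁ / 2) (1 / (2 * d.γI)) * (attNorm (R * Rh⁻¹) ^ 2 + ‖bh - b‖ ^ 2)
      ≤ lyapunov d ε b q R Rh bh := by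
  have hγ := hd.γI_pos
  have hα := hd.α₁_pos
  have hcross := abs_matInner_skew_le (R * Rh⁻¹) (rot (R : Mat3) (bh - b))
  rw [norm_rot] at hcross
  have hΦ := (hd.bounds (R * Rh⁻¹) q).1
  rw [lyapunov]
  set ρ := attNorm (R * Rh⁻¹)
  set y := ‖bh - b‖
  have hρ : 0 ≤ ρ := attNorm_nonneg _
  have hy : 0 ≤ y := norm_nonneg _
  have hyoung : ε * (4 * ρ * y) ≤ α₁ / 2 * ρ ^ 2 + 1 / (2 * d.γI) * y ^ 2 := by
    refine abs_le_of_sq_le_sq' ?_ (by positivity) |>.2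
    have h1 : 16 * ε ^ 2 ≤ 4 * (α₁ / 2) * (1 / (2 * d.γI)) := by
      have : 4 * (α₁ / 2) * (1 / (2 * d.γI)) = α₁ / d.γI := by field_simp; ring
      rw [this]
      nlinarith
    have h2 := mul_le_mul_of_nonneg_right h1 (by positivity : 0 ≤ (ρ * y) ^ 2)
    nlinarith [sq_nonneg (α₁ / 2 * ρ ^ 2 - 1 / (2 * d.γI) * y ^ 2)]
  have h3 := mul_le_mul_of_nonneg_left ((le_abs_self _).trans hcross) hε0
  have h4 : y ^ 2 / d.γI = 1 / (2 * d.γI) * y ^ 2 + 1 / (2 * d.γI) * y ^ 2 := by field_simp; ring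
  have h5 := mul_le_mul_of_nonneg_right (min_le_left (α₁ / 2) (1 / (2 * d.γI))) (sq_nonneg ρ)
  have h6 := mul_le_mul_of_nonneg_right (min_le_right (α₁ / 2) (1 / (2 * d.γI))) (sq_nonneg y)
  linarith

theorem Admissible.lyapunov_le (hd : Admissible d 𝒟 α₁ α₂ α₃ α₄) {ε : ℝ} (hε0 : 0 ≤ ε)
    (hε1 : ε ≤ 1) (b : Vec3) (q : 𝒬) (R Rh : SO3) (bh : Vec3) :
    lyapunov d ε b q R Rh bh
      ≤ (α₂ + 1 / d.γI + 2) * (attNorm (R * Rh⁻¹) ^ 2 + ‖bh - b‖ ^ 2) := by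
  have hγ := hd.γI_pos
  have hα := hd.α₂_pos
  have hcross := abs_matInner_skew_le (R * Rh⁻¹) (rot (R : Mat3) (bh - b))
  rw [norm_rot] at hcross
  have hΦ := (hd.bounds (R * Rh⁻¹) q).2
  rw [lyapunov]
  set ρ := attNorm (R * Rh⁻¹)
  set y := ‖bh - b‖
  have h3 := mul_le_mul_of_nonneg_left ((neg_le_abs _).trans hcross) hε0
  have h4 : ε * (4 * ρ * y) ≤ 2 * (ρ ^ 2 + y ^ 2) := by
    have hρ : 0 ≤ ρ := attNorm_nonneg _
    have hy : 0 ≤ y := norm_nonneg _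
    calc ε * (4 * ρ * y) ≤ 1 * (4 * ρ * y) := by gcongr
      _ ≤ _ := by nlinarith [sq_nonneg (ρ - y)]
  have h5 : 0 ≤ α₂ * y ^ 2 + 1 / d.γI * ρ ^ 2 := by positivity
  have h6 : y ^ 2 / d.γI = 1 / d.γI * y ^ 2 := by ring
  linarith

namespace FlowOn

variable {ω : ℝ → Vec3} {b : Vec3} {q : 𝒬} {R Rh : ℝ → SO3} {bh : ℝ → Vec3} {s t : ℝ}

theorem mono (h : FlowOn d ω b q R Rh bh s t) {s' t' : ℝ} (hs : s ≤ s') (hst : s' ≤ t')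
    (ht : t' ≤ t) : FlowOn d ω b q R Rh bh s' t' := by
  have hsub : uIcc s' t' ⊆ uIcc s t := by
    rw [uIcc_of_le hst, uIcc_of_le h.le]
    exact Icc_subset_Icc hs ht
  have hoo : Ioo s' t' ⊆ Ioo s t := Ioo_subset_Ioo hs ht
  exact ⟨hst, fun i k => (h.ac_R i k).mono hsub, fun i k => (h.ac_Rh i k).mono hsub,
    h.ac_bh.mono hsub, fun u hu => h.mem u (hoo hu), h.ae_flowAt.mono fun u hu hu' => hu (hoo hu')⟩

/-- The projection keeps every ball that contains the ball of radius `bbar` invariant. -/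
theorem norm_bhat_le (h : FlowOn d ω b q R Rh bh s t) (hb : 0 ≤ d.bbar) {r : ℝ} (hr : d.bbar ≤ r)
    (hs : ‖bh s‖ ≤ r) : ‖bh t‖ ≤ r := by
  by_contra! hcon
  have hcont : ContinuousOn (fun u => ‖bh u‖) (Icc s t) := by
    have := h.ac_bh.continuousOn
    rw [uIcc_of_le h.le] at this
    exact this.norm
  -- the last time in the ball
  obtain ⟨u₀, hu₀, hmax⟩ := IsCompact.exists_isGreatest
    (isCompact_Icc.of_isClosed_subset
      (hcont.preimage_isClosed_of_isClosed isClosed_Icc (isClosed_Iic (a := r)))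
      inter_subset_left) ⟨s, ⟨le_rfl, h.le⟩, hs⟩
  have h' := h.mono hu₀.1.1 hu₀.1.2 le_rfl
  have hn : AbsolutelyContinuousOnInterval (fun u => ‖bh u‖) u₀ t :=
    lipschitzWith_one_norm.comp_absolutelyContinuousOnInterval h'.ac_bh
  have key := le_of_ae_hasDerivAt_nonpos hu₀.1.2 (hn.mul hn) (by
    filter_upwards [h'.ae_flowAt] with u hu hut
    obtain ⟨v, hv, hbv⟩ := (hu hut).deriv_bh
    refine ⟨2 * inner ℝ (bh u) v, ?_, ?_⟩
    · convert hbv.norm_sq using 1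
      funext x
      simp [sq]
    · have hur : r < ‖bh u‖ := by
        by_contra! hle
        exact (hmax ⟨⟨hu₀.1.1.trans hut.1.le, hut.2.le⟩, hle⟩).not_gt hut.1
      have := inner_nonpos_of_mem_krasovskii_proj hb (hr.trans_lt hur) hv
      linarith)
  simp only [Pi.mul_apply] at key
  have h1 : ‖bh u₀‖ ≤ r := hu₀.2
  nlinarith [norm_nonneg (bh u₀)]

theorem ac_error (h : FlowOn d ω b q R Rh bh s t) (i k : Fin 3) :
    AbsolutelyContinuousOnInterval (fun u => ((R u * (Rh u)⁻¹ : SO3) : Mat3) i k) s t := by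
  simp only [SO3.coe_mul, SO3.coe_inv, Matrix.mul_apply, Matrix.transpose_apply]
  exact absolutelyContinuousOnInterval_sum _ fun j _ => (h.ac_R i j).fun_mul (h.ac_Rh k j)

theorem ac_matInner {A B : ℝ → Mat3}
    (hA : ∀ i k, AbsolutelyContinuousOnInterval (fun u => A u i k) s t)
    (hB : ∀ i k, AbsolutelyContinuousOnInterval (fun u => B u i k) s t) :
    AbsolutelyContinuousOnInterval (fun u => matInner (A u) (B u)) s t := by
  simp only [matInner_eq_sum]
  exact absolutelyContinuousOnInterval_sum _ fun i _ =>
    absolutelyContinuousOnInterval_sum _ fun k _ => (hA i k).fun_mul (hB i k)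

theorem ac_skew {w : ℝ → Vec3} (hw : ∀ i, AbsolutelyContinuousOnInterval (fun u => w u i) s t)
    (i k : Fin 3) : AbsolutelyContinuousOnInterval (fun u => skew (w u) i k) s t := by
  have h0 : AbsolutelyContinuousOnInterval (fun _ : ℝ => (0 : ℝ)) s t :=
    (LipschitzWith.const (0 : ℝ)).lipschitzOnWith.absolutelyContinuousOnInterval
  fin_cases i <;> fin_cases k
  exacts [h0, (hw 2).fun_neg, hw 1, hw 2, h0, (hw 0).fun_neg, (hw 1).fun_neg, hw 0, h0]

theorem ac_coord {w : ℝ → Vec3} (hw : AbsolutelyContinuousOnInterval w s t) (i : Fin 3) :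
    AbsolutelyContinuousOnInterval (fun u => w u i) s t :=
  (EuclideanSpace.proj (𝕜 := ℝ) i).lipschitz.comp_absolutelyContinuousOnInterval hw

theorem ac_bias_error (h : FlowOn d ω b q R Rh bh s t) :
    AbsolutelyContinuousOnInterval (fun u => bh u - b) s t :=
  h.ac_bh.fun_sub (LipschitzWith.const b).lipschitzOnWith.absolutelyContinuousOnInterval

theorem abs_error_sub_le (h : FlowOn d ω b q R Rh bh s t) (hd : Admissible d 𝒟 α₁ α₂ α₃ α₄)
    {B : ℝ} (hB : ∀ u ∈ Icc s t, ‖bh u - b‖ ≤ B) (i k : Fin 3) :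
    |((R t * (Rh t)⁻¹ : SO3) : Mat3) i k - ((R s * (Rh s)⁻¹ : SO3) : Mat3) i k|
      ≤ (2 * B + d.γP * (2 * √α₄)) * (t - s) := by
  refine abs_sub_le_of_ae_hasDerivAt_abs_le h.le (h.ac_error i k) ?_
  filter_upwards [h.ae_flowAt] with u hu hut
  exact ⟨_, (hu hut).hasEntryDerivAt_error hd i k, (abs_apply_le_frobNorm _ _ _).trans
    ((hu hut).frobNorm_error_deriv_le hd (hB u (Ioo_subset_Icc_self hut)))⟩

theorem ac_potential (h : FlowOn d ω b q R Rh bh s t) (hd : Admissible d 𝒟 α₁ α₂ α₃ α₄)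
    {B : ℝ} (hB : ∀ u ∈ Icc s t, ‖bh u - b‖ ≤ B) :
    AbsolutelyContinuousOnInterval (fun u => d.Φ (R u * (Rh u)⁻¹) q) s t := by
  set M := 2 * B + d.γP * (2 * √α₄)
  have hM : 0 ≤ M := by
    have h1 := (norm_nonneg _).trans (hB s ⟨le_rfl, h.le⟩)
    have h2 := hd.γP_pos
    positivity
  set L := (√α₄ * 2 + 1) * (3 * M)
  have hlip : ∀ u ∈ Icc s t, ∀ u' ∈ Icc s t, u ≤ u' →
      |d.Φ (R u' * (Rh u')⁻¹) q - d.Φ (R u * (Rh u)⁻¹) q| ≤ L * (u' - u) := by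
    intro u hu u' hu' huu'
    have hsub : Icc u u' ⊆ Icc s t := Icc_subset_Icc hu.1 hu'.2
    refine abs_comp_sub_le (X := fun u => R u * (Rh u)⁻¹) (hd.potential.continuous q) huu' hM ?_ ?_
    · intro x hx y hy hxy i k
      exact (h.mono (hsub hx).1 hxy (hsub hy).2).abs_error_sub_le hd
        (fun z hz => hB z ⟨(hsub hx).1.trans hz.1, hz.2.trans (hsub hy).2⟩) i k
    · intro x hx
      have hmem := h.mem x ⟨hu.1.trans_lt hx.1, hx.2.trans_le hu'.2⟩
      exact ⟨_, hd.hasGradient hmem, (hd.frobNorm_grad_le hmem).trans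
        (mul_le_mul_of_nonneg_left (attNorm_le_two _) (Real.sqrt_nonneg _))⟩
  refine LipschitzOnWith.absolutelyContinuousOnInterval (K := L.toNNReal) ?_
  rw [uIcc_of_le h.le]
  refine LipschitzOnWith.of_dist_le_mul fun x hx y hy => ?_
  rw [Real.coe_toNNReal _ (by positivity), Real.dist_eq, Real.dist_eq]
  rcases le_total x y with hxy | hxy
  · rw [abs_sub_comm, abs_sub_comm x y, abs_of_nonneg (sub_nonneg.2 hxy)]
    exact hlip x hx y hy hxy
  · rw [abs_of_nonneg (sub_nonneg.2 hxy)]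
    exact hlip y hy x hx hxy

theorem ac_lyapunov (h : FlowOn d ω b q R Rh bh s t) (hd : Admissible d 𝒟 α₁ α₂ α₃ α₄)
    {B : ℝ} (hB : ∀ u ∈ Icc s t, ‖bh u - b‖ ≤ B) (ε : ℝ) :
    AbsolutelyContinuousOnInterval (fun u => lyapunov d ε b q (R u) (Rh u) (bh u)) s t := by
  have h1 : AbsolutelyContinuousOnInterval (fun u => ‖bh u - b‖) s t :=
    lipschitzWith_one_norm.comp_absolutelyContinuousOnInterval h.ac_bias_error
  have h2 : AbsolutelyContinuousOnInterval (fun u => ‖bh u - b‖ ^ 2 / d.γI) s t := by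
    convert (h1.fun_mul h1).const_mul d.γI⁻¹ using 2
    ring
  have hw : ∀ i, AbsolutelyContinuousOnInterval
      (fun u => rot (R u : Mat3) (bh u - b) i) s t := fun i => by
    simp only [rot_apply]
    exact absolutelyContinuousOnInterval_sum _ fun j _ =>
      (h.ac_R i j).fun_mul (ac_coord h.ac_bias_error j)
  exact ((h.ac_potential hd hB).fun_add h2).fun_sub
    ((ac_matInner h.ac_error (ac_skew hw)).const_mul ε)

/-- Exponential decay of the Lyapunov function along flows, for small weights of the cross term. -/
theorem lyapunov_le (h : FlowOn d ω b q R Rh bh s t) (hd : Admissible d 𝒟 α₁ α₂ α₃ α₄)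
    (hb : ‖b‖ ≤ d.bbar) {B c : ℝ} (hB : ∀ u ∈ Icc s t, ‖bh u - b‖ ≤ B)
    (hω : ∀ u ∈ Icc s t, ‖ω u‖ ≤ c) {ε : ℝ} (hε0 : 0 < ε) (hε1 : ε ≤ 1)
    (hε : ε * ((4 * B + 2 * d.γP * √α₄ + 4 * c) ^ 2 / 4 + 4 * d.γI * √α₄) ≤ d.γP * α₃ / 2)
    {lam : ℝ} (hlam0 : 0 ≤ lam)
    (hlam : lam * (α₂ + 1 / d.γI + 2) ≤ min (d.γP * α₃ / 2) ε) :
    lyapunov d ε b q (R t) (Rh t) (bh t)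
      ≤ Real.exp (-lam * (t - s)) * lyapunov d ε b q (R s) (Rh s) (bh s) := by
  refine le_exp_mul_of_ae_hasDerivAt_le h.le (h.ac_lyapunov hd hB ε) ?_
  filter_upwards [h.ae_flowAt] with u hu hut
  have hucc := Ioo_subset_Icc_self hut
  have hfu := hu hut
  obtain ⟨v, hv, hbv⟩ := hfu.deriv_bh
  obtain ⟨V', hV, hVle⟩ := hfu.energy_deriv hd hb hv hbv
  obtain ⟨X', hX, hXle⟩ := hfu.cross_deriv hd hv hbv (hB u hucc) (hω u hucc)
  refine ⟨_, hV.sub (hX.const_mul ε), ?_⟩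
  have hW := hd.lyapunov_le hε0.le hε1 b q (R u) (Rh u) (bh u)
  set ρ := attNorm (R u * (Rh u)⁻¹)
  set y := ‖bh u - b‖
  set K := 4 * B + 2 * d.γP * √α₄ + 4 * c
  set L := 4 * d.γI * √α₄
  have h1 : lam * lyapunov d ε b q (R u) (Rh u) (bh u)
      ≤ min (d.γP * α₃ / 2) ε * (ρ ^ 2 + y ^ 2) := by
    refine (mul_le_mul_of_nonneg_left hW hlam0).trans ?_
    rw [← mul_assoc]
    exact mul_le_mul_of_nonneg_right hlam (by positivity)
  have h2 := mul_le_mul_of_nonneg_right (min_le_left (d.γP * α₃ / 2) ε) (sq_nonneg ρ)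
  have h3 := mul_le_mul_of_nonneg_right (min_le_right (d.γP * α₃ / 2) ε) (sq_nonneg y)
  have h4 := mul_le_mul_of_nonneg_right hε (sq_nonneg ρ)
  have h5 := mul_le_mul_of_nonneg_left hXle hε0.le
  have h6 : 0 ≤ ε * (y - K / 2 * ρ) ^ 2 := by positivity
  nlinarith

end FlowOn

end

section

/-! ### Hybrid time domains and the stability estimate -/

namespace IsHybridTimeDomain

variable {t₀ : ℝ} {E : Set (ℝ × ℕ)}

theorem initial_mem (h : IsHybridTimeDomain t₀ E) : (t₀, 0) ∈ E := by
  obtain ⟨τ, hτ, rfl, rfl | ⟨J, I, hI, rfl⟩⟩ := h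
  · exact ⟨le_rfl, hτ (Nat.le_succ 0)⟩
  · rcases Nat.eq_zero_or_pos J with rfl | hJ
    · refine Or.inr ⟨rfl, ?_⟩
      rcases hI with rfl | ⟨T, hT, rfl⟩ | ⟨T, hT, rfl⟩
      · exact self_mem_Ici
      · exact ⟨le_rfl, hT⟩
      · exact ⟨le_rfl, hT⟩
    · exact Or.inl ⟨hJ, le_rfl, hτ (Nat.le_succ 0)⟩

theorem le_of_mem_zero (h : IsHybridTimeDomain t₀ E) {t : ℝ} (ht : (t, 0) ∈ E) : t₀ ≤ t := by
  obtain ⟨τ, hτ, rfl, rfl | ⟨J, I, hI, rfl⟩⟩ := h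
  · exact ht.1
  · rcases ht with ⟨-, ht⟩ | ⟨hJ, ht⟩
    · exact ht.1
    · simp only at hJ ht
      subst hJ
      rcases hI with rfl | ⟨T, hT, rfl⟩ | ⟨T, hT, rfl⟩
      · exact ht
      · exact ht.1
      · exact ht.1

theorem Icc_subset (h : IsHybridTimeDomain t₀ E) {s t : ℝ} {j : ℕ} (hs : (s, j) ∈ E)
    (ht : (t, j) ∈ E) : Icc s t ⊆ {u | (u, j) ∈ E} := by
  intro u hu
  obtain ⟨τ, hτ, rfl, rfl | ⟨J, I, hI, rfl⟩⟩ := h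
  · exact ⟨hs.1.trans hu.1, hu.2.trans ht.2⟩
  · rcases hs with ⟨hsJ, hs⟩ | ⟨hsJ, hs⟩ <;> rcases ht with ⟨htJ, ht⟩ | ⟨htJ, ht⟩
    · exact Or.inl ⟨hsJ, hs.1.trans hu.1, hu.2.trans ht.2⟩
    · exact absurd htJ (ne_of_lt hsJ)
    · exact absurd hsJ (ne_of_lt htJ)
    · refine Or.inr ⟨hsJ, ?_⟩
      rcases hI with rfl | ⟨T, hT, rfl⟩ | ⟨T, hT, rfl⟩
      · exact hs.trans hu.1
      · exact ⟨hs.1.trans hu.1, hu.2.trans ht.2⟩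
      · exact ⟨hs.1.trans hu.1, hu.2.trans_lt ht.2⟩

theorem exists_jump_time (h : IsHybridTimeDomain t₀ E) {t : ℝ} {j : ℕ} (ht : (t, j + 1) ∈ E) :
    ∃ s ≤ t, (s, j) ∈ E ∧ (s, j + 1) ∈ E := by
  obtain ⟨τ, hτ, rfl, rfl | ⟨J, I, hI, rfl⟩⟩ := h
  · exact ⟨τ (j + 1), ht.1, ⟨hτ (Nat.le_succ j), le_rfl⟩, le_rfl, hτ (Nat.le_succ _)⟩
  · rcases ht with ⟨hJ, ht⟩ | ⟨hJ, ht⟩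
    · exact ⟨τ (j + 1), ht.1, Or.inl ⟨(Nat.lt_succ_self j).trans hJ, hτ (Nat.le_succ j), le_rfl⟩,
        Or.inl ⟨hJ, le_rfl, hτ (Nat.le_succ _)⟩⟩
    · simp only at hJ ht
      subst hJ
      have hj : (τ (j + 1), j) ∈ {x : ℝ × ℕ | (x.2 < j + 1 ∧ x.1 ∈ Icc (τ x.2) (τ (x.2 + 1))) ∨
          (x.2 = j + 1 ∧ x.1 ∈ I)} :=
        Or.inl ⟨Nat.lt_succ_self j, hτ (Nat.le_succ j), le_rfl⟩
      rcases hI with rfl | ⟨T, hT, rfl⟩ | ⟨T, hT, rfl⟩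
      · exact ⟨τ (j + 1), ht, hj, Or.inr ⟨rfl, self_mem_Ici⟩⟩
      · exact ⟨τ (j + 1), ht.1, hj, Or.inr ⟨rfl, le_rfl, hT⟩⟩
      · exact ⟨τ (j + 1), ht.1, hj, Or.inr ⟨rfl, le_rfl, hT⟩⟩

theorem le_of_mem (h : IsHybridTimeDomain t₀ E) {t : ℝ} {j : ℕ} (ht : (t, j) ∈ E) : t₀ ≤ t := by
  induction j generalizing t with
  | zero => exact h.le_of_mem_zero ht
  | succ j ih =>
    obtain ⟨s, hst, hs, -⟩ := h.exists_jump_time ht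
    exact (ih hs).trans hst

end IsHybridTimeDomain

variable {𝒬 : Finset ℕ} {d : Design 𝒬} {𝒟 : Set (SO3 × 𝒬)} {α₁ α₂ α₃ α₄ : ℝ}
  {ω : ℝ → Vec3} {b : Vec3} {t₀ : ℝ} {R : ℝ → SO3} {x : Arc 𝒬}

theorem IsSolution.flowOn (hx : IsSolution d ω b t₀ R x) (hR : IsAttitude ω t₀ R) {s t : ℝ} {j : ℕ}
    (hst : s ≤ t) (hs : (s, j) ∈ x.dom) (ht : (t, j) ∈ x.dom) :
    FlowOn d ω b (x.q s j) R (fun u => x.Rhat u j) (fun u => x.bhat u j) s t := by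
  have hsub : Icc s t ⊆ x.interval j := hx.dom.Icc_subset hs ht
  have hint : Ioo s t ⊆ interior (x.interval j) :=
    interior_maximal (Ioo_subset_Icc_self.trans hsub) isOpen_Ioo
  have hq : ∀ u ∈ Icc s t, x.q u j = x.q s j := fun u hu => hx.flow_q j u (hsub hu) s hs
  have hs0 : t₀ ≤ s := hx.dom.le_of_mem hs
  have hmem : ∀ u ∈ Ioo s t, (R u * (x.Rhat u j)⁻¹, x.q s j) ∈ flowSet d.Φ d.δ := fun u hu => by
    rw [← hq u (Ioo_subset_Icc_self hu)]
    exact hx.flow_mem j u (hint hu)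
  refine ⟨hst, fun i k => hR.1 i k s t hst fun u hu => hs0.trans hu.1,
    fun i k => hx.ac_Rhat j i k s t hst hsub, hx.ac_bhat j s t hst hsub, hmem, ?_⟩
  filter_upwards [hR.2, hx.flow_Rhat j, hx.flow_bhat j] with u h1 h2 h3 hu
  have hu' := Ioo_subset_Icc_self hu
  have h2 := h2 (hsub hu')
  have h3 := h3 (hsub hu')
  rw [hq u hu'] at h2 h3
  exact ⟨hmem u hu, h1 (hs0.trans hu'.1), h2, h3⟩

/-- The value of the Lyapunov function along a solution. -/
noncomputable def Arc.lyap (x : Arc 𝒬) (d : Design 𝒬) (ε : ℝ) (b : Vec3) (R : ℝ → SO3) (t : ℝ)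
    (j : ℕ) : ℝ :=
  lyapunov d ε b (x.q t j) (R t) (x.Rhat t j) (x.bhat t j)

theorem IsSolution.lyap_jump (hx : IsSolution d ω b t₀ R x) (ε : ℝ) {t : ℝ} {j : ℕ}
    (h₁ : (t, j) ∈ x.dom) (h₂ : (t, j + 1) ∈ x.dom) :
    x.lyap d ε b R t (j + 1) + d.δ ≤ x.lyap d ε b R t j := by
  have hmem := hx.jump_mem t j h₁ h₂
  have hne : Nonempty 𝒬 := ⟨x.q t j⟩
  have hle : d.Φ (x.Rtilde R t j) (x.q t (j + 1)) ≤ ⨅ p, d.Φ (x.Rtilde R t j) p :=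
    le_ciInf (hx.jump_q t j h₁ h₂)
  simp only [jumpSet, mem_ofPred_eq] at hmem
  rw [Arc.lyap, Arc.lyap, hx.jump_Rhat t j h₁ h₂, hx.jump_bhat t j h₁ h₂, lyapunov, lyapunov]
  have e : R t * (x.Rhat t j)⁻¹ = x.Rtilde R t j := rfl
  rw [e]
  linarith

/-- Along a solution the bias estimate stays in the ball of radius `r`, the Lyapunov function
decays exponentially in ordinary time, and each jump costs at least `δ`. -/
theorem IsSolution.lyap_estimates (hx : IsSolution d ω b t₀ R x) (hR : IsAttitude ω t₀ R)
    (hd : Admissible d 𝒟 α₁ α₂ α₃ α₄) (hδ : 0 < d.δ) (hb : ‖b‖ ≤ d.bbar) {r c : ℝ}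
    (hr : d.bbar ≤ r) (hω : ∀ t, t₀ ≤ t → ‖ω t‖ ≤ c) (hx0 : ‖x.bhat t₀ 0‖ ≤ r)
    {ε : ℝ} (hε0 : 0 < ε) (hε1 : ε ≤ 1) (hε2 : 16 * ε ≤ α₁ / d.γI)
    (hε : ε * ((4 * (r + d.bbar) + 2 * d.γP * √α₄ + 4 * c) ^ 2 / 4 + 4 * d.γI * √α₄)
      ≤ d.γP * α₃ / 2)
    {lam : ℝ} (hlam0 : 0 ≤ lam)
    (hlam : lam * (α₂ + 1 / d.γI + 2) ≤ min (d.γP * α₃ / 2) ε) {t : ℝ} {j : ℕ}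
    (ht : (t, j) ∈ x.dom) :
    ‖x.bhat t j‖ ≤ r ∧ x.lyap d ε b R t j + j * d.δ ≤ x.lyap d ε b R t₀ 0 ∧
      x.lyap d ε b R t j ≤ Real.exp (-lam * (t - t₀)) * x.lyap d ε b R t₀ 0 := by
  have hpos : ∀ t j, 0 ≤ x.lyap d ε b R t j := fun t j => by
    refine le_trans ?_ (hd.le_lyapunov hε0.le hε1 hε2 _ _ _ _ _)
    have h1 := hd.α₁_pos
    have h2 := hd.γI_pos
    positivity
  have hflow : ∀ s t j, s ≤ t → (s, j) ∈ x.dom → (t, j) ∈ x.dom → ‖x.bhat s j‖ ≤ r →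
      ‖x.bhat t j‖ ≤ r ∧
        x.lyap d ε b R t j ≤ Real.exp (-lam * (t - s)) * x.lyap d ε b R s j := by
    intro s t j hst hs ht hbs
    have hfl := hx.flowOn hR hst hs ht
    have hbr : ∀ u ∈ Icc s t, ‖x.bhat u j‖ ≤ r := fun u hu =>
      (hfl.mono le_rfl hu.1 hu.2).norm_bhat_le hd.bbar_nonneg hr hbs
    refine ⟨hbr t ⟨hst, le_rfl⟩, ?_⟩
    have := hfl.lyapunov_le hd hb (B := r + d.bbar) (c := c)
      (fun u hu => (norm_sub_le _ _).trans (add_le_add (hbr u hu) hb))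
      (fun u hu => hω u ((hx.dom.le_of_mem hs).trans hu.1)) hε0 hε1 hε hlam0 hlam
    rw [Arc.lyap, hx.flow_q j t ht s hs]
    exact this
  have hexp : ∀ s t, s ≤ t → Real.exp (-lam * (t - s)) ≤ 1 := fun s t hst =>
    Real.exp_le_one_iff.2 (by nlinarith)
  induction j generalizing t with
  | zero =>
    have h0 := hx.dom.le_of_mem ht
    obtain ⟨h1, h2⟩ := hflow t₀ t 0 h0 hx.dom.initial_mem ht hx0
    refine ⟨h1, ?_, h2⟩
    have := mul_le_mul_of_nonneg_right (hexp t₀ t h0) (hpos t₀ 0)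
    simp only [Nat.cast_zero, zero_mul, add_zero]
    linarith
  | succ j ih =>
    obtain ⟨s, hst, hs, hs'⟩ := hx.dom.exists_jump_time ht
    obtain ⟨i1, i2, i3⟩ := ih hs
    have hj := hx.lyap_jump ε hs hs'
    have hbs : ‖x.bhat s (j + 1)‖ ≤ r := by rw [hx.jump_bhat s j hs hs']; exact i1
    obtain ⟨h1, h2⟩ := hflow s t (j + 1) hst hs' ht hbs
    refine ⟨h1, ?_, ?_⟩
    · have := mul_le_mul_of_nonneg_right (hexp s t hst) (hpos s (j + 1))
      push_cast
      linarith
    · refine h2.trans ?_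
      have h3 : x.lyap d ε b R s (j + 1) ≤ Real.exp (-lam * (s - t₀)) * x.lyap d ε b R t₀ 0 := by
        linarith
      refine (mul_le_mul_of_nonneg_left h3 (Real.exp_pos _).le).trans (le_of_eq ?_)
      rw [← mul_assoc, ← Real.exp_add]
      congr 2
      ring

end

section

/-! ### Local existence of flows -/

/-- The matrix with given vector of entries, the inverse of `matVec`. -/
def vecMat (m : EuclideanSpace ℝ (Fin 3 × Fin 3)) : Mat3 := fun i k => m (i, k)

theorem vecMat_matVec (A : Mat3) : vecMat (matVec A) = A := rfl
theorem matVec_vecMat (m : EuclideanSpace ℝ (Fin 3 × Fin 3)) : matVec (vecMat m) = m := rfl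

theorem continuous_vecMat : Continuous vecMat := by
  refine continuous_pi fun i => continuous_pi fun k => ?_
  exact PiLp.continuous_apply 2 _ (i, k)

theorem continuous_skew : Continuous skew := by
  refine continuous_pi fun i => continuous_pi fun k => ?_
  fin_cases i <;> fin_cases k <;> simp [skew] <;> fun_prop

theorem continuous_vee : Continuous vee := by
  refine (PiLp.continuous_toLp 2 _).comp (continuous_pi fun i => ?_)
  fin_cases i <;> simp <;> fun_prop

theorem Continuous.rot {X : Type*} [TopologicalSpace X] {A : X → Mat3} {v : X → Vec3}
    (hA : Continuous A) (hv : Continuous v) : Continuous fun p => rot (A p) (v p) := by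
  refine (PiLp.continuous_toLp 2 _).comp ?_
  exact hA.matrix_mulVec ((PiLp.continuous_ofLp 2 _).comp hv)

theorem isClosed_SO3 : IsClosed {A : Mat3 | A ∈ Matrix.specialOrthogonalGroup (Fin 3) ℝ} := by
  simp only [mem_SO3_iff]
  have h1 : Continuous fun A : Mat3 => A.transpose * A := by fun_prop
  have h2 : Continuous fun A : Mat3 => A.det := continuous_id.matrix_det
  exact (isClosed_eq h1 continuous_const).inter (isClosed_eq h2 continuous_const)

/-- A matrix curve with `M' = M [u]_×` stays orthogonal. -/
theorem transpose_mul_self_eq_one {M : ℝ → Mat3} {u : ℝ → Vec3} {a b : ℝ} (hab : a ≤ b)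
    (hac : ∀ i k, AbsolutelyContinuousOnInterval (fun t => M t i k) a b)
    (hM : ∀ᵐ t, t ∈ Ioo a b → HasEntryDerivAt M (M t * skew (u t)) t)
    (h0 : (M a).transpose * M a = 1) : (M b).transpose * M b = 1 := by
  have hPac : ∀ i k, AbsolutelyContinuousOnInterval
      (fun t => ((M t).transpose * M t - 1) i k) a b := by
    intro i k
    simp only [Matrix.sub_apply, Matrix.mul_apply, Matrix.transpose_apply]
    exact (absolutelyContinuousOnInterval_sum _ fun j _ => (hac j i).fun_mul (hac j k)).fun_sub
      (LipschitzWith.const _).lipschitzOnWith.absolutelyContinuousOnInterval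
  have key := le_of_ae_hasDerivAt_nonpos hab (FlowOn.ac_matInner hPac hPac) (by
    filter_upwards [hM] with t ht htab
    have ht := ht htab
    set P := (M t).transpose * M t - 1 with hP
    have hPd : HasEntryDerivAt (fun s => (M s).transpose * M s - 1)
        (P * skew (u t) - skew (u t) * P) t := by
      intro i k
      have h2 : P * skew (u t) - skew (u t) * P
          = (M t * skew (u t)).transpose * M t + (M t).transpose * (M t * skew (u t)) := by
        rw [Matrix.transpose_mul, skew_transpose, hP]
        noncomm_ring
      rw [h2]
      exact (ht.transpose.mul ht i k).sub_const ((1 : Mat3) i k)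
    refine ⟨_, hPd.matInner hPd, le_of_eq ?_⟩
    have hPt : P.transpose = P := by
      rw [hP, Matrix.transpose_sub, Matrix.transpose_mul, Matrix.transpose_transpose,
        Matrix.transpose_one]
    have h2 : matInner P (P * skew (u t) - skew (u t) * P) = 0 := by
      rw [matInner, hPt, mul_sub, Matrix.trace_sub, ← mul_assoc, ← mul_assoc,
        Matrix.trace_mul_comm (P * skew (u t)) P, mul_assoc, sub_self]
    rw [← hP, matInner_comm _ P, h2, add_zero])
  rw [h0, sub_self, matInner_self, matInner_self] at key
  have h1 : frobNorm ((M b).transpose * M b - 1) = 0 := by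
    have h2 : frobNorm (0 : Mat3) = 0 := by simp [frobNorm, matInner]
    rw [h2] at key
    nlinarith [frobNorm_nonneg ((M b).transpose * M b - 1)]
  rw [frobNorm_eq_norm, norm_eq_zero] at h1
  have h2 : (M b).transpose * M b - 1 = 0 := by
    rw [← vecMat_matVec ((M b).transpose * M b - 1), h1]; rfl
  exact sub_eq_zero.1 h2

variable {𝒬 : Finset ℕ} {d : Design 𝒬} {𝒟 : Set (SO3 × 𝒬)} {α₁ α₂ α₃ α₄ : ℝ}

theorem mem_flowSet_iff {X : SO3} {q : 𝒬} :
    (X, q) ∈ flowSet d.Φ d.δ ↔ ∀ p, d.Φ X q - d.Φ X p ≤ d.δ := by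
  have hne : Nonempty 𝒬 := ⟨q⟩
  have hbdd : BddBelow (range fun p => d.Φ X p) := (finite_range _).bddBelow
  simp only [flowSet, mem_ofPred_eq]
  constructor
  · intro h p
    have := ciInf_le hbdd p
    linarith
  · intro h
    have : d.Φ X q - d.δ ≤ ⨅ p, d.Φ X p := le_ciInf fun p => by linarith [h p]
    linarith

theorem Admissible.eventually_mem_flowSet (hd : Admissible d 𝒟 α₁ α₂ α₃ α₄) {X : SO3} {q : 𝒬}
    (h : (X, q) ∉ jumpSet d.Φ d.δ) : ∀ᶠ Y in 𝓝 X, (Y, q) ∈ flowSet d.Φ d.δ := by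
  have hne : Nonempty 𝒬 := ⟨q⟩
  have hbdd : BddBelow (range fun p => d.Φ X p) := (finite_range _).bddBelow
  simp only [jumpSet, mem_ofPred_eq, not_le] at h
  have h1 : ∀ p, ∀ᶠ Y in 𝓝 X, d.Φ Y q - d.Φ Y p < d.δ := fun p =>
    (((hd.potential.continuous q).sub (hd.potential.continuous p)).tendsto X).eventually_lt_const
      (by
        have := ciInf_le hbdd p
        simp only [Pi.sub_apply]
        linarith)
  filter_upwards [eventually_all.2 h1] with Y hY
  exact mem_flowSet_iff.2 fun p => (hY p).le

/-- The rotation vector `[Xᵀ ∇Φ(X, q)]_⊗` of the gradient extends continuously from a neighbourhood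
in `SO(3)` to all matrices. -/
theorem Admissible.exists_gradient_extension (hd : Admissible d 𝒟 α₁ α₂ α₃ α₄) {X₀ : SO3} {q : 𝒬}
    (h : (X₀, q) ∉ jumpSet d.Φ d.δ) :
    ∃ (g : EuclideanSpace ℝ (Fin 3 × Fin 3) → Vec3) (ρ : ℝ), Continuous g ∧ 0 < ρ ∧
      ∀ X : SO3, dist (matVec X) (matVec X₀) ≤ ρ → (X, q) ∈ flowSet d.Φ d.δ ∧
        g (matVec X) = vee ((X : Mat3).transpose * gradSO3 (fun Y => d.Φ Y q) X) := by
  have hind : Topology.IsInducing fun X : SO3 => matVec X := by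
    have h1 : Topology.IsInducing matVec := by
      refine Topology.IsInducing.of_comp continuous_matVec continuous_vecMat ?_
      exact Topology.IsInducing.id
    exact h1.comp Topology.IsInducing.subtypeVal
  have hnear := hd.eventually_mem_flowSet h
  rw [hind.nhds_eq_comap, eventually_comap] at hnear
  obtain ⟨ρ, hρ, hball⟩ := Metric.nhds_basis_closedBall.eventually_iff.1 hnear
  have hV : ∀ X : SO3, dist (matVec X) (matVec X₀) ≤ ρ → (X, q) ∈ flowSet d.Φ d.δ :=
    fun X hX => hball (Metric.mem_closedBall.2 hX) X rfl
  set C : Set (EuclideanSpace ℝ (Fin 3 × Fin 3)) :=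
    {m | vecMat m ∈ Matrix.specialOrthogonalGroup (Fin 3) ℝ} ∩ Metric.closedBall (matVec X₀) ρ
  have hC : IsClosed C := (isClosed_SO3.preimage continuous_vecMat).inter Metric.isClosed_closedBall
  have hσ : ContinuousOn (fun X : SO3 => vee ((X : Mat3).transpose *
      gradSO3 (fun Y => d.Φ Y q) X)) {X | (X, q) ∈ flowSet d.Φ d.δ} := by
    refine continuous_vee.comp_continuousOn ?_
    exact (Continuous.matrix_transpose continuous_subtype_val).continuousOn.mul
      ((hd.potential.continuousOn_grad q).mono fun X hX => hd.flowSet_subset hX)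
  have hcont : Continuous fun m : C => vee ((vecMat m).transpose *
      gradSO3 (fun Y => d.Φ Y q) ⟨vecMat m, m.2.1⟩) := by
    refine hσ.comp_continuous (f := fun m : C => (⟨vecMat m, m.2.1⟩ : SO3))
      ((continuous_vecMat.comp continuous_subtype_val).subtype_mk _) fun m => ?_
    exact hV _ m.2.2
  obtain ⟨g, hg⟩ := ContinuousMap.exists_restrict_eq (Y := Vec3) hC ⟨_, hcont⟩
  refine ⟨g, ρ, g.continuous, hρ, fun X hX => ⟨hV X hX, ?_⟩⟩
  have := DFunLike.congr_fun hg ⟨matVec X, X.2, Metric.mem_closedBall.2 hX⟩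
  exact this

end

section

/-- Krasovskii regularization does not change a component of the field that is continuous. -/
theorem fst_eq_of_forall_mem_closure_convexHull {P E₁ E₂ : Type*} [PseudoMetricSpace P]
    [NormedAddCommGroup E₁] [NormedSpace ℝ E₁] [NormedAddCommGroup E₂] [NormedSpace ℝ E₂]
    {f : P → E₁ × E₂} {F : P → E₁} {p : P} {v : E₁ × E₂} (hfF : ∀ x, (f x).1 = F x)
    (hF : ContinuousAt F p)
    (hv : ∀ ε > 0, v ∈ closure (convexHull ℝ (f '' Metric.ball p ε))) : v.1 = F p := by
  refine eq_of_forall_dist_le fun η hη => ?_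
  obtain ⟨ε, hε, hball⟩ := Metric.continuousAt_iff.1 hF η hη
  have hsub : closure (convexHull ℝ (f '' Metric.ball p ε))
      ⊆ Prod.fst ⁻¹' Metric.closedBall (F p) η := by
    refine closure_minimal (convexHull_min ?_ ?_)
      (Metric.isClosed_closedBall.preimage continuous_fst)
    · rintro _ ⟨x, hx, rfl⟩
      rw [mem_preimage, hfF]
      exact (hball hx).le
    · exact (convex_closedBall (F p) η).linear_preimage (LinearMap.fst ℝ E₁ E₂)
  exact hsub (hv ε hε)

variable {𝒬 : Finset ℕ} {d : Design 𝒬} {𝒟 : Set (SO3 × 𝒬)} {α₁ α₂ α₃ α₄ : ℝ}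
  {ω : ℝ → Vec3} {b : Vec3} {t₀ : ℝ} {R : ℝ → SO3}

/-- From a state outside the jump set it is possible to flow for a short time. In terms of the error
`R̃` the attitude equation does not involve `ω`, so that the only discontinuity of the equations is
that of the projection. -/
theorem Admissible.exists_flowOn (hd : Admissible d 𝒟 α₁ α₂ α₃ α₄) (hR : IsAttitude ω t₀ R)
    (b : Vec3) {T : ℝ} (hT : t₀ ≤ T) (Rh₀ : SO3) (b₀ : Vec3) {q : 𝒬}
    (hjump : (R T * Rh₀⁻¹, q) ∉ jumpSet d.Φ d.δ) :
    ∃ h > 0, ∃ (Rh : ℝ → SO3) (bh : ℝ → Vec3), Rh T = Rh₀ ∧ bh T = b₀ ∧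
      FlowOn d ω b q R Rh bh T (T + h) ∧
      ∀ u ∈ Icc T (T + h), (R u * (Rh u)⁻¹, q) ∈ flowSet d.Φ d.δ := by
  obtain ⟨g, ρ, hg, hρ, hgX⟩ := hd.exists_gradient_extension hjump
  set X₀ := R T * Rh₀⁻¹ with hX₀
  -- the true attitude, extended to a continuous curve on the real line
  set Rc : ℝ → SO3 := fun t => R (max T t) with hRc
  have hRcont : Continuous Rc := by
    have h1 : ContinuousOn R (Ici T) := by
      rw [continuousOn_SO3_iff]
      intro i k t ht
      have h2 := (hR.1 i k T (t + 1) (by linarith [mem_Ici.1 ht])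
        fun u hu => hT.trans hu.1).continuousOn
      rw [uIcc_of_le (by linarith [mem_Ici.1 ht])] at h2
      have h3 := h2 t ⟨ht, by linarith⟩
      refine h3.mono_of_mem_nhdsWithin ?_
      rw [← Ici_inter_Iic]
      exact inter_mem_nhdsWithin _ (Iic_mem_nhds (by linarith))
    exact h1.comp_continuous (by fun_prop) fun t => le_max_left T t
  have hRmat : Continuous fun t => (Rc t : Mat3) := continuous_subtype_val.comp hRcont
  let V := EuclideanSpace ℝ (Fin 3 × Fin 3)
  -- the coefficients of the error equations
  let w : ℝ × V × Vec3 → Vec3 := fun p =>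
    rot (vecMat p.2.1).transpose (rot (Rc p.1 : Mat3) (p.2.2 - b)) - d.γP • g p.2.1
  let F : ℝ × V × Vec3 → V := fun p => matVec (vecMat p.2.1 * skew (w p))
  let μ : ℝ × V × Vec3 → Vec3 := fun p =>
    -(d.γI • rot ((Rc p.1 : Mat3).transpose * vecMat p.2.1) (g p.2.1))
  let f : ℝ × V × Vec3 → V × Vec3 := fun p => (F p, proj d.bbar (μ p) p.2.2)
  have hM : Continuous fun p : ℝ × V × Vec3 => vecMat p.2.1 :=
    continuous_vecMat.comp (continuous_fst.comp continuous_snd)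
  have hgc : Continuous fun p : ℝ × V × Vec3 => g p.2.1 :=
    hg.comp (continuous_fst.comp continuous_snd)
  have hRp : Continuous fun p : ℝ × V × Vec3 => (Rc p.1 : Mat3) := hRmat.comp continuous_fst
  have hw : Continuous w :=
    (Continuous.rot hM.matrix_transpose (Continuous.rot hRp
      ((continuous_snd.comp continuous_snd).sub continuous_const))).sub (hgc.const_smul d.γP)
  have hF : Continuous F := continuous_matVec.comp (hM.matrix_mul (continuous_skew.comp hw))
  have hμ : Continuous μ :=
    ((Continuous.rot (hRp.matrix_transpose.matrix_mul hM) hgc).const_smul d.γI).neg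
  set z₀ : V × Vec3 := (matVec X₀, b₀) with hz₀
  -- a ball on which the extension of the gradient is correct and the determinant is positive
  obtain ⟨ρ', hρ', hdet⟩ : ∃ ρ' > 0, ∀ m : V, dist m (matVec X₀) < ρ' → 0 < (vecMat m).det := by
    have h1 : Continuous fun m : V => (vecMat m).det := continuous_vecMat.matrix_det
    have h2 : ∀ᶠ m in 𝓝 (matVec X₀), 0 < (vecMat m).det := by
      refine h1.continuousAt.eventually_const_lt ?_
      change 0 < (X₀ : Mat3).det
      rw [SO3.det_eq_one]
      exact one_pos
    obtain ⟨ρ', hρ', h3⟩ := Metric.eventually_nhds_iff.1 h2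
    exact ⟨ρ', hρ', fun m hm => h3 hm⟩
  set r := min ρ ρ' with hr
  have hrpos : 0 < r := lt_min hρ hρ'
  obtain ⟨C₁, hC₁⟩ := (isCompact_closedBall (T, z₀) r).exists_bound_of_continuousOn hF.continuousOn
  obtain ⟨C₂, hC₂⟩ := (isCompact_closedBall (T, z₀) r).exists_bound_of_continuousOn hμ.continuousOn
  have hfb : ∀ p ∈ Metric.ball (T, z₀) r, ‖f p‖ ≤ max C₁ C₂ := by
    intro p hp
    have hp' := Metric.ball_subset_closedBall hp
    rw [Prod.norm_def]
    exact max_le_max (hC₁ p hp') ((norm_proj_le _ _ _).trans (hC₂ p hp'))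
  obtain ⟨y, K, h, hh, hylip, hy0, hy⟩ := exists_local_krasovskii_solution hrpos hfb
  have hTh : T ≤ T + h := by linarith
  have hdist : ∀ t ∈ Icc T (T + h), dist (y t).1 (matVec X₀) < r := fun t ht => by
    have h1 := (hy t ht).1
    rw [Metric.mem_ball, Prod.dist_eq, max_lt_iff, Prod.dist_eq, max_lt_iff] at h1
    exact h1.2.1
  have hMac : ∀ a c i k, AbsolutelyContinuousOnInterval
      (fun t => vecMat (y t).1 i k) a c := by
    intro a c i k
    have h1 : LipschitzWith K (Prod.fst ∘ y) := by
      simpa using LipschitzWith.prod_fst.comp hylip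
    exact (EuclideanSpace.proj (𝕜 := ℝ) (i, k)).lipschitz.comp_absolutelyContinuousOnInterval
      h1.lipschitzOnWith.absolutelyContinuousOnInterval
  have hbac : ∀ a c, AbsolutelyContinuousOnInterval (fun t => (y t).2) a c := fun _ _ =>
    LipschitzWith.prod_snd.comp_absolutelyContinuousOnInterval
      hylip.lipschitzOnWith.absolutelyContinuousOnInterval
  -- almost everywhere the error equations hold
  have hae : ∀ᵐ t : ℝ, t ∈ Icc T (T + h) →
      HasEntryDerivAt (fun s => vecMat (y s).1) (vecMat (y t).1 * skew (w (t, y t))) t ∧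
      ∃ v ∈ krasovskii (proj d.bbar (μ (t, y t))) (y t).2, HasDerivAt (fun s => (y s).2) v t := by
    filter_upwards [hylip.ae_differentiableAt (μ := volume)] with t ht htI
    obtain ⟨v, hv⟩ : ∃ v, HasDerivAt y v t := ⟨_, ht.hasDerivAt⟩
    have hK := (hy t htI).2 v hv
    have hv1 : v.1 = F (t, y t) :=
      fst_eq_of_forall_mem_closure_convexHull (fun _ => rfl) hF.continuousAt hK
    refine ⟨?_, v.2, ?_, ?_⟩
    · rw [hasEntryDerivAt_iff]
      have h1 : HasDerivAt (fun s => (y s).1) v.1 t :=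
        (ContinuousLinearMap.fst ℝ V Vec3).hasFDerivAt.comp_hasDerivAt t hv
      rw [hv1] at h1
      exact h1
    · refine mem_krasovskii_proj_of_forall fun ε hε => ?_
      obtain ⟨η, hη, hball⟩ := Metric.continuousAt_iff.1 (hμ.continuousAt (x := (t, y t))) ε hε
      set S := closure (convexHull ℝ {u | ∃ ν ∈ Metric.ball (μ (t, y t)) ε,
        ∃ x ∈ Metric.ball (y t).2 ε, u = proj d.bbar ν x}) with hS
      have hsub : closure (convexHull ℝ (f '' Metric.ball (t, y t) (min η ε)))
          ⊆ Prod.snd ⁻¹' S := by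
        refine closure_minimal (convexHull_min ?_ ?_) (isClosed_closure.preimage continuous_snd)
        · rintro _ ⟨p, hp, rfl⟩
          refine subset_closure (subset_convexHull ℝ _ ⟨μ p, ?_, p.2.2, ?_, rfl⟩)
          · exact hball (lt_of_lt_of_le hp (min_le_left _ _))
          · have h1 := lt_of_lt_of_le (Metric.mem_ball.1 hp) (min_le_right _ _)
            rw [Prod.dist_eq, max_lt_iff, Prod.dist_eq, max_lt_iff] at h1
            exact h1.2.2
        · exact (convex_convexHull ℝ _).closure.linear_preimage (LinearMap.snd ℝ V Vec3)
      exact hsub (hK _ (lt_min hη hε))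
    · exact (ContinuousLinearMap.snd ℝ V Vec3).hasFDerivAt.comp_hasDerivAt t hv
  -- the solution stays in `SO(3)`
  have hSO : ∀ t ∈ Icc T (T + h), vecMat (y t).1 ∈ Matrix.specialOrthogonalGroup (Fin 3) ℝ := by
    intro t ht
    have horth : (vecMat (y t).1).transpose * vecMat (y t).1 = 1 := by
      refine transpose_mul_self_eq_one (M := fun s => vecMat (y s).1)
        (u := fun s => w (s, y s)) ht.1 (hMac _ _) ?_ ?_
      · filter_upwards [hae] with s hs hst
        exact (hs ⟨hst.1.le, hst.2.le.trans ht.2⟩).1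
      · rw [hy0, hz₀, vecMat_matVec, SO3.transpose_mul_self]
    refine mem_SO3_iff.2 ⟨horth, ?_⟩
    have h1 := congrArg Matrix.det horth
    rw [Matrix.det_mul, Matrix.det_transpose, Matrix.det_one] at h1
    have h2 := hdet _ ((hdist t ht).trans_le (min_le_right _ _))
    nlinarith
  classical
  set X : ℝ → SO3 := fun t => if ht : vecMat (y t).1 ∈ Matrix.specialOrthogonalGroup (Fin 3) ℝ
    then ⟨vecMat (y t).1, ht⟩ else X₀ with hX
  have hXc : ∀ t ∈ Icc T (T + h), (X t : Mat3) = vecMat (y t).1 := fun t ht => by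
    simp only [hX, dif_pos (hSO t ht)]
  set Rh : ℝ → SO3 := fun t => (X t)⁻¹ * R t with hRh
  have herr : ∀ t, R t * (Rh t)⁻¹ = X t := fun t => by simp [hRh]
  have hmem : ∀ t ∈ Icc T (T + h), (R t * (Rh t)⁻¹, q) ∈ flowSet d.Φ d.δ ∧
      g (y t).1 = vee ((X t : Mat3).transpose * gradSO3 (fun Y => d.Φ Y q) (X t)) := by
    intro t ht
    have h1 : matVec (X t) = (y t).1 := by rw [hXc t ht, matVec_vecMat]
    have h2 := hgX (X t) (by
      rw [h1]; exact ((hdist t ht).trans_le (min_le_left _ _)).le)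
    rw [h1] at h2
    rwa [herr]
  refine ⟨h, hh, Rh, fun t => (y t).2, ?_, ?_, ?_, fun t ht => (hmem t ht).1⟩
  · have h1 : X T = X₀ := Subtype.ext (by rw [hXc T ⟨le_rfl, hTh⟩, hy0, hz₀, vecMat_matVec])
    simp [hRh, h1, hX₀]
  · simp only [hy0, hz₀]
  have hRac : ∀ i k, AbsolutelyContinuousOnInterval (fun t => (R t : Mat3) i k) T (T + h) :=
    fun i k => hR.1 i k T (T + h) hTh fun u hu => hT.trans hu.1
  refine ⟨hTh, hRac, fun i k => ?_, hbac _ _, fun t ht => (hmem t (Ioo_subset_Icc_self ht)).1, ?_⟩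
  · refine AbsolutelyContinuousOnInterval.congr (f := fun t => ∑ j, vecMat (y t).1 j i *
      (R t : Mat3) j k) (absolutelyContinuousOnInterval_sum _ fun j _ =>
        (hMac _ _ j i).fun_mul (hRac j k)) ?_
    intro t ht
    rw [uIcc_of_le hTh] at ht
    simp only [hRh, SO3.coe_mul, SO3.coe_inv, Matrix.mul_apply, Matrix.transpose_apply, hXc t ht]
  · filter_upwards [hae, hR.2] with t hat hRt htI
    have htI' := Ioo_subset_Icc_self htI
    obtain ⟨hM', v, hv, hbv⟩ := hat htI'
    have hRt := hRt (hT.trans htI'.1)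
    obtain ⟨hflow, hgrad⟩ := hmem t htI'
    have hRct : Rc t = R t := by simp only [hRc, max_eq_right htI'.1]
    have hRhT : ((Rh t : SO3) : Mat3) = (X t : Mat3).transpose * (R t : Mat3) := rfl
    have hβ : d.beta (R t * (Rh t)⁻¹) (Rh t) q
        = rot ((Rc t : Mat3).transpose * vecMat (y t).1) (g (y t).1) := by
      rw [Design.beta, herr, ← hgrad, hRct, ← hXc t htI', hRhT, Matrix.transpose_mul,
        Matrix.transpose_transpose]
      rfl
    refine ⟨hflow, hRt, ?_, v, ?_, hbv⟩
    · have h1 : HasEntryDerivAt (fun s => (vecMat (y s).1).transpose * (R s : Mat3))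
          ((vecMat (y t).1 * skew (w (t, y t))).transpose * (R t : Mat3)
            + (vecMat (y t).1).transpose * ((R t : Mat3) * skew (ω t))) t :=
        hM'.transpose.mul (B := fun s => (R s : Mat3)) hRt
      have h2 : (vecMat (y t).1 * skew (w (t, y t))).transpose * (R t : Mat3)
            + (vecMat (y t).1).transpose * ((R t : Mat3) * skew (ω t))
          = (Rh t : Mat3) * skew ((ω t + b) - (y t).2
            + d.γP • d.beta (R t * (Rh t)⁻¹) (Rh t) q) := by
        have h3 : w (t, y t) = -rot (Rh t : Mat3) (b - (y t).2
            + d.γP • d.beta (R t * (Rh t)⁻¹) (Rh t) q) := by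
          have h4 : rot (Rh t : Mat3) (d.beta (R t * (Rh t)⁻¹) (Rh t) q) = g (y t).1 := by
            have h5 : (Rc t : Mat3).transpose * vecMat (y t).1 = (Rh t : Mat3).transpose := by
              rw [hRct, ← hXc t htI', hRhT, Matrix.transpose_mul, Matrix.transpose_transpose]
            rw [hβ, h5, ← rot_mul, SO3.self_mul_transpose, rot_one]
          rw [rot_add, rot_smul, h4]
          simp only [w, hRct]
          rw [← hXc t htI', ← rot_mul, ← hRhT, rot_sub, rot_sub]
          abel
        have h6 : (ω t + b) - (y t).2 + d.γP • d.beta (R t * (Rh t)⁻¹) (Rh t) q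
            = ω t + (b - (y t).2 + d.γP • d.beta (R t * (Rh t)⁻¹) (Rh t) q) := by abel
        have h7 : ∀ u : Vec3, skew (-u) = -skew u := fun u => by
          rw [← neg_one_smul ℝ u, skew_smul, neg_one_smul]
        rw [h6, skew_add, mul_add, ← skew_rot_mul (Rh t) (b - (y t).2 + _), h3,
          Matrix.transpose_mul, skew_transpose, h7, neg_neg, ← hXc t htI', mul_assoc, ← hRhT,
          ← mul_assoc _ (R t : Mat3), ← hRhT, add_comm]
      rw [h2] at h1
      intro i k
      refine (h1 i k).congr_of_eventuallyEq ?_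
      filter_upwards [Ioo_mem_nhds htI.1 htI.2] with s hs
      rw [← hXc s (Ioo_subset_Icc_self hs)]
      rfl
    · rw [hβ]
      exact hv

end

section

/-! ### Extension of solutions and completeness -/

variable {𝒬 : Finset ℕ} {d : Design 𝒬} {𝒟 : Set (SO3 × 𝒬)} {α₁ α₂ α₃ α₄ : ℝ}

theorem FlowAt.congr {ω b : Vec3} {q : 𝒬} {R Rh Rh' : ℝ → SO3} {bh bh' : ℝ → Vec3} {t : ℝ}
    (h : FlowAt d ω b q R Rh bh t) (hR : Rh' =ᶠ[𝓝 t] Rh) (hb : bh' =ᶠ[𝓝 t] bh) :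
    FlowAt d ω b q R Rh' bh' t := by
  have e1 := hR.eq_of_nhds
  have e2 := hb.eq_of_nhds
  obtain ⟨h1, h2, h3, v, h4, h5⟩ := h
  refine ⟨by rwa [e1], h2, ?_, v, by rwa [e1, e2], h5.congr_of_eventuallyEq hb⟩
  rw [e1, e2]
  intro i k
  refine (h3 i k).congr_of_eventuallyEq ?_
  filter_upwards [hR] with s hs
  rw [hs]

variable {ω : ℝ → Vec3} {b : Vec3} {R : ℝ → SO3} {t₀ : ℝ}

theorem FlowOn.join {q : 𝒬} {Rh₁ Rh₂ : ℝ → SO3} {bh₁ bh₂ : ℝ → Vec3} {s t u : ℝ}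
    (h₁ : FlowOn d ω b q R Rh₁ bh₁ s t) (h₂ : FlowOn d ω b q R Rh₂ bh₂ t u)
    (hRh : Rh₂ t = Rh₁ t) (hbh : bh₂ t = bh₁ t)
    (hmem : (R t * (Rh₁ t)⁻¹, q) ∈ flowSet d.Φ d.δ) :
    FlowOn d ω b q R (fun x => if x ≤ t then Rh₁ x else Rh₂ x)
      (fun x => if x ≤ t then bh₁ x else bh₂ x) s u := by
  have hst := h₁.le
  have htu := h₂.le
  have e1 : ∀ x ∈ uIcc s t, x ≤ t := fun x hx => by rw [uIcc_of_le hst] at hx; exact hx.2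
  have e2 : ∀ x ∈ uIcc t u, x ≤ t → x = t := fun x hx hxt => by
    rw [uIcc_of_le htu] at hx; exact le_antisymm hxt hx.1
  refine ⟨hst.trans htu, fun i k => absolutelyContinuousOnInterval_join hst htu (h₁.ac_R i k)
    (h₂.ac_R i k), fun i k => absolutelyContinuousOnInterval_join hst htu
      ((h₁.ac_Rh i k).congr ?_) ((h₂.ac_Rh i k).congr ?_),
    absolutelyContinuousOnInterval_join hst htu (h₁.ac_bh.congr ?_) (h₂.ac_bh.congr ?_), ?_, ?_⟩
  · intro x hx
    simp only [if_pos (e1 x hx)]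
  · intro x hx
    by_cases hxt : x ≤ t
    · simp only [e2 x hx hxt, hRh, ite_self]
    · simp only [if_neg hxt]
  · intro x hx
    simp only [if_pos (e1 x hx)]
  · intro x hx
    by_cases hxt : x ≤ t
    · simp only [e2 x hx hxt, hbh, ite_self]
    · simp only [if_neg hxt]
  · intro x hx
    rcases lt_trichotomy x t with hxt | rfl | hxt
    · simp only [if_pos hxt.le]
      exact h₁.mem x ⟨hx.1, hxt⟩
    · simpa using hmem
    · simp only [if_neg hxt.not_ge]
      exact h₂.mem x ⟨hxt, hx.2⟩
  · have hne : ∀ᵐ x : ℝ, x ≠ t := Measure.ae_ne volume t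
    filter_upwards [h₁.ae_flowAt, h₂.ae_flowAt, hne] with x hx1 hx2 hxt hx
    rcases lt_or_gt_of_ne hxt with hlt | hgt
    · refine (hx1 ⟨hx.1, hlt⟩).congr ?_ ?_ <;>
        filter_upwards [Iio_mem_nhds hlt] with y hy using if_pos (le_of_lt hy)
    · refine (hx2 ⟨hgt, hx.2⟩).congr ?_ ?_ <;>
        filter_upwards [Ioi_mem_nhds hgt] with y hy using if_neg (not_le.2 hy)

/-- A Lipschitz curve of rotations on `[a, T)` extends to `[a, T]`. -/
theorem exists_extension_SO3 {X : ℝ → SO3} {a T M : ℝ} (haT : a < T) (hM : 0 ≤ M)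
    (hX : ∀ s ∈ Ico a T, ∀ t ∈ Ico a T, s ≤ t → ∀ i k,
      |(X t : Mat3) i k - (X s : Mat3) i k| ≤ M * (t - s)) :
    ∃ X' : ℝ → SO3, (∀ t < T, X' t = X t) ∧
      ∀ i k, AbsolutelyContinuousOnInterval (fun t => (X' t : Mat3) i k) a T := by
  have hlip : ∀ i k, LipschitzOnWith M.toNNReal (fun t => (X t : Mat3) i k) (Ico a T) := by
    intro i k
    refine LipschitzOnWith.of_dist_le_mul fun s hs t ht => ?_
    rw [Real.coe_toNNReal _ hM, Real.dist_eq, Real.dist_eq]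
    rcases le_total s t with h | h
    · rw [abs_sub_comm, abs_sub_comm s t, abs_of_nonneg (sub_nonneg.2 h)]
      exact hX s hs t ht h i k
    · rw [abs_of_nonneg (sub_nonneg.2 h)]
      exact hX t ht s hs h i k
  choose g hg hgX using fun i k => (hlip i k).extend_real
  let G : ℝ → Mat3 := fun t i k => g i k t
  have hgc : Continuous G :=
    continuous_pi fun i => continuous_pi fun k => (hg i k).continuous
  have hgeq : ∀ t ∈ Ico a T, G t = (X t : Mat3) := fun t ht => by
    funext i k
    exact (hgX i k ht).symm
  have hT : G T ∈ Matrix.specialOrthogonalGroup (Fin 3) ℝ := by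
    have hcl : T ∈ closure (Ico a T) := by
      rw [closure_Ico haT.ne]; exact ⟨haT.le, le_rfl⟩
    have hsub : closure (Ico a T) ⊆ G ⁻¹'
        {A | A ∈ Matrix.specialOrthogonalGroup (Fin 3) ℝ} := by
      refine closure_minimal (fun t ht => ?_) (isClosed_SO3.preimage hgc)
      rw [mem_preimage, hgeq t ht]
      exact (X t).2
    exact hsub hcl
  refine ⟨fun t => if t < T then X t else ⟨_, hT⟩, fun t ht => if_pos ht, fun i k => ?_⟩
  refine (hg i k).lipschitzOnWith.absolutelyContinuousOnInterval.congr fun t ht => ?_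
  rw [uIcc_of_le haT.le] at ht
  by_cases htT : t < T
  · simp only [if_pos htT]
    exact (hgX i k ⟨ht.1, htT⟩).symm
  · simp only [if_neg htT]
    rw [le_antisymm ht.2 (not_lt.1 htT)]

theorem exists_extension_vec3 {x : ℝ → Vec3} {a T M : ℝ} (haT : a < T) (hM : 0 ≤ M)
    (hx : ∀ s ∈ Ico a T, ∀ t ∈ Ico a T, s ≤ t → ‖x t - x s‖ ≤ M * (t - s)) :
    ∃ x' : ℝ → Vec3, (∀ t < T, x' t = x t) ∧ AbsolutelyContinuousOnInterval x' a T := by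
  have hlip : LipschitzOnWith M.toNNReal x (Ico a T) := by
    refine LipschitzOnWith.of_dist_le_mul fun s hs t ht => ?_
    rw [Real.coe_toNNReal _ hM, dist_eq_norm, Real.dist_eq]
    rcases le_total s t with h | h
    · rw [norm_sub_rev, abs_sub_comm s t, abs_of_nonneg (sub_nonneg.2 h)]
      exact hx s hs t ht h
    · rw [abs_of_nonneg (sub_nonneg.2 h)]
      exact hx t ht s hs h
  obtain ⟨g, hg, hgx⟩ := hlip.extend_finite_dimension
  refine ⟨fun t => if t < T then x t else g t, fun t ht => if_pos ht, ?_⟩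
  refine hg.lipschitzOnWith.absolutelyContinuousOnInterval.congr fun t ht => ?_
  rw [uIcc_of_le haT.le] at ht
  by_cases htT : t < T
  · simp only [if_pos htT]
    exact (hgx ⟨ht.1, htT⟩).symm
  · simp only [if_neg htT]

/-- A flow with bounded bias estimate on a bounded half-open interval extends to the endpoint. -/
theorem exists_flowOn_closed (hd : Admissible d 𝒟 α₁ α₂ α₃ α₄) (hR : IsAttitude ω t₀ R)
    {c r : ℝ} (hω : ∀ t, t₀ ≤ t → ‖ω t‖ ≤ c) {q : 𝒬} {Rh : ℝ → SO3} {bh : ℝ → Vec3} {a T : ℝ}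
    (ha : t₀ ≤ a) (haT : a < T) (hflow : ∀ s ∈ Ico a T, FlowOn d ω b q R Rh bh a s)
    (hbh : ∀ s ∈ Ico a T, ‖bh s‖ ≤ r) :
    ∃ (Rh' : ℝ → SO3) (bh' : ℝ → Vec3), (∀ t < T, Rh' t = Rh t) ∧ (∀ t < T, bh' t = bh t) ∧
      FlowOn d ω b q R Rh' bh' a T := by
  have hc : 0 ≤ c := (norm_nonneg _).trans (hω a ha)
  have hr : 0 ≤ r := (norm_nonneg _).trans (hbh a ⟨le_rfl, haT⟩)
  have hγP := hd.γP_pos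
  have hγI := hd.γI_pos
  have hβ : ∀ u, (R u * (Rh u)⁻¹, q) ∈ flowSet d.Φ d.δ →
      ‖d.beta (R u * (Rh u)⁻¹) (Rh u) q‖ ≤ √α₄ * 2 := fun u hu =>
    (hd.norm_beta_le (Rh u) hu).trans
      (mul_le_mul_of_nonneg_left (attNorm_le_two _) (Real.sqrt_nonneg _))
  have hsub : ∀ s ∈ Ico a T, ∀ t ∈ Ico a T, s ≤ t → FlowOn d ω b q R Rh bh s t :=
    fun s hs t ht hst => (hflow t ht).mono hs.1 hst le_rfl
  set M := √2 * (c + ‖b‖ + r + d.γP * (√α₄ * 2)) with hM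
  obtain ⟨Rh', hRh', hRac⟩ := exists_extension_SO3 (X := Rh) (M := M) haT (by positivity) (by
    intro s hs t ht hst i k
    have hf := hsub s hs t ht hst
    refine abs_sub_le_of_ae_hasDerivAt_abs_le hst (hf.ac_Rh i k) ?_
    filter_upwards [hf.ae_flowAt] with u hu hut
    have hfu := hu hut
    have hua : a ≤ u := hs.1.trans hut.1.le
    refine ⟨_, hfu.deriv_Rh i k, (abs_apply_le_frobNorm _ _ _).trans ?_⟩
    rw [frobNorm_SO3_mul, frobNorm_skew]
    refine mul_le_mul_of_nonneg_left ?_ (Real.sqrt_nonneg _)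
    refine (norm_add_le _ _).trans (add_le_add ((norm_sub_le _ _).trans (add_le_add
      ((norm_add_le _ _).trans (add_le_add (hω u (ha.trans hua)) le_rfl))
      (hbh u ⟨hua, hut.2.trans ht.2⟩))) ?_)
    rw [norm_smul, Real.norm_of_nonneg hγP.le]
    exact mul_le_mul_of_nonneg_left (hβ u hfu.mem) hγP.le)
  obtain ⟨bh', hbh', hbac⟩ := exists_extension_vec3 (x := bh) (M := d.γI * (√α₄ * 2)) haT
    (by positivity) (by
    intro s hs t ht hst
    have hf := hsub s hs t ht hst
    refine norm_sub_le_of_ae_hasDerivAt_norm_le hst hf.ac_bh ?_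
    filter_upwards [hf.ae_flowAt] with u hu hut
    obtain ⟨v, hv, hbv⟩ := (hu hut).deriv_bh
    refine ⟨v, hbv, (norm_le_of_mem_krasovskii_proj hv).trans ?_⟩
    rw [norm_neg, norm_smul, Real.norm_of_nonneg hγI.le]
    exact mul_le_mul_of_nonneg_left (hβ u (hu hut).mem) hγI.le)
  refine ⟨Rh', bh', hRh', hbh', haT.le,
    fun i k => hR.1 i k a T haT.le fun u hu => ha.trans hu.1, hRac, hbac, ?_, ?_⟩
  · intro u hu
    rw [hRh' u hu.2]
    have hm : (u + T) / 2 ∈ Ico a T := ⟨by linarith [hu.1, hu.2], by linarith [hu.2]⟩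
    exact (hflow _ hm).mem u ⟨hu.1, by linarith [hu.2]⟩
  · -- a countable exhaustion of `(a, T)`
    obtain ⟨s, -, hsT, hs⟩ := exists_seq_strictMono_tendsto' haT
    have hall : ∀ᵐ u : ℝ, ∀ n, u ∈ Ioo a (s n) → FlowAt d (ω u) b q R Rh bh u :=
      ae_all_iff.2 fun n => (hflow (s n) ⟨(hsT n).1.le, (hsT n).2⟩).ae_flowAt
    filter_upwards [hall] with u hu huT
    obtain ⟨n, hn⟩ := (hs.eventually_const_lt huT.2).exists
    refine (hu n ⟨huT.1, hn⟩).congr ?_ ?_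
    · filter_upwards [Iio_mem_nhds huT.2] with y hy using hRh' y hy
    · filter_upwards [Iio_mem_nhds huT.2] with y hy using hbh' y hy

/-- The hybrid time domain with jump times `τ 1, …, τ J` and last interval `I`, such as
`[τ J, ∞)`, `[τ J, T]` or `[τ J, T)`. -/
def finiteDomain (τ : ℕ → ℝ) (J : ℕ) (I : Set ℝ) : Set (ℝ × ℕ) :=
  {x | (x.2 < J ∧ x.1 ∈ Icc (τ x.2) (τ (x.2 + 1))) ∨ (x.2 = J ∧ x.1 ∈ I)}

/-- A maximal solution already contains every flow that extends its last piece. -/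
theorem IsMaximalSolution.mem_of_flowOn {x : Arc 𝒬} (hx : IsMaximalSolution d ω b t₀ R x)
    {τ : ℕ → ℝ} (hτ : Monotone τ) (hτ0 : τ 0 = t₀) {J : ℕ} {I : Set ℝ}
    (hdom : x.dom = finiteDomain τ J I) {T : ℝ} (hI : I ⊆ Icc (τ J) T) (hmemI : τ J ∈ I)
    {Rh : ℝ → SO3} {bh : ℝ → Vec3} (hRh : ∀ t ∈ I, Rh t = x.Rhat t J)
    (hbh : ∀ t ∈ I, bh t = x.bhat t J)
    (hflow : FlowOn d ω b (x.q (τ J) J) R Rh bh (τ J) T) : T ∈ I := by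
  classical
  obtain ⟨hsol, hmax⟩ := hx
  have hT : τ J ≤ T := hflow.le
  have hxJ : ∀ t, (t, J) ∈ x.dom ↔ t ∈ I := fun t => by
    rw [hdom]; simp [finiteDomain]
  let y : Arc 𝒬 :=
    { dom := finiteDomain τ J (Icc (τ J) T)
      Rhat := fun t j => if j = J then Rh t else x.Rhat t j
      bhat := fun t j => if j = J then bh t else x.bhat t j
      q := fun t j => if j = J then x.q (τ J) J else x.q t j }
  have hyint : y.interval J = Icc (τ J) T := by
    ext t; simp [Arc.interval, y, finiteDomain]
  have hdomj : ∀ j ≠ J, ∀ t, (t, j) ∈ y.dom ↔ (t, j) ∈ x.dom := fun j hj t => by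
    rw [hdom]; simp [y, finiteDomain, hj]
  have hyint' : ∀ j ≠ J, y.interval j = x.interval j := fun j hj => by
    ext t; exact hdomj j hj t
  have hyR : ∀ j ≠ J, ∀ t, y.Rhat t j = x.Rhat t j := fun j hj t => if_neg hj
  have hyb : ∀ j ≠ J, ∀ t, y.bhat t j = x.bhat t j := fun j hj t => if_neg hj
  have hyq : ∀ j ≠ J, ∀ t, y.q t j = x.q t j := fun j hj t => if_neg hj
  have hyRJ : ∀ t, y.Rhat t J = Rh t := fun t => if_pos rfl
  have hybJ : ∀ t, y.bhat t J = bh t := fun t => if_pos rfl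
  have hyqJ : ∀ t, y.q t J = x.q (τ J) J := fun t => if_pos rfl
  have hyt : ∀ j ≠ J, ∀ t, y.Rtilde R t j = x.Rtilde R t j := fun j hj t => by
    rw [Arc.Rtilde, Arc.Rtilde, hyR j hj]
  have hends : ∀ᵐ t : ℝ, t ∈ Icc (τ J) T → t ∈ Ioo (τ J) T := by
    filter_upwards [Measure.ae_ne volume (τ J), Measure.ae_ne volume T] with t h1 h2 h3
    exact ⟨lt_of_le_of_ne h3.1 h1.symm, lt_of_le_of_ne h3.2 h2⟩
  -- the two states at a jump time
  have hjump : ∀ t j, (t, j) ∈ y.dom → (t, j + 1) ∈ y.dom → j ≠ J ∧ (t, j) ∈ x.dom ∧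
      (t, j + 1) ∈ x.dom ∧ y.Rhat t (j + 1) = x.Rhat t (j + 1) ∧
      y.bhat t (j + 1) = x.bhat t (j + 1) ∧ y.q t (j + 1) = x.q t (j + 1) := by
    intro t j h1 h2
    have hjJ : j ≠ J := by
      rintro rfl
      rcases h2 with ⟨h2, -⟩ | ⟨h2, -⟩ <;> simp at h2
    have hx1 := (hdomj j hjJ t).1 h1
    by_cases hj1 : j + 1 = J
    · subst hj1
      have htτ : t = τ (j + 1) := by
        have h3 : t ∈ Icc (τ (j + 1)) T := by rw [← hyint]; exact h2
        rcases h1 with ⟨-, h1⟩ | ⟨h1, -⟩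
        · exact le_antisymm h1.2 h3.1
        · exact absurd h1 hjJ
      subst htτ
      refine ⟨hjJ, hx1, (hxJ _).2 hmemI, ?_, ?_, ?_⟩
      · rw [hyRJ, hRh _ hmemI]
      · rw [hybJ, hbh _ hmemI]
      · rw [hyqJ]
    · exact ⟨hjJ, hx1, (hdomj _ hj1 t).1 h2, hyR _ hj1 t, hyb _ hj1 t, hyq _ hj1 t⟩
  have hy : IsSolution d ω b t₀ R y := by
    constructor
    · exact ⟨τ, hτ, hτ0, Or.inr ⟨J, _, Or.inr (Or.inl ⟨T, hT, rfl⟩), rfl⟩⟩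
    · intro j
      by_cases hj : j = J
      · subst hj
        intro i k s t hst hsub
        rw [hyint, Icc_subset_Icc_iff hst] at hsub
        simp only [hyRJ]
        exact (hflow.mono hsub.1 hst hsub.2).ac_Rh i k
      · simp only [hyR j hj, hyint' j hj]
        exact hsol.ac_Rhat j
    · intro j
      by_cases hj : j = J
      · subst hj
        intro s t hst hsub
        rw [hyint, Icc_subset_Icc_iff hst] at hsub
        simp only [hybJ]
        exact (hflow.mono hsub.1 hst hsub.2).ac_bh
      · simp only [hyb j hj, hyint' j hj]
        exact hsol.ac_bhat j
    · intro j s hs t ht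
      by_cases hj : j = J
      · subst hj
        rw [hyqJ, hyqJ]
      · rw [hyint' j hj] at hs ht
        rw [hyq j hj, hyq j hj]
        exact hsol.flow_q j s hs t ht
    · intro j t ht
      by_cases hj : j = J
      · subst hj
        rw [hyint, interior_Icc] at ht
        rw [Arc.Rtilde, hyRJ, hyqJ]
        exact hflow.mem t ht
      · rw [hyint' j hj] at ht
        rw [hyt j hj, hyq j hj]
        exact hsol.flow_mem j t ht
    · intro j
      by_cases hj : j = J
      · subst hj
        filter_upwards [hflow.ae_flowAt, hends] with t h1 h2 h3
        rw [hyint] at h3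
        simp only [Arc.Rtilde, hyRJ, hybJ, hyqJ]
        exact (h1 (h2 h3)).deriv_Rh
      · simp only [hyint' j hj, hyR j hj, hyb j hj, hyq j hj, hyt j hj]
        exact hsol.flow_Rhat j
    · intro j
      by_cases hj : j = J
      · subst hj
        filter_upwards [hflow.ae_flowAt, hends] with t h1 h2 h3
        rw [hyint] at h3
        simp only [Arc.Rtilde, hyRJ, hybJ, hyqJ]
        exact (h1 (h2 h3)).deriv_bh
      · simp only [hyint' j hj, hyR j hj, hyb j hj, hyq j hj, hyt j hj]
        exact hsol.flow_bhat j
    · intro t j h1 h2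
      obtain ⟨hj, hx1, hx2, -⟩ := hjump t j h1 h2
      rw [hyt j hj, hyq j hj]
      exact hsol.jump_mem t j hx1 hx2
    · intro t j h1 h2
      obtain ⟨hj, hx1, hx2, -, -, e⟩ := hjump t j h1 h2
      rw [hyt j hj, e]
      exact hsol.jump_q t j hx1 hx2
    · intro t j h1 h2
      obtain ⟨hj, hx1, hx2, e, -⟩ := hjump t j h1 h2
      rw [e, hyR j hj]
      exact hsol.jump_Rhat t j hx1 hx2
    · intro t j h1 h2
      obtain ⟨hj, hx1, hx2, -, e, -⟩ := hjump t j h1 h2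
      rw [e, hyb j hj]
      exact hsol.jump_bhat t j hx1 hx2
  have hext : x.ExtendedBy y := by
    constructor
    · rw [hdom]
      rintro p (hp | ⟨hp, hpI⟩)
      · exact Or.inl hp
      · exact Or.inr ⟨hp, hI hpI⟩
    · intro t j htj
      by_cases hj : j = J
      · subst hj
        have htI := (hxJ t).1 htj
        rw [hyRJ, hybJ, hyqJ]
        exact ⟨hRh t htI, hbh t htI, hsol.flow_q j _ ((hxJ _).2 hmemI) t htj⟩
      · exact ⟨hyR j hj t, hyb j hj t, hyq j hj t⟩
  have heq := hmax y hy hext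
  rw [← hxJ, ← heq]
  exact Or.inr ⟨rfl, hT, le_rfl⟩

/-- A maximal solution cannot end in the jump set. -/
theorem IsMaximalSolution.notMem_jumpSet {x : Arc 𝒬} (hx : IsMaximalSolution d ω b t₀ R x)
    {τ : ℕ → ℝ} (hτ : Monotone τ) (hτ0 : τ 0 = t₀) {J : ℕ} {T : ℝ} (hT : τ J ≤ T)
    (hdom : x.dom = finiteDomain τ J (Icc (τ J) T)) :
    (x.Rtilde R T J, x.q T J) ∉ jumpSet d.Φ d.δ := by
  classical
  intro hmem
  obtain ⟨hsol, hmax⟩ := hx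
  have hne : Nonempty 𝒬 := ⟨x.q T J⟩
  obtain ⟨p₀, hp₀⟩ := Finite.exists_min fun p => d.Φ (x.Rtilde R T J) p
  let σ : ℕ → ℝ := fun k => if k ≤ J then τ k else T
  have hσ : ∀ k ≤ J, σ k = τ k := fun k hk => if_pos hk
  have hσ' : σ (J + 1) = T := if_neg (by omega)
  have hσm : Monotone σ := by
    refine monotone_nat_of_le_succ fun n => ?_
    rcases lt_trichotomy n J with h | rfl | h
    · rw [hσ n h.le, hσ (n + 1) h]; exact hτ (Nat.le_succ n)
    · rw [hσ n le_rfl, hσ']; exact hT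
    · simp only [σ, if_neg (show ¬ n ≤ J by omega), if_neg (show ¬ n + 1 ≤ J by omega), le_rfl]
  let y : Arc 𝒬 :=
    { dom := finiteDomain σ (J + 1) (Icc T T)
      Rhat := fun t j => if j = J + 1 then x.Rhat T J else x.Rhat t j
      bhat := fun t j => if j = J + 1 then x.bhat T J else x.bhat t j
      q := fun t j => if j = J + 1 then p₀ else x.q t j }
  have hdomj : ∀ j ≠ J + 1, ∀ t, (t, j) ∈ y.dom ↔ (t, j) ∈ x.dom := fun j hj t => by
    rw [hdom]
    simp only [y, finiteDomain, mem_ofPred_eq]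
    rcases lt_trichotomy j J with h | rfl | h
    · rw [hσ j h.le, hσ (j + 1) h]
      simp [h, h.ne, hj, Nat.lt_succ_of_lt h]
    · rw [hσ j le_rfl, hσ']
      simp
    · simp [show ¬ j < J + 1 by omega, hj, show ¬ j < J by omega, h.ne']
  have hdomJ : ∀ t, (t, J + 1) ∈ y.dom ↔ t = T := fun t => by
    simp [y, finiteDomain]
  have hyint : y.interval (J + 1) = {T} := by
    ext t; exact hdomJ t
  have hyint' : ∀ j ≠ J + 1, y.interval j = x.interval j := fun j hj => by
    ext t; exact hdomj j hj t
  have hyR : ∀ j ≠ J + 1, ∀ t, y.Rhat t j = x.Rhat t j := fun j hj t => if_neg hj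
  have hyb : ∀ j ≠ J + 1, ∀ t, y.bhat t j = x.bhat t j := fun j hj t => if_neg hj
  have hyq : ∀ j ≠ J + 1, ∀ t, y.q t j = x.q t j := fun j hj t => if_neg hj
  have hyRJ : ∀ t, y.Rhat t (J + 1) = x.Rhat T J := fun t => if_pos rfl
  have hybJ : ∀ t, y.bhat t (J + 1) = x.bhat T J := fun t => if_pos rfl
  have hyqJ : ∀ t, y.q t (J + 1) = p₀ := fun t => if_pos rfl
  have hyt : ∀ j ≠ J + 1, ∀ t, y.Rtilde R t j = x.Rtilde R t j := fun j hj t => by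
    rw [Arc.Rtilde, Arc.Rtilde, hyR j hj]
  have hne' : ∀ᵐ t : ℝ, t ≠ T := Measure.ae_ne volume T
  have hjump : ∀ t j, (t, j) ∈ y.dom → (t, j + 1) ∈ y.dom → j ≠ J + 1 ∧
      (t = T ∧ j = J ∨ j + 1 ≠ J + 1 ∧ (t, j) ∈ x.dom ∧ (t, j + 1) ∈ x.dom) := by
    intro t j h1 h2
    have hj : j ≠ J + 1 := by
      rintro rfl
      rcases h2 with ⟨h2, -⟩ | ⟨h2, -⟩ <;> simp at h2
    refine ⟨hj, ?_⟩
    by_cases hj1 : j + 1 = J + 1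
    · rw [hj1, hdomJ] at h2
      exact Or.inl ⟨h2, by omega⟩
    · exact Or.inr ⟨hj1, (hdomj j hj t).1 h1, (hdomj _ hj1 t).1 h2⟩
  have hy : IsSolution d ω b t₀ R y := by
    constructor
    · refine ⟨σ, hσm, by rw [hσ 0 (Nat.zero_le _), hτ0], Or.inr ⟨J + 1, Icc T T,
        Or.inr (Or.inl ⟨T, hσ'.le, by rw [hσ']⟩), rfl⟩⟩
    · intro j
      by_cases hj : j = J + 1
      · subst hj
        intro i k s t hst hsub
        simp only [hyRJ]
        exact (LipschitzWith.const _).lipschitzOnWith.absolutelyContinuousOnInterval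
      · simp only [hyR j hj, hyint' j hj]
        exact hsol.ac_Rhat j
    · intro j
      by_cases hj : j = J + 1
      · subst hj
        intro s t hst hsub
        simp only [hybJ]
        exact (LipschitzWith.const _).lipschitzOnWith.absolutelyContinuousOnInterval
      · simp only [hyb j hj, hyint' j hj]
        exact hsol.ac_bhat j
    · intro j s hs t ht
      by_cases hj : j = J + 1
      · subst hj
        rw [hyqJ, hyqJ]
      · rw [hyint' j hj] at hs ht
        rw [hyq j hj, hyq j hj]
        exact hsol.flow_q j s hs t ht
    · intro j t ht
      by_cases hj : j = J + 1
      · subst hj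
        rw [hyint, interior_singleton] at ht
        exact absurd ht (notMem_empty t)
      · rw [hyint' j hj] at ht
        rw [hyt j hj, hyq j hj]
        exact hsol.flow_mem j t ht
    · intro j
      by_cases hj : j = J + 1
      · subst hj
        filter_upwards [hne'] with t h1 h2
        rw [hyint] at h2
        exact absurd h2 h1
      · simp only [hyint' j hj, hyR j hj, hyb j hj, hyq j hj, hyt j hj]
        exact hsol.flow_Rhat j
    · intro j
      by_cases hj : j = J + 1
      · subst hj
        filter_upwards [hne'] with t h1 h2
        rw [hyint] at h2
        exact absurd h2 h1
      · simp only [hyint' j hj, hyR j hj, hyb j hj, hyq j hj, hyt j hj]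
        exact hsol.flow_bhat j
    · intro t j h1 h2
      obtain ⟨hj, ⟨rfl, rfl⟩ | ⟨hj1, hx1, hx2⟩⟩ := hjump t j h1 h2 <;> rw [hyt _ hj, hyq _ hj]
      · exact hmem
      · exact hsol.jump_mem t j hx1 hx2
    · intro t j h1 h2
      obtain ⟨hj, ⟨rfl, rfl⟩ | ⟨hj1, hx1, hx2⟩⟩ := hjump t j h1 h2 <;> rw [hyt _ hj]
      · rw [hyqJ]
        exact hp₀
      · rw [hyq _ hj1]
        exact hsol.jump_q t j hx1 hx2
    · intro t j h1 h2
      obtain ⟨hj, ⟨rfl, rfl⟩ | ⟨hj1, hx1, hx2⟩⟩ := hjump t j h1 h2 <;> rw [hyR _ hj]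
      · rw [hyRJ]
      · rw [hyR _ hj1]
        exact hsol.jump_Rhat t j hx1 hx2
    · intro t j h1 h2
      obtain ⟨hj, ⟨rfl, rfl⟩ | ⟨hj1, hx1, hx2⟩⟩ := hjump t j h1 h2 <;> rw [hyb _ hj]
      · rw [hybJ]
      · rw [hyb _ hj1]
        exact hsol.jump_bhat t j hx1 hx2
  have hnotJ : ∀ t, (t, J + 1) ∉ x.dom := fun t => by
    rw [hdom]; simp [finiteDomain]
  have hext : x.ExtendedBy y := by
    constructor
    · rintro ⟨t, j⟩ htj
      have hj : j ≠ J + 1 := by rintro rfl; exact hnotJ t htj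
      exact (hdomj j hj t).2 htj
    · intro t j htj
      have hj : j ≠ J + 1 := by rintro rfl; exact hnotJ t htj
      exact ⟨hyR j hj t, hyb j hj t, hyq j hj t⟩
  have heq := hmax y hy hext
  exact hnotJ T (heq ▸ (hdomJ T).2 rfl)

/-- Maximal solutions with bounded bias estimate are complete: at the end of a bounded domain it is
possible to pass to the limit, to jump, or to flow. -/
theorem IsMaximalSolution.complete {x : Arc 𝒬} (hx : IsMaximalSolution d ω b t₀ R x)
    (hd : Admissible d 𝒟 α₁ α₂ α₃ α₄) (hR : IsAttitude ω t₀ R)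
    {c r : ℝ} (hω : ∀ t, t₀ ≤ t → ‖ω t‖ ≤ c) (hr : ∀ t j, (t, j) ∈ x.dom → ‖x.bhat t j‖ ≤ r) :
    x.Complete := by
  have hsol := hx.1
  obtain ⟨τ, hτ, hτ0, hdom | ⟨J, I, hI, hdom⟩⟩ := hsol.dom
  · intro M
    refine ⟨τ ⌈M - t₀⌉₊, ⌈M - t₀⌉₊, ?_, ?_⟩
    · rw [hdom]; exact ⟨le_rfl, hτ (Nat.le_succ _)⟩
    · have h1 : t₀ ≤ τ ⌈M - t₀⌉₊ := by rw [← hτ0]; exact hτ (Nat.zero_le _)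
      linarith [Nat.le_ceil (M - t₀)]
  change x.dom = finiteDomain τ J I at hdom
  have hxJ : ∀ t, (t, J) ∈ x.dom ↔ t ∈ I := fun t => by
    rw [hdom]; simp [finiteDomain]
  have ht₀ : t₀ ≤ τ J := by rw [← hτ0]; exact hτ (Nat.zero_le _)
  rcases hI with rfl | ⟨T, hT, rfl⟩ | ⟨T, hT, rfl⟩
  · intro M
    refine ⟨max M (τ J), J, (hxJ _).2 (mem_Ici.2 (le_max_right _ _)), ?_⟩
    have h1 := le_max_left M (τ J)
    have h2 : (0 : ℝ) ≤ J := Nat.cast_nonneg J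
    linarith
  · exfalso
    have hmemT : (T, J) ∈ x.dom := (hxJ T).2 ⟨hT, le_rfl⟩
    have hmemτ : (τ J, J) ∈ x.dom := (hxJ _).2 ⟨le_rfl, hT⟩
    have hq : x.q T J = x.q (τ J) J := hsol.flow_q J T hmemT _ hmemτ
    have hnot := hx.notMem_jumpSet hτ hτ0 hT hdom
    rw [hq] at hnot
    obtain ⟨h, hh, Rh, bh, hRh, hbh, hflow, hmem⟩ :=
      hd.exists_flowOn hR b (ht₀.trans hT) (x.Rhat T J) (x.bhat T J) hnot
    have hmT := hmem T ⟨le_rfl, by linarith⟩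
    rw [hRh] at hmT
    have hjoin := (hsol.flowOn hR hT hmemτ hmemT).join hflow hRh hbh hmT
    have hend := hx.mem_of_flowOn hτ hτ0 hdom (T := T + h)
      (Icc_subset_Icc_right (by linarith)) ⟨le_rfl, hT⟩
      (fun t ht => if_pos ht.2) (fun t ht => if_pos ht.2) hjoin
    linarith [hend.2]
  · exfalso
    have hmemτ : (τ J, J) ∈ x.dom := (hxJ _).2 ⟨le_rfl, hT⟩
    obtain ⟨Rh, bh, hRh, hbh, hflow⟩ := exists_flowOn_closed hd hR hω ht₀ hT
      (fun s hs => hsol.flowOn hR hs.1 hmemτ ((hxJ s).2 hs))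
      (fun s hs => hr s J ((hxJ s).2 hs))
    have hend := hx.mem_of_flowOn hτ hτ0 hdom Ico_subset_Icc_self ⟨le_rfl, hT⟩
      (fun t ht => hRh t ht.2) (fun t ht => hbh t ht.2) hflow
    exact lt_irrefl T hend.2

end

end HybridObserver

theorem corollary1 (𝒬 : Finset ℕ) (d : Design 𝒬) (𝒟 : Set (SO3 × 𝒬))
    (hγP : 0 < d.γP) (hγI : 0 < d.γI) (hδ : 0 < d.δ)
    (hΦ : IsPotential d.Φ 𝒟) (hF : flowSet d.Φ d.δ ⊆ 𝒟)
    (α₁ α₂ α₃ α₄ : ℝ) (hα₁ : 0 < α₁) (hα₂ : 0 < α₂) (hα₃ : 0 < α₃) (hα₄ : 0 < α₄)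
    (hΦ₁ : ∀ X q, α₁ * attNorm X ^ 2 ≤ d.Φ X q ∧ d.Φ X q ≤ α₂ * attNorm X ^ 2)
    (hΦ₂ : ∀ X q, (X, q) ∈ flowSet d.Φ d.δ →
      α₃ * attNorm X ^ 2 ≤ frobNorm (gradSO3 (fun Y => d.Φ Y q) X) ^ 2 ∧
        frobNorm (gradSO3 (fun Y => d.Φ Y q) X) ^ 2 ≤ α₄ * attNorm X ^ 2)
    (cω r : ℝ) (hr : d.bbar ≤ r) :
    ∃ k lam : ℝ, 0 < k ∧ 0 < lam ∧ ∃ N : ℕ,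
      ∀ (ω : ℝ → Vec3) (b : Vec3) (t₀ : ℝ) (R : ℝ → SO3) (x : Arc 𝒬),
        (∀ t, t₀ ≤ t → ‖ω t‖ ≤ cω) → ‖b‖ ≤ d.bbar → IsAttitude ω t₀ R →
        IsSolution d ω b t₀ R x → ‖x.bhat t₀ 0‖ ≤ r →
          (∀ t j, (t, j) ∈ x.dom →
            ‖x.bhat t j‖ ≤ r ∧ j ≤ N ∧
              x.errNorm b R t j ≤ k * Real.exp (-lam * (t - t₀ + j)) * x.errNorm b R t₀ 0) ∧
          (IsMaximalSolution d ω b t₀ R x → x.Complete) := by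
  -- a negative bound contradicts the hypotheses on the bias or the angular velocity
  by_cases hb0 : 0 ≤ d.bbar
  swap
  · exact ⟨1, 1, one_pos, one_pos, 0, fun ω b t₀ R x _ hb =>
      absurd ((norm_nonneg b).trans hb) hb0⟩
  by_cases hc0 : 0 ≤ cω
  swap
  · exact ⟨1, 1, one_pos, one_pos, 0, fun ω b t₀ R x hω =>
      absurd ((norm_nonneg (ω t₀)).trans (hω t₀ le_rfl)) hc0⟩
  have hd : Admissible d 𝒟 α₁ α₂ α₃ α₄ :=
    ⟨hγP, hγI, hb0, hΦ, hF, hα₁, hα₂, hα₄, hΦ₁, hΦ₂⟩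
  have hr0 : 0 ≤ r := hb0.trans hr
  set D := (4 * (r + d.bbar) + 2 * d.γP * √α₄ + 4 * cω) ^ 2 / 4 + 4 * d.γI * √α₄ with hD
  have hD0 : 0 ≤ D := by positivity
  -- the first bound on `ε` makes the Lyapunov function positive definite, the second one lets
  -- the dissipation of the attitude error absorb the cross term
  obtain ⟨ε, hε0, hε1, hε2, hε⟩ : ∃ ε : ℝ, 0 < ε ∧ ε ≤ 1 ∧ 16 * ε ≤ α₁ / d.γI ∧
      ε * D ≤ d.γP * α₃ / 2 := by
    refine ⟨min 1 (min (α₁ / d.γI / 16) (d.γP * α₃ / 2 / (D + 1))), by positivity,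
      min_le_left _ _, ?_, ?_⟩
    · have := (min_le_right 1 (min (α₁ / d.γI / 16) (d.γP * α₃ / 2 / (D + 1)))).trans
        (min_le_left _ _)
      linarith
    · have h1 := (min_le_right 1 (min (α₁ / d.γI / 16) (d.γP * α₃ / 2 / (D + 1)))).trans
        (min_le_right _ _)
      refine (mul_le_mul_of_nonneg_right h1 hD0).trans ?_
      rw [div_mul_eq_mul_div, div_le_iff₀ (by positivity)]
      have h2 : 0 ≤ d.γP * α₃ / 2 := by positivity
      nlinarith
  set c₁ := min (α₁ / 2) (1 / (2 * d.γI)) with hc₁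
  have hc₁0 : 0 < c₁ := lt_min (by positivity) (by positivity)
  set c₂ := α₂ + 1 / d.γI + 2 with hc₂
  have hc₂0 : 0 < c₂ := by positivity
  set c₃ := min (d.γP * α₃ / 2) ε with hc₃
  have hc₃0 : 0 < c₃ := lt_min (by positivity) hε0
  set lam := c₃ / c₂ with hlam
  have hlam0 : 0 < lam := by positivity
  have hlamc : lam * c₂ ≤ c₃ := by rw [hlam, div_mul_cancel₀ _ hc₂0.ne']
  set N := ⌈c₂ * (3 / 2 + (r + d.bbar) ^ 2) / d.δ⌉₊ with hN
  -- the factor `exp (lam / 2 * N)` converts decay in `t` into decay in `t + j`, as `j ≤ N`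
  refine ⟨√(c₂ / c₁) * Real.exp (lam / 2 * N), lam / 2, by positivity, by positivity, N, ?_⟩
  intro ω b t₀ R x hω hb hR hx hx0
  have hest := fun t j (ht : (t, j) ∈ x.dom) =>
    hx.lyap_estimates hR hd hδ hb hr hω hx0 hε0 hε1 hε2 hε hlam0.le hlamc ht
  refine ⟨fun t j ht => ?_, fun hmax => hmax.complete hd hR hω fun t j ht => (hest t j ht).1⟩
  obtain ⟨hbr, hW, hWe⟩ := hest t j ht
  have hlow : c₁ * (attNorm (x.Rtilde R t j) ^ 2 + ‖x.bhat t j - b‖ ^ 2) ≤ x.lyap d ε b R t j :=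
    hd.le_lyapunov hε0.le hε1 hε2 _ _ _ _ _
  have hup : x.lyap d ε b R t₀ 0
      ≤ c₂ * (attNorm (x.Rtilde R t₀ 0) ^ 2 + ‖x.bhat t₀ 0 - b‖ ^ 2) :=
    hd.lyapunov_le hε0.le hε1 _ _ _ _ _
  have hj : j ≤ N := by
    have h1 : ‖x.bhat t₀ 0 - b‖ ≤ r + d.bbar := (norm_sub_le _ _).trans (add_le_add hx0 hb)
    have h2 : ‖x.bhat t₀ 0 - b‖ ^ 2 ≤ (r + d.bbar) ^ 2 := pow_le_pow_left₀ (norm_nonneg _) h1 2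
    have h3 : x.lyap d ε b R t₀ 0 ≤ c₂ * (3 / 2 + (r + d.bbar) ^ 2) :=
      hup.trans (mul_le_mul_of_nonneg_left (add_le_add (attNorm_sq_le _) h2) hc₂0.le)
    have h4 : 0 ≤ x.lyap d ε b R t j := le_trans (by positivity) hlow
    have h5 : (j : ℝ) ≤ c₂ * (3 / 2 + (r + d.bbar) ^ 2) / d.δ := by
      rw [le_div_iff₀ hδ]
      linarith
    exact_mod_cast h5.trans (Nat.le_ceil _)
  refine ⟨hbr, hj, ?_⟩
  set e := attNorm (x.Rtilde R t j) ^ 2 + ‖x.bhat t j - b‖ ^ 2 with he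
  set e₀ := attNorm (x.Rtilde R t₀ 0) ^ 2 + ‖x.bhat t₀ 0 - b‖ ^ 2 with he₀
  have he₀0 : 0 ≤ e₀ := by positivity
  have hmain : e ≤ c₂ / c₁ * (Real.exp (-lam * (t - t₀)) * e₀) := by
    rw [div_mul_eq_mul_div, le_div_iff₀ hc₁0]
    have h1 := mul_le_mul_of_nonneg_left hup (Real.exp_pos (-lam * (t - t₀))).le
    linarith
  change √e ≤ _ * √e₀
  refine Real.sqrt_le_iff.2 ⟨by positivity, hmain.trans ?_⟩
  rw [mul_pow, mul_pow, mul_pow, Real.sq_sqrt (by positivity), Real.sq_sqrt he₀0, mul_assoc,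
    mul_assoc, ← mul_assoc (Real.exp _ ^ 2), ← Real.exp_nat_mul, ← Real.exp_nat_mul, ← Real.exp_add]
  refine mul_le_mul_of_nonneg_left (mul_le_mul_of_nonneg_right (Real.exp_le_exp.2 ?_) he₀0)
    (by positivity)
  have hjN : (j : ℝ) ≤ N := by exact_mod_cast hj
  push_cast
  nlinarith
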